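/- Write $z=x+iy$, $u=f+ig$, $p=h+il$. Let $W$ be an open set of points $(x,y,f,g,h,l)\in\mathbb R^6$, let $w_1,w_2$ be continuous real functions on $W$, and let $\Omega\subset\mathbb C^2$ be the (open) set of all $(z,u)$ such that $(z,u,p)\in W$ for some $p$. Consider, for pairs $(f,g)$ of real functions of $(x,y)$ that satisfy the Cauchy–Riemann equations $f_x=g_y$, $f_y=-g_x$, the system $$f_{xx}-f_{yy}+2g_{xy}=4w_1(x,y,f,g,h,l),\qquad g_{xx}-g_{yy}-2f_{xy}=4w_2(x,y,f,g,h,l),\tag{1}$$ where $2h=f_x+g_y$ and $2l=g_x-f_y$. The system (1) is called *complex-linearizable* if every point of $\Omega$ has an open neighbourhood $N\subset\mathbb C^2$ with a biholomorphic point transformation $(z,u)\mapsto(Z,U)$ of $N$ onto an open subset of $\mathbb C^2$, and holomorphic functions $a=a^1+ia^2$, $b=b^1+ib^2$, $c=c^1+ic^2$ of $Z=X+iY$ on the set of values of $Z$, such that the transformation turns (1) into the linear system $$F_{XX}-F_{YY}+2G_{XY}=4(a^1H-a^2L+b^1F-b^2G+c^1),\quad G_{XX}-G_{YY}-2F_{XY}=4(a^1L+a^2H+b^1G+b^2F+c^2),\tag{2}$$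 $2H=F_X+G_Y$, $2L=G_X-F_Y$, that is, $U''=a(Z)U'+b(Z)U+c(Z)$ with $U=F+iG$. Here "turns (1) into (2)" means: whenever $(f,g)$ satisfies the Cauchy–Riemann equations near a point $(x,y)$, its graph there lies in $N$ and its values $(x,y,f,g,h,l)$ there lie in $W$, and the derivative of $z\mapsto Z(z,u(z))$ does not vanish there, then for the pair $(F,G)$ defined near the image point by $F+iG=U(z,u(z))$ as a function of $Z=Z(z,u(z))$, $(f,g)$ satisfies (1) at $(x,y)$ if and only if $(F,G)$ satisfies (2) at the image point. **Theorem.** The system (1) is complex-linearizable if and only if there are real functions $A^i,B^i,C^i,D^i$ $(i=1,2)$ of $(x,y,f,g)$ on $\Omega$, such that $A=A^1+iA^2$, $B=B^1+iB^2$, $C=C^1+iC^2$, $D=D^1+iD^2$ are holomorphic functions of $(z,u)$, with the following two properties. First, on $W$, $$\begin{aligned}4w_1={}&4A^1h^3-12A^1hl^2-12A^2h^2l+4A^2l^3+4B^1h^2-4B^1l^2-8B^2hl+4C^1h-4C^2l+4D^1,\\ 4w_2={}&12A^1h^2l-4A^1l^3+4A^2h^3-12A^2hl^2+8B^1hl+4B^2h^2-4B^2l^2+4C^2h+4C^1l+4D^2\end{aligned}$$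 (that is, (1) is $u''=Au'^3+Bu'^2+Cu'+D$). Second, on $\Omega$, $$\begin{aligned} &3A^1_{xx}-3A^1_{yy}+6A^2_{xy}+6C^1A^1_x+6C^1A^2_y-6C^2A^2_x+6C^2A^1_y-6D^1A^1_f-6D^1A^2_g+6D^2A^2_f-6D^2A^1_g\\ &\quad+6A^1C^1_x+6A^1C^2_y-6A^2C^2_x+6A^2C^1_y+C^1_{ff}-C^1_{gg}+2C^2_{fg}-12A^1D^1_f-12A^1D^2_g+12A^2D^2_f-12A^2D^1_g\\ &\quad+2B^1C^1_f+2B^1C^2_g-2B^2C^2_f+2B^2C^1_g-4B^1B^1_x-4B^1B^2_y+4B^2B^2_x-4B^2B^1_y-2B^1_{xf}-2B^2_{yf}-2B^2_{xg}+2B^1_{yg}=0,\\[4pt] &3A^2_{xx}-3A^2_{yy}-6A^1_{xy}+6C^2A^1_x+6C^2A^2_y+6C^1A^2_x-6C^1A^1_y-6D^2A^1_f-6D^2A^2_g-6D^1A^2_f+6D^1A^1_g\\ &\quad+6A^2C^1_x+6A^2C^2_y+6A^1C^2_x-6A^1C^1_y+C^2_{ff}-C^2_{gg}-2C^1_{fg}-12A^2D^1_f-12A^2D^2_g-12A^1D^2_f+12A^1D^1_g\\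 &\quad+2B^2C^1_f+2B^2C^2_g+2B^1C^2_f-2B^1C^1_g-4B^2B^1_x-4B^2B^2_y-4B^1B^2_x+4B^1B^1_y-2B^2_{xf}+2B^1_{yf}+2B^1_{xg}+2B^2_{yg}=0,\\[4pt] &12D^1A^1_x+12D^1A^2_y-12D^2A^2_x+12D^2A^1_y-6D^1B^1_f-6D^1B^2_g+6D^2B^2_f-6D^2B^1_g+6A^1D^1_x+6A^1D^2_y-6A^2D^2_x+6A^2D^1_y\\ &\quad+B^1_{xx}-B^1_{yy}+2B^2_{xy}-2C^1_{xf}-2C^2_{yf}-2C^2_{xg}+2C^1_{yg}-6B^1D^1_f-6B^1D^2_g+6B^2D^2_f-6B^2D^1_g\\ &\quad+3D^1_{ff}-3D^1_{gg}+6D^2_{fg}+4C^1C^1_f+4C^1C^2_g-4C^2C^2_f+4C^2C^1_g-2C^1B^1_x-2C^1B^2_y+2C^2B^2_x-2C^2B^1_y=0,\\[4pt] &12D^2A^1_x+12D^2A^2_y+12D^1A^2_x-12D^1A^1_y-6D^2B^1_f-6D^2B^2_g-6D^1B^2_f+6D^1B^1_g+6A^2D^1_x+6A^2D^2_y+6A^1D^2_x-6A^1D^1_y\\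 &\quad+B^2_{xx}-B^2_{yy}-2B^1_{xy}-2C^2_{xf}+2C^1_{yf}+2C^1_{xg}+2C^2_{yg}-6B^2D^1_f-6B^2D^2_g-6B^1D^2_f+6B^1D^1_g\\ &\quad+3D^2_{ff}-3D^2_{gg}-6D^1_{fg}+4C^2C^1_f+4C^2C^2_g+4C^1C^2_f-4C^1C^1_g-2C^2B^1_x-2C^2B^2_y-2C^1B^2_x+2C^1B^1_y=0. \end{aligned}$$ These are four times the real and imaginary parts of Lie's two conditions $3A_{zz}+3A_zC+3AC_z-3A_uD+C_{uu}-6AD_u+BC_u-2BB_z-2B_{zu}=0$ and $6A_zD-3B_uD+3AD_z+B_{zz}-2C_{zu}-3BD_u+3D_{uu}+2CC_u-CB_z=0$. -/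

import Mathlib

namespace ComplexLin

/-! ### Real functions of two variables, and the class of systems of PDEs -/

/-- The partial derivative with respect to the first variable `x`. -/
noncomputable def px (f : ℝ → ℝ → ℝ) : ℝ → ℝ → ℝ := fun x y => deriv (fun t => f t y) x

/-- The partial derivative with respect to the second variable `y`. -/
noncomputable def py (f : ℝ → ℝ → ℝ) : ℝ → ℝ → ℝ := fun x y => deriv (fun t => f x t) y

/-- The function `h` with `2h = f_x + g_y`. -/
noncomputable def hh (f g : ℝ → ℝ → ℝ) : ℝ → ℝ → ℝ := fun x y => (px f x y + py g x y) / 2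

/-- The function `l` with `2l = g_x - f_y`. -/
noncomputable def ll (f g : ℝ → ℝ → ℝ) : ℝ → ℝ → ℝ := fun x y => (px g x y - py f x y) / 2

/-- A real function of `(x, y, f, g, h, l)`. -/
abbrev Fun6 := ℝ → ℝ → ℝ → ℝ → ℝ → ℝ → ℝ

/-- The pair `(f, g)` satisfies, at the point `(x, y)`, the two equations
`f_xx - f_yy + 2 g_xy = 4 w₁(x, y, f, g, h, l)` and `g_xx - g_yy - 2 f_xy = 4 w₂(x, y, f, g, h, l)`. -/
def SatisfiesAt (w₁ w₂ : Fun6) (f g : ℝ → ℝ → ℝ) (x y : ℝ) : Prop :=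
  px (px f) x y - py (py f) x y + 2 * py (px g) x y
      = 4 * w₁ x y (f x y) (g x y) (hh f g x y) (ll f g x y) ∧
  px (px g) x y - py (py g) x y - 2 * py (px f) x y
      = 4 * w₂ x y (f x y) (g x y) (hh f g x y) (ll f g x y)

/-- The complex function `u(z) = f(x, y) + i g(x, y)` of `z = x + i y`. The Cauchy-Riemann
equations for `(f, g)` are imposed by asking that `u` is complex analytic. -/
def toComplex (f g : ℝ → ℝ → ℝ) : ℂ → ℂ := fun z => ⟨f z.re z.im, g z.re z.im⟩

/-! ### Linear systems of the class -/

/-- Real part of `a(Z) P + b(Z) U + c(Z)` at `Z = X + i Y`, `U = F + i G`, `P = H + i L`. -/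
noncomputable def linRe (a b c : ℂ → ℂ) : Fun6 := fun X Y F G H L =>
  (a ⟨X, Y⟩).re * H - (a ⟨X, Y⟩).im * L + (b ⟨X, Y⟩).re * F - (b ⟨X, Y⟩).im * G + (c ⟨X, Y⟩).re

/-- Imaginary part of `a(Z) P + b(Z) U + c(Z)` at `Z = X + i Y`, `U = F + i G`, `P = H + i L`. -/
noncomputable def linIm (a b c : ℂ → ℂ) : Fun6 := fun X Y F G H L =>
  (a ⟨X, Y⟩).re * L + (a ⟨X, Y⟩).im * H + (b ⟨X, Y⟩).re * G + (b ⟨X, Y⟩).im * F + (c ⟨X, Y⟩).im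

/-! ### Complex linearizability

The right-hand sides `w₁`, `w₂` live on a set `W` of points `(x + i y, f + i g, h + i l)`. -/

/-- The set of those `(x + i y, f + i g)` over which `W` has a point. -/
def base (W : Set (ℂ × ℂ × ℂ)) : Set (ℂ × ℂ) := {q | ∃ p : ℂ, (q.1, q.2, p) ∈ W}

/-- The complex point transformation `(z, u) ↦ (Z, U)` takes the pair `(f, g)`, near `(x, y)`, to the
pair `(F, G)`: along the graph of `u = f + i g` near `x + i y` one has `U = F(X, Y) + i G(X, Y)`,
and the new independent variable `Z = X + i Y` is a local coordinate there. -/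
def TransformsTo (T : OpenPartialHomeomorph (ℂ × ℂ) (ℂ × ℂ)) (f g F G : ℝ → ℝ → ℝ) (x y : ℝ) :
    Prop :=
  deriv (fun z => (T (z, toComplex f g z)).1) ⟨x, y⟩ ≠ 0 ∧
  ∀ᶠ z in nhds (⟨x, y⟩ : ℂ),
    toComplex F G (T (z, toComplex f g z)).1 = (T (z, toComplex f g z)).2

/-- Near the point `q` of the `(z, u)`-space, the system given by `w₁`, `w₂` (with the
Cauchy-Riemann equations) is turned into a linear system, which comes from
`U'' = a(Z) U' + b(Z) U + c(Z)` with `a`, `b`, `c` analytic, by an invertible analytic point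
transformation `T` of a neighbourhood of `q`. -/
def ComplexLinearizableAt (W : Set (ℂ × ℂ × ℂ)) (w₁ w₂ : Fun6) (q : ℂ × ℂ) : Prop :=
  ∃ (T : OpenPartialHomeomorph (ℂ × ℂ) (ℂ × ℂ)) (a b c : ℂ → ℂ),
    q ∈ T.source ∧
    DifferentiableOn ℂ T T.source ∧ DifferentiableOn ℂ T.symm T.target ∧
    DifferentiableOn ℂ a (Prod.fst '' T.target) ∧
    DifferentiableOn ℂ b (Prod.fst '' T.target) ∧
    DifferentiableOn ℂ c (Prod.fst '' T.target) ∧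
    ∀ (f g F G : ℝ → ℝ → ℝ) (x y : ℝ),
      AnalyticAt ℂ (toComplex f g) ⟨x, y⟩ →
      ((⟨x, y⟩ : ℂ), (⟨f x y, g x y⟩ : ℂ)) ∈ T.source →
      ((⟨x, y⟩ : ℂ), (⟨f x y, g x y⟩ : ℂ), (⟨hh f g x y, ll f g x y⟩ : ℂ)) ∈ W →
      TransformsTo T f g F G x y →
      (SatisfiesAt w₁ w₂ f g x y ↔
        SatisfiesAt (linRe a b c) (linIm a b c) F G
          (T (⟨x, y⟩, ⟨f x y, g x y⟩)).1.re (T (⟨x, y⟩, ⟨f x y, g x y⟩)).1.im)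

/-- The system is complex-linearizable: it is so near every point of its domain. -/
def ComplexLinearizable (W : Set (ℂ × ℂ × ℂ)) (w₁ w₂ : Fun6) : Prop :=
  ∀ q ∈ base W, ComplexLinearizableAt W w₁ w₂ q

/-! ### The criterion -/

/-- A real function of `(x, y, f, g)`. -/
abbrev Fun4 := ℝ → ℝ → ℝ → ℝ → ℝ

/-- Partial derivative with respect to `x`. -/
noncomputable def dx (k : Fun4) : Fun4 := fun x y f g => deriv (fun t => k t y f g) x
/-- Partial derivative with respect to `y`. -/
noncomputable def dy (k : Fun4) : Fun4 := fun x y f g => deriv (fun t => k x t f g) y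
/-- Partial derivative with respect to `f`. -/
noncomputable def df (k : Fun4) : Fun4 := fun x y f g => deriv (fun t => k x y t g) f
/-- Partial derivative with respect to `g`. -/
noncomputable def dg (k : Fun4) : Fun4 := fun x y f g => deriv (fun t => k x y f t) g

/-- `k₁ + i k₂` is an analytic function of `(z, u) = (x + i y, f + i g)` on `Ω`. -/
def AnalyticPairOn (Ω : Set (ℂ × ℂ)) (k₁ k₂ : Fun4) : Prop :=
  DifferentiableOn ℂ (fun q : ℂ × ℂ =>
    (⟨k₁ q.1.re q.1.im q.2.re q.2.im, k₂ q.1.re q.1.im q.2.re q.2.im⟩ : ℂ)) Ω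

/-- On `W` the functions `w₁`, `w₂` are the cubics in `(h, l)` with the given coefficients. -/
def IsCubic (W : Set (ℂ × ℂ × ℂ)) (w₁ w₂ : Fun6) (A₁ A₂ B₁ B₂ C₁ C₂ D₁ D₂ : Fun4) : Prop :=
  ∀ x y f g h l : ℝ, ((⟨x, y⟩ : ℂ), (⟨f, g⟩ : ℂ), (⟨h, l⟩ : ℂ)) ∈ W →
    4 * w₁ x y f g h l =
      4 * A₁ x y f g * h ^ 3 - 12 * A₁ x y f g * h * l ^ 2 - 12 * A₂ x y f g * h ^ 2 * l
        + 4 * A₂ x y f g * l ^ 3 + 4 * B₁ x y f g * h ^ 2 - 4 * B₁ x y f g * l ^ 2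
        - 8 * B₂ x y f g * h * l + 4 * C₁ x y f g * h - 4 * C₂ x y f g * l + 4 * D₁ x y f g ∧
    4 * w₂ x y f g h l =
      12 * A₁ x y f g * h ^ 2 * l - 4 * A₁ x y f g * l ^ 3 + 4 * A₂ x y f g * h ^ 3
        - 12 * A₂ x y f g * h * l ^ 2 + 8 * B₁ x y f g * h * l + 4 * B₂ x y f g * h ^ 2
        - 4 * B₂ x y f g * l ^ 2 + 4 * C₂ x y f g * h + 4 * C₁ x y f g * l + 4 * D₂ x y f g

/-- Left-hand side of the first constraint: four times the real part of
`3A_zz + 3A_z C + 3A C_z - 3A_u D + C_uu - 6A D_u + B C_u - 2B B_z - 2B_zu`. -/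
noncomputable def constraint₁ (A₁ A₂ B₁ B₂ C₁ C₂ D₁ D₂ : Fun4) : Fun4 :=
  3 * dx (dx A₁) - 3 * dy (dy A₁) + 6 * dy (dx A₂)
    + 6 * C₁ * dx A₁ + 6 * C₁ * dy A₂ - 6 * C₂ * dx A₂ + 6 * C₂ * dy A₁
    - 6 * D₁ * df A₁ - 6 * D₁ * dg A₂ + 6 * D₂ * df A₂ - 6 * D₂ * dg A₁
    + 6 * A₁ * dx C₁ + 6 * A₁ * dy C₂ - 6 * A₂ * dx C₂ + 6 * A₂ * dy C₁
    + df (df C₁) - dg (dg C₁) + 2 * dg (df C₂)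
    - 12 * A₁ * df D₁ - 12 * A₁ * dg D₂ + 12 * A₂ * df D₂ - 12 * A₂ * dg D₁
    + 2 * B₁ * df C₁ + 2 * B₁ * dg C₂ - 2 * B₂ * df C₂ + 2 * B₂ * dg C₁
    - 4 * B₁ * dx B₁ - 4 * B₁ * dy B₂ + 4 * B₂ * dx B₂ - 4 * B₂ * dy B₁
    - 2 * df (dx B₁) - 2 * df (dy B₂) - 2 * dg (dx B₂) + 2 * dg (dy B₁)

/-- Left-hand side of the second constraint: four times the imaginary part of the same
expression. -/
noncomputable def constraint₂ (A₁ A₂ B₁ B₂ C₁ C₂ D₁ D₂ : Fun4) : Fun4 :=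
  3 * dx (dx A₂) - 3 * dy (dy A₂) - 6 * dy (dx A₁)
    + 6 * C₂ * dx A₁ + 6 * C₂ * dy A₂ + 6 * C₁ * dx A₂ - 6 * C₁ * dy A₁
    - 6 * D₂ * df A₁ - 6 * D₂ * dg A₂ - 6 * D₁ * df A₂ + 6 * D₁ * dg A₁
    + 6 * A₂ * dx C₁ + 6 * A₂ * dy C₂ + 6 * A₁ * dx C₂ - 6 * A₁ * dy C₁
    + df (df C₂) - dg (dg C₂) - 2 * dg (df C₁)
    - 12 * A₂ * df D₁ - 12 * A₂ * dg D₂ - 12 * A₁ * df D₂ + 12 * A₁ * dg D₁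
    + 2 * B₂ * df C₁ + 2 * B₂ * dg C₂ + 2 * B₁ * df C₂ - 2 * B₁ * dg C₁
    - 4 * B₂ * dx B₁ - 4 * B₂ * dy B₂ - 4 * B₁ * dx B₂ + 4 * B₁ * dy B₁
    - 2 * df (dx B₂) + 2 * df (dy B₁) + 2 * dg (dx B₁) + 2 * dg (dy B₂)

/-- Left-hand side of the third constraint: four times the real part of
`6A_z D - 3B_u D + 3A D_z + B_zz - 2C_zu - 3B D_u + 3D_uu + 2C C_u - C B_z`. -/
noncomputable def constraint₃ (A₁ A₂ B₁ B₂ C₁ C₂ D₁ D₂ : Fun4) : Fun4 :=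
  12 * D₁ * dx A₁ + 12 * D₁ * dy A₂ - 12 * D₂ * dx A₂ + 12 * D₂ * dy A₁
    - 6 * D₁ * df B₁ - 6 * D₁ * dg B₂ + 6 * D₂ * df B₂ - 6 * D₂ * dg B₁
    + 6 * A₁ * dx D₁ + 6 * A₁ * dy D₂ - 6 * A₂ * dx D₂ + 6 * A₂ * dy D₁
    + dx (dx B₁) - dy (dy B₁) + 2 * dy (dx B₂)
    - 2 * df (dx C₁) - 2 * df (dy C₂) - 2 * dg (dx C₂) + 2 * dg (dy C₁)
    - 6 * B₁ * df D₁ - 6 * B₁ * dg D₂ + 6 * B₂ * df D₂ - 6 * B₂ * dg D₁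
    + 3 * df (df D₁) - 3 * dg (dg D₁) + 6 * dg (df D₂)
    + 4 * C₁ * df C₁ + 4 * C₁ * dg C₂ - 4 * C₂ * df C₂ + 4 * C₂ * dg C₁
    - 2 * C₁ * dx B₁ - 2 * C₁ * dy B₂ + 2 * C₂ * dx B₂ - 2 * C₂ * dy B₁

/-- Left-hand side of the fourth constraint: four times the imaginary part of the expression in
the third. -/
noncomputable def constraint₄ (A₁ A₂ B₁ B₂ C₁ C₂ D₁ D₂ : Fun4) : Fun4 :=
  12 * D₂ * dx A₁ + 12 * D₂ * dy A₂ + 12 * D₁ * dx A₂ - 12 * D₁ * dy A₁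
    - 6 * D₂ * df B₁ - 6 * D₂ * dg B₂ - 6 * D₁ * df B₂ + 6 * D₁ * dg B₁
    + 6 * A₂ * dx D₁ + 6 * A₂ * dy D₂ + 6 * A₁ * dx D₂ - 6 * A₁ * dy D₁
    + dx (dx B₂) - dy (dy B₂) - 2 * dy (dx B₁)
    - 2 * df (dx C₂) + 2 * df (dy C₁) + 2 * dg (dx C₁) + 2 * dg (dy C₂)
    - 6 * B₂ * df D₁ - 6 * B₂ * dg D₂ - 6 * B₁ * df D₂ + 6 * B₁ * dg D₁
    + 3 * df (df D₂) - 3 * dg (dg D₂) - 6 * dg (df D₁)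
    + 4 * C₂ * df C₁ + 4 * C₂ * dg C₂ + 4 * C₁ * df C₂ - 4 * C₁ * dg C₁
    - 2 * C₂ * dx B₁ - 2 * C₂ * dy B₂ - 2 * C₁ * dx B₂ + 2 * C₁ * dy B₁

/-- The four constraints hold at every point of `Ω`. -/
def Constraints (Ω : Set (ℂ × ℂ)) (A₁ A₂ B₁ B₂ C₁ C₂ D₁ D₂ : Fun4) : Prop :=
  ∀ x y f g : ℝ, ((⟨x, y⟩ : ℂ), (⟨f, g⟩ : ℂ)) ∈ Ω →
    constraint₁ A₁ A₂ B₁ B₂ C₁ C₂ D₁ D₂ x y f g = 0 ∧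
    constraint₂ A₁ A₂ B₁ B₂ C₁ C₂ D₁ D₂ x y f g = 0 ∧
    constraint₃ A₁ A₂ B₁ B₂ C₁ C₂ D₁ D₂ x y f g = 0 ∧
    constraint₄ A₁ A₂ B₁ B₂ C₁ C₂ D₁ D₂ x y f g = 0

end ComplexLin

namespace ComplexLin

open Metric Set Filter Topology MeasureTheory

/-! ### Holomorphic functions on finite-dimensional complex spaces -/

section SeveralVariables

variable {X E : Type*} [NormedAddCommGroup X] [NormedSpace ℂ X]
  [NormedAddCommGroup E] [NormedSpace ℂ E]

/-! For holomorphic `u = f + ig` the operators `∂_x` and `∂_y` act as `d/dz` and `i d/dz`, so the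
two real equations are the real and imaginary parts of `4u'' = 4w(z, u, u')` (`satisfiesAt_iff`,
`hh_ll_eq`). In the same way the four real constraints are Lie's two conditions (`constraints_eq`).
What has to be proved is thus Lie's linearization test for one complex equation. Curves are taken in
parametric form `(ζ, υ)`: `u'' = Au'³ + Bu'² + Cu' + D` becomes `ζ'υ'' - υ'ζ'' = cubicForm A B C D
ζ' υ'`, which is independent of the parametrization and transforms well under point transformations.

Sufficiency. The cubic equation is encoded in an overdetermined linear system that gives `φ_zz`,
`φ_zu`, `φ_uu` in terms of `φ_z`, `φ_u`, `φ`, with the coefficients of the derivatives read off from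
`A, B, C, D`. Equality of mixed third derivatives determines the coefficients of `φ` and leaves
exactly Lie's two conditions (`exists_solution_of_lie`). The system is then flat and, by Frobenius
(`exists_solution_of_flat`), has three independent solutions. Their Wronskian along a curve is a
nonzero multiple of the defect of the curve in the cubic equation, so `Z = φ₁/φ₀`, `U = φ₂/φ₀` turn
solutions into straight lines, that is, into solutions of `U'' = 0` (`exists_straightening`).

Necessity. A linear equation pulls back to a cubic one (`exists_pullback`). Test curves with
prescribed 2-jet show that `w` equals this cubic at every slope for which `Z` is a local parameter
on the curve; continuity of `w` gives the one slope that may remain. A linear equation satisfies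
Lie's conditions, hence can itself be straightened; composing, the cubic equation is straightened to
`U'' = 0` (`lie_of_linearization`). Then `A, B, C, D` are combinations of the coefficients
expressing the second derivatives of `Z` and `U` through the first ones, and Lie's conditions follow
from the compatibility of those expressions (`lie_of_straightening`). A cubic is determined by its
values on an open set (`cubicForm_inj_of_isOpen`), so the local coefficients agree on overlaps and
glue over `Ω`.

The analysis in two variables rests on Cauchy's formula and on linear equations with a holomorphic
parameter, solved by Picard iteration. -/

theorem norm_fderiv_le_of_norm_le {f : X → E} {x : X} {r C : ℝ} (hr : 0 < r)
    (hd : DifferentiableOn ℂ f (ball x r)) (hC : ∀ y ∈ ball x r, ‖f y‖ ≤ C) :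
    ‖fderiv ℂ f x‖ ≤ 2 * C / r := by
  refine Complex.norm_fderiv_le_div_of_mapsTo_ball hd (fun y hy => ?_) hr
  have h1 := hC y hy
  have h2 := hC x (mem_ball_self hr)
  rw [mem_closedBall, dist_eq_norm]
  calc ‖f y - f x‖ ≤ ‖f y‖ + ‖f x‖ := norm_sub_le _ _
    _ ≤ 2 * C := by linarith

variable [FiniteDimensional ℂ X] [CompleteSpace E] [SecondCountableTopology E]

/-- Differentiation under the integral sign, for integrals of a holomorphic function along a
family of affine maps. -/
theorem differentiableAt_intervalIntegral_comp_affine {f : X → E} {U : Set X} (hU : IsOpen U)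
    (hf : DifferentiableOn ℂ f U) {a b : ℝ} {g : ℝ → ℂ} (hg : Continuous g)
    {A : ℝ → X →L[ℂ] X} (hA : Continuous A) {β : ℝ → X} (hβ : Continuous β) {q : X}
    (hq : ∀ t ∈ uIcc a b, A t q + β t ∈ U) :
    DifferentiableAt ℂ (fun x => ∫ t in a..b, g t • f (A t x + β t)) q := by
  have : ProperSpace X := FiniteDimensional.proper ℂ X
  have hσ : ∀ x, Continuous (fun t => A t x + β t) := fun x => by fun_prop
  have hK : IsCompact ((fun t => A t q + β t) '' uIcc a b) := isCompact_uIcc.image (hσ q)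
  have hKU : (fun t => A t q + β t) '' uIcc a b ⊆ U := by
    rintro _ ⟨t, ht, rfl⟩; exact hq t ht
  -- A closed tube around the compact path stays in `U`. There `f` is bounded, and Cauchy's estimate
  -- on balls inside the tube bounds its derivative, which gives a constant dominating function.
  obtain ⟨δ, hδ, hδU⟩ := hK.exists_cthickening_subset_open hU hKU
  obtain ⟨C, hC⟩ := (hK.cthickening (r := δ)).exists_bound_of_continuousOn
    (hf.continuousOn.mono hδU)
  obtain ⟨a₀, ha₀⟩ := isCompact_uIcc.exists_bound_of_continuousOn (s := uIcc a b) hA.continuousOn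
  obtain ⟨g₀, hg₀⟩ := isCompact_uIcc.exists_bound_of_continuousOn (s := uIcc a b) hg.continuousOn
  have ha₀n : 0 ≤ a₀ := (norm_nonneg _).trans (ha₀ a left_mem_uIcc)
  have hg₀n : 0 ≤ g₀ := (norm_nonneg _).trans (hg₀ a left_mem_uIcc)
  -- Moving `q` by less than `η` moves the path by at most `δ / 2`; the other `δ / 2` is the radius
  -- for Cauchy's estimate.
  set η : ℝ := δ / (2 * (a₀ + 1)) with hη
  have hηpos : 0 < η := by positivity
  have hball : ∀ t ∈ uIcc a b, ∀ x ∈ ball q η, ball (A t x + β t) (δ / 2) ⊆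
      cthickening δ ((fun t => A t q + β t) '' uIcc a b) := by
    intro t ht x hx y hy
    have h1 : ‖A t (x - q)‖ ≤ δ / 2 := by
      calc ‖A t (x - q)‖ ≤ ‖A t‖ * ‖x - q‖ := (A t).le_opNorm _
        _ ≤ (a₀ + 1) * η := by
          have := ha₀ t ht
          have h2 : ‖x - q‖ ≤ η := by rw [← dist_eq_norm]; exact (mem_ball.1 hx).le
          gcongr
          linarith
        _ = δ / 2 := by rw [hη]; field_simp
    refine mem_cthickening_of_dist_le y (A t q + β t) δ _ ⟨t, ht, rfl⟩ ?_
    have h3 : dist (A t x + β t) (A t q + β t) ≤ δ / 2 := by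
      rw [dist_eq_norm, add_sub_add_right_eq_sub, ← map_sub]; exact h1
    have h4 := mem_ball.1 hy
    linarith [dist_triangle y (A t x + β t) (A t q + β t)]
  have hmem : ∀ t ∈ uIcc a b, ∀ x ∈ ball q η, A t x + β t ∈ U := fun t ht x hx =>
    hδU (hball t ht x hx (mem_ball_self (by positivity)))
  have hcont : ∀ x ∈ ball q η, ContinuousOn (fun t => g t • f (A t x + β t)) (uIcc a b) := by
    intro x hx
    refine hg.continuousOn.smul (hf.continuousOn.comp (hσ x).continuousOn fun t ht => ?_)
    exact hmem t ht x hx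
  have hfd : ∀ t ∈ uIcc a b, ∀ x ∈ ball q η, ‖fderiv ℂ f (A t x + β t)‖ ≤ 2 * C / (δ / 2) := by
    intro t ht x hx
    refine norm_fderiv_le_of_norm_le (by positivity)
      (hf.mono ((hball t ht x hx).trans hδU)) fun y hy => hC y (hball t ht x hx hy)
  borelize X
  borelize E
  refine (intervalIntegral.hasFDerivAt_integral_of_dominated_of_fderiv_le
    (F := fun x t => g t • f (A t x + β t))
    (F' := fun x t => g t • (fderiv ℂ f (A t x + β t)).comp (A t))
    (bound := fun _ => g₀ * (2 * C / (δ / 2) * a₀))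
    (ball_mem_nhds q hηpos) ?_ ?_ ?_ ?_ ?_ ?_).differentiableAt
  · filter_upwards [ball_mem_nhds q hηpos] with x hx
    exact ((hcont x hx).mono uIoc_subset_uIcc).aestronglyMeasurable measurableSet_uIoc
  · exact (hcont q (mem_ball_self hηpos)).intervalIntegrable
  · have h1 : StronglyMeasurable (fun t => fderiv ℂ f (A t q + β t)) :=
      ((measurable_fderiv ℂ f).comp (hσ q).measurable).stronglyMeasurable
    refine hg.aestronglyMeasurable.smul ?_
    exact (ContinuousLinearMap.compL ℂ X X E).aestronglyMeasurable_comp₂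
      h1.aestronglyMeasurable hA.aestronglyMeasurable
  · refine Eventually.of_forall fun t ht x hx => ?_
    have ht' := uIoc_subset_uIcc ht
    rw [norm_smul]
    have h0 : 0 ≤ 2 * C / (δ / 2) := (norm_nonneg _).trans (hfd t ht' x hx)
    refine mul_le_mul (hg₀ t ht') ?_ (norm_nonneg _) hg₀n
    exact (ContinuousLinearMap.opNorm_comp_le _ _).trans
      (mul_le_mul (hfd t ht' x hx) (ha₀ t ht') (norm_nonneg _) h0)
  · exact intervalIntegrable_const
  · refine Eventually.of_forall fun t ht x hx => ?_
    have ht' := uIoc_subset_uIcc ht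
    have h1 : HasFDerivAt f (fderiv ℂ f (A t x + β t)) (A t x + β t) :=
      (hf.differentiableAt (hU.mem_nhds (hmem t ht' x hx))).hasFDerivAt
    have h2 : HasFDerivAt (fun x => A t x + β t) (A t) x := (A t).hasFDerivAt.add_const _
    exact (h1.comp x h2).const_smul (g t)

/-- Directional derivatives of holomorphic functions are holomorphic. -/
theorem differentiableAt_fderiv_apply {f : X → E} {U : Set X} (hU : IsOpen U)
    (hf : DifferentiableOn ℂ f U) {x : X} (hx : x ∈ U) (v : X) :
    DifferentiableAt ℂ (fun y => fderiv ℂ f y v) x := by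
  obtain ⟨R, hR, hRU⟩ := Metric.isOpen_iff.1 hU x hx
  set r : ℝ := R / (4 * (‖v‖ + 1)) with hr
  have hrpos : 0 < r := by positivity
  have hrv : r * ‖v‖ ≤ R / 4 := by
    calc r * ‖v‖ ≤ r * (‖v‖ + 1) := by gcongr; linarith
      _ = R / 4 := by rw [hr]; field_simp
  have hmem : ∀ y ∈ ball x (R / 2), ∀ w ∈ closedBall (0 : ℂ) r, y + w • v ∈ U := by
    intro y hy w hw
    apply hRU
    rw [mem_ball, dist_eq_norm]
    have h1 : ‖w • v‖ ≤ R / 4 := by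
      rw [norm_smul]
      refine le_trans ?_ hrv
      gcongr
      simpa using hw
    have h2 : ‖y - x‖ < R / 2 := by rw [← dist_eq_norm]; exact hy
    calc ‖y + w • v - x‖ = ‖(y - x) + w • v‖ := by congr 1; abel
      _ ≤ ‖y - x‖ + ‖w • v‖ := norm_add_le _ _
      _ < R := by linarith
  -- Cauchy's formula for the first derivative at the centre, applied to `w ↦ f (y + w v)`. It
  -- writes the directional derivative as an integral of `f` along translates of a fixed circle,
  -- which is holomorphic in `y` by the previous lemma.
  have hrep : ∀ y ∈ ball x (R / 2), fderiv ℂ f y v =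
      (2 * Real.pi * Complex.I : ℂ)⁻¹ • ∫ θ in (0 : ℝ)..2 * Real.pi,
        (deriv (circleMap 0 r) θ * ((circleMap 0 r θ) ^ 2)⁻¹) •
          f ((ContinuousLinearMap.id ℂ X) y + circleMap 0 r θ • v) := by
    intro y hy
    have hd : HasDerivAt (fun w : ℂ => f (y + w • v)) (fderiv ℂ f y v) 0 := by
      have h1 : HasFDerivAt f (fderiv ℂ f y) (y + (0 : ℂ) • v) := by
        have := (hf.differentiableAt (hU.mem_nhds
          (by simpa using hmem y hy 0 (mem_closedBall_self hrpos.le)))).hasFDerivAt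
        simpa using this
      have h2 : HasDerivAt (fun w : ℂ => y + w • v) v 0 := by
        simpa using ((hasDerivAt_id (0 : ℂ)).smul_const v).const_add y
      exact h1.comp_hasDerivAt (0 : ℂ) h2
    have hV : IsOpen ((fun w : ℂ => y + w • v) ⁻¹' U) := hU.preimage (by fun_prop)
    have hg : DifferentiableOn ℂ (fun w : ℂ => f (y + w • v)) ((fun w : ℂ => y + w • v) ⁻¹' U) := by
      refine hf.comp ?_ fun w hw => hw
      fun_prop
    have := Complex.two_pi_I_inv_smul_circleIntegral_sub_sq_inv_smul_of_differentiable hV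
      (fun w hw => hmem y hy w hw) hg (mem_ball_self hrpos)
    rw [hd.deriv] at this
    rw [← this, circleIntegral]
    congr 1
    refine intervalIntegral.integral_congr fun θ _ => ?_
    simp [smul_smul]
  have hne : ∀ θ, circleMap 0 r θ ≠ 0 := fun θ => circleMap_ne_center hrpos.ne'
  have hcm : Continuous (circleMap 0 r) := continuous_circleMap 0 r
  have hmain := differentiableAt_intervalIntegral_comp_affine hU hf (a := 0) (b := 2 * Real.pi)
    (g := fun θ => deriv (circleMap 0 r) θ * ((circleMap 0 r θ) ^ 2)⁻¹)
    (by
      simp only [deriv_circleMap]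
      exact (hcm.mul continuous_const).mul ((hcm.pow 2).inv₀ fun θ => pow_ne_zero 2 (hne θ)))
    (A := fun _ => ContinuousLinearMap.id ℂ X) continuous_const
    (β := fun θ => circleMap 0 r θ • v) (hcm.smul continuous_const) (q := x)
    (fun θ _ => hmem x (mem_ball_self (by positivity)) _
      (sphere_subset_closedBall (circleMap_mem_sphere 0 hrpos.le θ)))
  refine (hmain.const_smul ((2 * Real.pi * Complex.I : ℂ)⁻¹)).congr_of_eventuallyEq ?_
  filter_upwards [ball_mem_nhds x (half_pos hR)] with y hy
  exact hrep y hy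

end SeveralVariables

/-! ### Linear differential equations with a holomorphic parameter -/

section LinearODE

variable {E : Type*} [NormedAddCommGroup E] [NormedSpace ℂ E]

/-- The primitive of `f` with respect to the first variable that vanishes for `q.1 = q₀.1`. -/
noncomputable def primFst (q₀ : ℂ × ℂ) (f : ℂ × ℂ → E) (q : ℂ × ℂ) : E :=
  (q.1 - q₀.1) • ∫ t in (0 : ℝ)..1, f (q₀.1 + t * (q.1 - q₀.1), q.2)

theorem segment_mem_ball {q₀ q : ℂ × ℂ} {r : ℝ} (hq : q ∈ ball q₀ r) {t : ℝ}
    (ht : t ∈ Icc (0 : ℝ) 1) : (q₀.1 + t * (q.1 - q₀.1), q.2) ∈ ball q₀ r := by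
  rw [mem_ball, Prod.dist_eq, max_lt_iff] at hq ⊢
  refine ⟨?_, hq.2⟩
  have h1 : ‖q.1 - q₀.1‖ < r := by rw [← dist_eq_norm]; exact hq.1
  calc dist (q₀.1 + t * (q.1 - q₀.1)) q₀.1 = |t| * ‖q.1 - q₀.1‖ := by
        rw [dist_eq_norm, add_sub_cancel_left, norm_mul, Complex.norm_real, Real.norm_eq_abs]
    _ ≤ 1 * ‖q.1 - q₀.1‖ := by
        gcongr; rw [abs_of_nonneg ht.1]; exact ht.2
    _ < r := by simpa using h1

theorem primFst_of_fst_eq (q₀ : ℂ × ℂ) (f : ℂ × ℂ → E) {q : ℂ × ℂ} (h : q.1 = q₀.1) :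
    primFst q₀ f q = 0 := by
  simp [primFst, h]

theorem norm_primFst_le {q₀ : ℂ × ℂ} {f : ℂ × ℂ → E} {r C : ℝ}
    (hC : ∀ q ∈ ball q₀ r, ‖f q‖ ≤ C) {q : ℂ × ℂ} (hq : q ∈ ball q₀ r) :
    ‖primFst q₀ f q‖ ≤ r * C := by
  have hC0 : 0 ≤ C := (norm_nonneg _).trans (hC q hq)
  have h1 : ‖q.1 - q₀.1‖ ≤ r := by
    rw [← dist_eq_norm]
    exact (le_max_left _ _).trans (mem_ball.1 hq).le
  have h2 : ‖∫ t in (0 : ℝ)..1, f (q₀.1 + t * (q.1 - q₀.1), q.2)‖ ≤ C * |1 - 0| := by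
    refine intervalIntegral.norm_integral_le_of_norm_le_const fun t ht => ?_
    rw [uIoc_of_le zero_le_one] at ht
    exact hC _ (segment_mem_ball hq ⟨ht.1.le, ht.2⟩)
  rw [primFst, norm_smul]
  refine mul_le_mul h1 (by simpa using h2) (norm_nonneg _) ((norm_nonneg _).trans h1)

variable [CompleteSpace E] [SecondCountableTopology E]

/-- The segment of integration depends on `q` through the affine maps with linear part `diag(t, 1)`,
so differentiation under the integral sign applies. -/
theorem differentiableOn_primFst {q₀ : ℂ × ℂ} {f : ℂ × ℂ → E} {r : ℝ}
    (hf : DifferentiableOn ℂ f (ball q₀ r)) :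
    DifferentiableOn ℂ (primFst q₀ f) (ball q₀ r) := by
  intro q hq
  have hA : Continuous fun t : ℝ => (((t : ℂ) • ContinuousLinearMap.fst ℂ ℂ ℂ).prod
      (ContinuousLinearMap.snd ℂ ℂ ℂ) : ℂ × ℂ →L[ℂ] ℂ × ℂ) := by
    have : (fun t : ℝ => (((t : ℂ) • ContinuousLinearMap.fst ℂ ℂ ℂ).prod
        (ContinuousLinearMap.snd ℂ ℂ ℂ) : ℂ × ℂ →L[ℂ] ℂ × ℂ)) = fun t : ℝ =>
        (t : ℂ) • (ContinuousLinearMap.inl ℂ ℂ ℂ).comp (ContinuousLinearMap.fst ℂ ℂ ℂ) +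
        (ContinuousLinearMap.inr ℂ ℂ ℂ).comp (ContinuousLinearMap.snd ℂ ℂ ℂ) := by
      funext t
      ext <;> simp
    rw [this]
    fun_prop
  have key : ∀ (t : ℝ) (x : ℂ × ℂ), (q₀.1 + t * (x.1 - q₀.1), x.2) =
      (((t : ℂ) • ContinuousLinearMap.fst ℂ ℂ ℂ).prod (ContinuousLinearMap.snd ℂ ℂ ℂ) :
        ℂ × ℂ →L[ℂ] ℂ × ℂ) x + ((1 - t) * q₀.1, 0) := by
    intro t x
    ext
    · simp; ring
    · simp
  have h := differentiableAt_intervalIntegral_comp_affine isOpen_ball hf (a := 0) (b := 1)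
    (g := fun _ => 1) continuous_const hA (β := fun t : ℝ => ((1 - t) * q₀.1, 0)) (by fun_prop)
    (q := q) (fun t ht => by
      rw [uIcc_of_le zero_le_one] at ht
      rw [← key]
      exact segment_mem_ball hq ht)
  simp only [one_smul, ← key] at h
  have h2 : DifferentiableAt ℂ (fun x : ℂ × ℂ => x.1 - q₀.1) q := by fun_prop
  exact (h2.smul h).differentiableWithinAt

/-- With the second variable frozen, `f` has a holomorphic primitive on the disc, and the integral
over the segment is its increment. -/
theorem fderiv_primFst {q₀ : ℂ × ℂ} {f : ℂ × ℂ → E} {r : ℝ}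
    (hf : DifferentiableOn ℂ f (ball q₀ r)) {q : ℂ × ℂ} (hq : q ∈ ball q₀ r) :
    fderiv ℂ (primFst q₀ f) q (1, 0) = f q := by
  have hq' : q.1 ∈ ball q₀.1 r ∧ q.2 ∈ ball q₀.2 r := by
    rwa [← Set.mem_prod, ball_prod_same]
  have hmem : ∀ w ∈ ball q₀.1 r, (w, q.2) ∈ ball q₀ r := by
    intro w hw
    rw [show ball q₀ r = ball q₀.1 r ×ˢ ball q₀.2 r from (ball_prod_same _ _ _).symm]
    exact ⟨hw, hq'.2⟩
  have hh : DifferentiableOn ℂ (fun w => f (w, q.2)) (ball q₀.1 r) :=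
    hf.comp (by fun_prop) hmem
  obtain ⟨g, hg⟩ := hh.isExactOn_ball
  have hrep : ∀ w ∈ ball q₀.1 r, primFst q₀ f (w, q.2) = g w - g q₀.1 := by
    intro w hw
    have hr : 0 < r := dist_nonneg.trans_lt (mem_ball.1 hw)
    have hseg : ∀ t ∈ uIcc (0 : ℝ) 1, q₀.1 + t * (w - q₀.1) ∈ ball q₀.1 r := by
      intro t ht
      rw [uIcc_of_le zero_le_one] at ht
      have := segment_mem_ball (hmem w hw) ht
      rw [show ball q₀ r = ball q₀.1 r ×ˢ ball q₀.2 r from (ball_prod_same _ _ _).symm] at this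
      exact this.1
    have hd : ∀ t ∈ uIcc (0 : ℝ) 1, HasDerivAt (fun t : ℝ => g (q₀.1 + t * (w - q₀.1)))
        ((w - q₀.1) • f (q₀.1 + t * (w - q₀.1), q.2)) t := by
      intro t ht
      have h1 : HasDerivAt (fun t : ℝ => q₀.1 + t * (w - q₀.1)) (w - q₀.1) t := by
        simpa using ((Complex.ofRealCLM.hasDerivAt (x := t)).mul_const (w - q₀.1)).const_add q₀.1
      exact (hg _ (hseg t ht)).scomp t h1
    have hcont : ContinuousOn (fun t : ℝ => (w - q₀.1) • f (q₀.1 + t * (w - q₀.1), q.2))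
        (uIcc 0 1) := by
      refine continuousOn_const.smul ?_
      refine hh.continuousOn.comp (by fun_prop) hseg
    have := intervalIntegral.integral_eq_sub_of_hasDerivAt hd hcont.intervalIntegrable
    rw [intervalIntegral.integral_smul] at this
    rw [primFst]
    simpa using this
  have h1 : HasDerivAt (fun w => primFst q₀ f (w, q.2)) (f q) q.1 := by
    have h2 : HasDerivAt (fun w => g w - g q₀.1) (f (q.1, q.2)) q.1 :=
      (hg _ hq'.1).sub_const _
    refine h2.congr_of_eventuallyEq ?_
    filter_upwards [isOpen_ball.mem_nhds hq'.1] with w hw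
    exact hrep w hw
  have h3 : HasDerivAt (fun w : ℂ => (w, q.2)) (1, 0) q.1 :=
    (hasDerivAt_id q.1).prodMk (hasDerivAt_const _ _)
  have h4 : HasFDerivAt (primFst q₀ f) (fderiv ℂ (primFst q₀ f) q) (q.1, q.2) :=
    ((differentiableOn_primFst hf).differentiableAt (isOpen_ball.mem_nhds hq)).hasFDerivAt
  have h5 : HasDerivAt (fun w => primFst q₀ f (w, q.2)) (fderiv ℂ (primFst q₀ f) q (1, 0)) q.1 :=
    h4.comp_hasDerivAt (f := fun w : ℂ => (w, q.2)) q.1 h3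
  exact h5.unique h1

/-- The linear equation `∂y/∂z = L(z, u) y` has, near a point, a solution holomorphic in `(z, u)`
with prescribed values on a line `z = const`. -/
theorem exists_solution_fst {L : ℂ × ℂ → E →L[ℂ] E} {q₀ : ℂ × ℂ} {R : ℝ} (hR : 0 < R)
    (hL : DifferentiableOn ℂ L (ball q₀ R)) {y₀ : ℂ → E}
    (hy₀ : DifferentiableOn ℂ y₀ (ball q₀.2 R)) :
    ∃ r > 0, r ≤ R ∧ ∃ y : ℂ × ℂ → E, DifferentiableOn ℂ y (ball q₀ r) ∧
      (∀ q ∈ ball q₀ r, fderiv ℂ y q (1, 0) = L q (y q)) ∧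
      ∀ u ∈ ball q₀.2 r, y (q₀.1, u) = y₀ u := by
  obtain ⟨C, hC0, hC⟩ : ∃ C > 0, ∀ᶠ q in 𝓝 q₀, ‖L q‖ ≤ C := by
    have h := (hL.differentiableAt (ball_mem_nhds q₀ hR)).continuousAt.norm
    refine ⟨‖L q₀‖ + 1, by positivity, ?_⟩
    filter_upwards [h.eventually (gt_mem_nhds (lt_add_one _))] with q hq using hq.le
  obtain ⟨B, hB0, hB⟩ : ∃ B > 0, ∀ᶠ q : ℂ × ℂ in 𝓝 q₀, ‖y₀ q.2‖ ≤ B := by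
    have h1 : ContinuousAt y₀ q₀.2 :=
      (hy₀.differentiableAt (ball_mem_nhds q₀.2 hR)).continuousAt
    have h : ContinuousAt (fun q : ℂ × ℂ => ‖y₀ q.2‖) q₀ :=
      (ContinuousAt.comp (f := Prod.snd) h1 continuousAt_snd).norm
    refine ⟨‖y₀ q₀.2‖ + 1, by positivity, ?_⟩
    filter_upwards [h.eventually (gt_mem_nhds (lt_add_one _))] with q hq using hq.le
  obtain ⟨ρ₀, hρ₀, hball⟩ := Metric.eventually_nhds_iff_ball.1 (hC.and hB)
  -- The bound `ρ * C ≤ 1 / 2` makes each Picard step halve the norm.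
  set ρ : ℝ := min (min ρ₀ R) (1 / (2 * C)) with hρ
  have hρpos : 0 < ρ := by positivity
  have hρC : ρ * C ≤ 1 / 2 := by
    calc ρ * C ≤ 1 / (2 * C) * C := by gcongr; exact min_le_right _ _
      _ = 1 / 2 := by field_simp
  have hρρ₀ : ball q₀ ρ ⊆ ball q₀ ρ₀ := ball_subset_ball ((min_le_left _ _).trans (min_le_left _ _))
  have hρR : ρ ≤ R := (min_le_left _ _).trans (min_le_right _ _)
  have hLρ : DifferentiableOn ℂ L (ball q₀ ρ) := hL.mono (ball_subset_ball hρR)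
  -- The increments of the Picard iteration: the initial value, then repeatedly the primitive of `L`
  -- applied to the previous increment. The solution is their sum.
  let d : ℕ → ℂ × ℂ → E := fun n => Nat.rec (fun q => y₀ q.2)
    (fun _ dn => primFst q₀ (fun q => L q (dn q))) n
  have hd0 : ∀ q, d 0 q = y₀ q.2 := fun _ => rfl
  have hds : ∀ n, d (n + 1) = primFst q₀ (fun q => L q (d n q)) := fun _ => rfl
  have hdiff : ∀ n, DifferentiableOn ℂ (d n) (ball q₀ ρ) := by
    intro n
    induction n with
    | zero =>
      refine hy₀.comp (by fun_prop) fun q hq => ?_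
      have := (ball_subset_ball hρR) hq
      rw [← ball_prod_same] at this
      exact this.2
    | succ n ih =>
      rw [hds]
      exact differentiableOn_primFst (hLρ.clm_apply ih)
  have hbound : ∀ n, ∀ q ∈ ball q₀ ρ, ‖d n q‖ ≤ B * (1 / 2) ^ n := by
    intro n
    induction n with
    | zero => intro q hq; simpa [hd0] using (hball q (hρρ₀ hq)).2
    | succ n ih =>
      intro q hq
      rw [hds]
      calc ‖primFst q₀ (fun q => L q (d n q)) q‖ ≤ ρ * (C * (B * (1 / 2) ^ n)) := by
            refine norm_primFst_le (fun x hx => ?_) hq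
            exact ((L x).le_opNorm _).trans
              (mul_le_mul (hball x (hρρ₀ hx)).1 (ih x hx) (norm_nonneg _) hC0.le)
        _ = (ρ * C) * (B * (1 / 2) ^ n) := by ring
        _ ≤ 1 / 2 * (B * (1 / 2) ^ n) := by gcongr
        _ = B * (1 / 2) ^ (n + 1) := by ring
  have hsum : Summable fun n : ℕ => B * (1 / 2 : ℝ) ^ n := summable_geometric_two.mul_left B
  have hsumd : ∀ q ∈ ball q₀ ρ, Summable fun n => d n q := fun q hq =>
    Summable.of_norm_bounded hsum fun n => hbound n q hq
  have hsub : ball q₀ (ρ / 2) ⊆ ball q₀ ρ := ball_subset_ball (by linarith)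
  -- Halving the radius leaves room for Cauchy's estimate, so the series of derivatives also
  -- converges geometrically and termwise differentiation is allowed.
  have hfd : ∀ n, ∀ q ∈ ball q₀ (ρ / 2), ‖fderiv ℂ (d n) q‖ ≤ 2 * (B * (1 / 2) ^ n) / (ρ / 2) := by
    intro n q hq
    have hs : ball q (ρ / 2) ⊆ ball q₀ ρ := by
      refine ball_subset_ball' ?_
      linarith [mem_ball.1 hq]
    exact norm_fderiv_le_of_norm_le (by positivity) ((hdiff n).mono hs)
      fun x hx => hbound n x (hs hx)
  have hsum' : Summable fun n : ℕ => 2 * (B * (1 / 2 : ℝ) ^ n) / (ρ / 2) :=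
    (hsum.mul_left 2).div_const _
  have hy : ∀ q ∈ ball q₀ (ρ / 2),
      HasFDerivAt (fun q => ∑' n, d n q) (∑' n, fderiv ℂ (d n) q) q := by
    intro q hq
    refine hasFDerivAt_tsum_of_isPreconnected hsum' isOpen_ball
      (convex_ball q₀ (ρ / 2)).isPreconnected
      (fun n x hx => ((hdiff n).differentiableAt (isOpen_ball.mem_nhds (hsub hx))).hasFDerivAt)
      hfd (mem_ball_self (by positivity)) (hsumd q₀ (mem_ball_self hρpos)) hq
  refine ⟨ρ / 2, by positivity, by linarith, fun q => ∑' n, d n q,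
    fun q hq => (hy q hq).differentiableAt.differentiableWithinAt, fun q hq => ?_, fun u hu => ?_⟩
  · rw [(hy q hq).fderiv]
    have hs : Summable fun n => fderiv ℂ (d n) q :=
      Summable.of_norm_bounded hsum' fun n => hfd n q hq
    have h1 : (∑' n, fderiv ℂ (d n) q) (1, 0) = ∑' n, fderiv ℂ (d n) q (1, 0) :=
      (ContinuousLinearMap.apply ℂ E ((1, 0) : ℂ × ℂ)).map_tsum hs
    have hs1 : Summable fun n => fderiv ℂ (d n) q (1, 0) :=
      (ContinuousLinearMap.apply ℂ E ((1, 0) : ℂ × ℂ)).summable hs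
    -- The sum shifts by one index: the zeroth term does not depend on `z`, and the `z`-derivative
    -- of term `n + 1` is `L` applied to term `n`.
    rw [h1, hs1.tsum_eq_zero_add, (L q).map_tsum (hsumd q (hsub hq))]
    have h2 : fderiv ℂ (d 0) q (1, 0) = 0 := by
      have h3 : DifferentiableAt ℂ y₀ q.2 := by
        have h4 := (ball_subset_ball hρR) (hsub hq)
        rw [← ball_prod_same] at h4
        exact hy₀.differentiableAt (isOpen_ball.mem_nhds h4.2)
      have h5 : HasFDerivAt (d 0) ((fderiv ℂ y₀ q.2).comp (ContinuousLinearMap.snd ℂ ℂ ℂ)) q :=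
        HasFDerivAt.comp q h3.hasFDerivAt hasFDerivAt_snd
      rw [h5.fderiv]
      simp
    rw [h2, zero_add]
    refine tsum_congr fun n => ?_
    rw [hds, fderiv_primFst (hLρ.clm_apply (hdiff n)) (hsub hq)]
  · have hq : (q₀.1, u) ∈ ball q₀ ρ := by
      rw [show ball q₀ ρ = ball q₀.1 ρ ×ˢ ball q₀.2 ρ from (ball_prod_same _ _ _).symm]
      exact ⟨mem_ball_self hρpos, ball_subset_ball (by linarith) hu⟩
    show ∑' n, d n (q₀.1, u) = y₀ u
    rw [(hsumd _ hq).tsum_eq_zero_add]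
    have h0 : ∀ n, d (n + 1) (q₀.1, u) = 0 := fun n => by
      rw [hds]; exact primFst_of_fst_eq _ _ rfl
    simp [hd0, h0]

end LinearODE

/-! ### Calculus of holomorphic functions of two variables -/

section TwoVariables

variable {E : Type*} [NormedAddCommGroup E] [NormedSpace ℂ E]

/-- `f` is holomorphic in a neighbourhood of `q`. -/
@[fun_prop]
def Hol (f : ℂ × ℂ → E) (q : ℂ × ℂ) : Prop := ∀ᶠ x in 𝓝 q, DifferentiableAt ℂ f x

/-- The partial derivative with respect to the first variable. -/
noncomputable def Dz (f : ℂ × ℂ → E) (q : ℂ × ℂ) : E := fderiv ℂ f q (1, 0)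

/-- The partial derivative with respect to the second variable. -/
noncomputable def Du (f : ℂ × ℂ → E) (q : ℂ × ℂ) : E := fderiv ℂ f q (0, 1)

theorem fderiv_apply_eq (f : ℂ × ℂ → E) (q v : ℂ × ℂ) :
    fderiv ℂ f q v = v.1 • Dz f q + v.2 • Du f q := by
  rw [Dz, Du, ← map_smul, ← map_smul, ← map_add]
  congr 1
  ext <;> simp

namespace Hol

variable {f : ℂ × ℂ → E} {q : ℂ × ℂ}

theorem of_differentiableOn {U : Set (ℂ × ℂ)} (hf : DifferentiableOn ℂ f U) (hU : U ∈ 𝓝 q) :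
    Hol f q := by
  filter_upwards [eventually_mem_nhds_iff.2 hU] with x hx using hf.differentiableAt hx

theorem differentiableAt (hf : Hol f q) : DifferentiableAt ℂ f q := hf.self_of_nhds

theorem eventually (hf : Hol f q) : ∀ᶠ x in 𝓝 q, Hol f x := eventually_eventually_nhds.2 hf

theorem congr {g : ℂ × ℂ → E} (hf : Hol f q) (h : f =ᶠ[𝓝 q] g) : Hol g q := by
  filter_upwards [hf, h.eventually_nhds] with x hx hgx
  exact hx.congr_of_eventuallyEq (EventuallyEq.symm hgx)

theorem exists_ball (hf : Hol f q) : ∃ r > 0, DifferentiableOn ℂ f (ball q r) := by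
  obtain ⟨r, hr, h⟩ := Metric.eventually_nhds_iff_ball.1 hf
  exact ⟨r, hr, fun x hx => (h x hx).differentiableWithinAt⟩

@[fun_prop]
theorem const (c : E) : Hol (fun _ => c) q := Eventually.of_forall fun _ => by fun_prop

@[fun_prop]
theorem add {g : ℂ × ℂ → E} (hf : Hol f q) (hg : Hol g q) : Hol (fun x => f x + g x) q := by
  filter_upwards [hf, hg] with x h1 h2 using h1.add h2

@[fun_prop]
theorem sub {g : ℂ × ℂ → E} (hf : Hol f q) (hg : Hol g q) : Hol (fun x => f x - g x) q := by
  filter_upwards [hf, hg] with x h1 h2 using h1.sub h2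

@[fun_prop]
theorem neg (hf : Hol f q) : Hol (fun x => -f x) q := by
  filter_upwards [hf] with x h1 using h1.neg

@[fun_prop]
theorem mul {f g : ℂ × ℂ → ℂ} (hf : Hol f q) (hg : Hol g q) : Hol (fun x => f x * g x) q := by
  filter_upwards [hf, hg] with x h1 h2 using h1.mul h2

@[fun_prop]
theorem pow {f : ℂ × ℂ → ℂ} (hf : Hol f q) (n : ℕ) : Hol (fun x => f x ^ n) q := by
  filter_upwards [hf] with x h1 using h1.pow n

@[fun_prop]
theorem div_const {f : ℂ × ℂ → ℂ} (hf : Hol f q) (c : ℂ) : Hol (fun x => f x / c) q := by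
  simp only [div_eq_mul_inv]
  exact hf.mul (Hol.const _)

@[fun_prop]
theorem div {f g : ℂ × ℂ → ℂ} (hf : Hol f q) (hg : Hol g q) (h0 : g q ≠ 0) :
    Hol (fun x => f x / g x) q := by
  filter_upwards [hf, hg, hg.differentiableAt.continuousAt.eventually_ne h0] with x h1 h2 h3
  simp only [div_eq_mul_inv]
  exact h1.fun_mul (h2.fun_inv h3)

theorem clm_apply {M : ℂ × ℂ → E →L[ℂ] E} (hM : Hol M q) (hf : Hol f q) :
    Hol (fun x => M x (f x)) q := by
  filter_upwards [hM, hf] with x h1 h2 using h1.clm_apply h2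

theorem comp {T : ℂ × ℂ → ℂ × ℂ} (hf : Hol f (T q))
    (hT : ∀ᶠ x in 𝓝 q, DifferentiableAt ℂ T x) : Hol (fun x => f (T x)) q := by
  filter_upwards [hT, hT.self_of_nhds.continuousAt.eventually hf] with x h1 h2
  exact h2.comp x h1

variable [CompleteSpace E] [SecondCountableTopology E]

@[fun_prop]
theorem Dz (hf : Hol f q) : Hol (Dz f) q := by
  obtain ⟨r, hr, h⟩ := hf.exists_ball
  filter_upwards [ball_mem_nhds q hr] with x hx
  exact differentiableAt_fderiv_apply isOpen_ball h hx _

@[fun_prop]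
theorem Du (hf : Hol f q) : Hol (Du f) q := by
  obtain ⟨r, hr, h⟩ := hf.exists_ball
  filter_upwards [ball_mem_nhds q hr] with x hx
  exact differentiableAt_fderiv_apply isOpen_ball h hx _

/-- In two dimensions the full derivative is assembled linearly from the two partial derivatives,
which are already known to be holomorphic. -/
theorem differentiableAt_fderiv (hf : Hol f q) : DifferentiableAt ℂ (fderiv ℂ f) q := by
  have h : fderiv ℂ f = fun x =>
      ContinuousLinearMap.smulRightL ℂ (ℂ × ℂ) E (ContinuousLinearMap.fst ℂ ℂ ℂ)
        (ComplexLin.Dz f x) +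
      ContinuousLinearMap.smulRightL ℂ (ℂ × ℂ) E (ContinuousLinearMap.snd ℂ ℂ ℂ)
        (ComplexLin.Du f x) := by
    funext x
    ext <;> simp [ComplexLin.Dz, ComplexLin.Du]
  rw [h]
  have h1 := hf.Dz.differentiableAt
  have h2 := hf.Du.differentiableAt
  fun_prop

theorem Dz_Du (hf : Hol f q) :
    ComplexLin.Dz (ComplexLin.Du f) q = ComplexLin.Du (ComplexLin.Dz f) q := by
  have h := hf.differentiableAt_fderiv
  have key : ∀ v w : ℂ × ℂ, fderiv ℂ (fun x => fderiv ℂ f x w) q v =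
      fderiv ℂ (fderiv ℂ f) q v w := by
    intro v w
    have := h.hasFDerivAt.clm_apply (hasFDerivAt_const w q)
    rw [this.fderiv]
    simp
  have hs := second_derivative_symmetric_of_eventually (f := f) (f' := fderiv ℂ f) (x := q)
    (by filter_upwards [hf] with x hx using hx.hasFDerivAt) h.hasFDerivAt (1, 0) (0, 1)
  show fderiv ℂ (fun x => fderiv ℂ f x (0, 1)) q (1, 0) =
    fderiv ℂ (fun x => fderiv ℂ f x (1, 0)) q (0, 1)
  rw [key, key, hs]

end Hol

/-! ### Rules for partial derivatives. -/

section Rules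

variable {f g : ℂ × ℂ → E} {q : ℂ × ℂ}

theorem Dz_congr (h : f =ᶠ[𝓝 q] g) : Dz f q = Dz g q := by rw [Dz, Dz, h.fderiv_eq]
theorem Du_congr (h : f =ᶠ[𝓝 q] g) : Du f q = Du g q := by rw [Du, Du, h.fderiv_eq]

theorem Dz_eventuallyEq (h : f =ᶠ[𝓝 q] g) : Dz f =ᶠ[𝓝 q] Dz g :=
  h.eventuallyEq_nhds.mono fun _ hx => Dz_congr hx
theorem Du_eventuallyEq (h : f =ᶠ[𝓝 q] g) : Du f =ᶠ[𝓝 q] Du g :=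
  h.eventuallyEq_nhds.mono fun _ hx => Du_congr hx

theorem Dz_const (c : E) : Dz (fun _ => c) q = 0 := by simp [Dz]
theorem Du_const (c : E) : Du (fun _ => c) q = 0 := by simp [Du]

theorem Dz_add (hf : Hol f q) (hg : Hol g q) :
    Dz (fun x => f x + g x) q = Dz f q + Dz g q := by
  simp only [Dz]
  rw [(hf.differentiableAt.hasFDerivAt.fun_add hg.differentiableAt.hasFDerivAt).fderiv]; rfl

theorem Du_add (hf : Hol f q) (hg : Hol g q) :
    Du (fun x => f x + g x) q = Du f q + Du g q := by
  simp only [Du]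
  rw [(hf.differentiableAt.hasFDerivAt.fun_add hg.differentiableAt.hasFDerivAt).fderiv]; rfl

theorem Dz_sub (hf : Hol f q) (hg : Hol g q) :
    Dz (fun x => f x - g x) q = Dz f q - Dz g q := by
  simp only [Dz]
  rw [(hf.differentiableAt.hasFDerivAt.fun_sub hg.differentiableAt.hasFDerivAt).fderiv]; rfl

theorem Du_sub (hf : Hol f q) (hg : Hol g q) :
    Du (fun x => f x - g x) q = Du f q - Du g q := by
  simp only [Du]
  rw [(hf.differentiableAt.hasFDerivAt.fun_sub hg.differentiableAt.hasFDerivAt).fderiv]; rfl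

theorem Dz_neg (hf : Hol f q) : Dz (fun x => -f x) q = -Dz f q := by
  simp only [Dz]
  rw [hf.differentiableAt.hasFDerivAt.fun_neg.fderiv]; rfl

theorem Du_neg (hf : Hol f q) : Du (fun x => -f x) q = -Du f q := by
  simp only [Du]
  rw [hf.differentiableAt.hasFDerivAt.fun_neg.fderiv]; rfl

theorem Dz_mul {f g : ℂ × ℂ → ℂ} (hf : Hol f q) (hg : Hol g q) :
    Dz (fun x => f x * g x) q = Dz f q * g q + f q * Dz g q := by
  simp only [Dz]
  rw [(hf.differentiableAt.hasFDerivAt.fun_mul hg.differentiableAt.hasFDerivAt).fderiv]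
  simp; ring

theorem Du_mul {f g : ℂ × ℂ → ℂ} (hf : Hol f q) (hg : Hol g q) :
    Du (fun x => f x * g x) q = Du f q * g q + f q * Du g q := by
  simp only [Du]
  rw [(hf.differentiableAt.hasFDerivAt.fun_mul hg.differentiableAt.hasFDerivAt).fderiv]
  simp; ring

theorem Dz_const_mul {f : ℂ × ℂ → ℂ} (c : ℂ) (hf : Hol f q) :
    Dz (fun x => c * f x) q = c * Dz f q := by
  rw [Dz_mul (Hol.const c) hf, Dz_const]; ring

theorem Du_const_mul {f : ℂ × ℂ → ℂ} (c : ℂ) (hf : Hol f q) :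
    Du (fun x => c * f x) q = c * Du f q := by
  rw [Du_mul (Hol.const c) hf, Du_const]; ring

theorem Dz_div_const {f : ℂ × ℂ → ℂ} (c : ℂ) (hf : Hol f q) :
    Dz (fun x => f x / c) q = Dz f q / c := by
  simp only [div_eq_mul_inv]
  rw [Dz_mul hf (Hol.const _), Dz_const]; ring

theorem Du_div_const {f : ℂ × ℂ → ℂ} (c : ℂ) (hf : Hol f q) :
    Du (fun x => f x / c) q = Du f q / c := by
  simp only [div_eq_mul_inv]
  rw [Du_mul hf (Hol.const _), Du_const]; ring

theorem Dz_clm_apply {M : ℂ × ℂ → E →L[ℂ] E} (hM : Hol M q) (hf : Hol f q) :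
    Dz (fun x => M x (f x)) q = Dz M q (f q) + M q (Dz f q) := by
  simp only [Dz]
  rw [(hM.differentiableAt.hasFDerivAt.clm_apply hf.differentiableAt.hasFDerivAt).fderiv]
  simp [add_comm]

theorem Du_clm_apply {M : ℂ × ℂ → E →L[ℂ] E} (hM : Hol M q) (hf : Hol f q) :
    Du (fun x => M x (f x)) q = Du M q (f q) + M q (Du f q) := by
  simp only [Du]
  rw [(hM.differentiableAt.hasFDerivAt.clm_apply hf.differentiableAt.hasFDerivAt).fderiv]
  simp [add_comm]

/-- The chain rule along a curve. -/
theorem hasDerivAt_comp_curve {γ : ℂ → ℂ × ℂ} {γ' : ℂ × ℂ} {t : ℂ} (hf : DifferentiableAt ℂ f (γ t))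
    (hγ : HasDerivAt γ γ' t) :
    HasDerivAt (fun s => f (γ s)) (γ'.1 • Dz f (γ t) + γ'.2 • Du f (γ t)) t := by
  rw [← fderiv_apply_eq]
  exact hf.hasFDerivAt.comp_hasDerivAt t hγ

end Rules

/-- **Frobenius' theorem** for linear systems: the system `y_z = M y`, `y_u = N y` with
`M_u + M N = N_z + N M` has a holomorphic solution with any prescribed value at a point. -/
theorem exists_solution_of_flat [CompleteSpace E] [SecondCountableTopology E]
    {M N : ℂ × ℂ → E →L[ℂ] E} {q₀ : ℂ × ℂ} (hM : Hol M q₀) (hN : Hol N q₀)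
    (hflat : ∀ᶠ q in 𝓝 q₀, ∀ v, Du M q v + M q (N q v) = Dz N q v + N q (M q v)) (e : E) :
    ∃ y : ℂ × ℂ → E, Hol y q₀ ∧ y q₀ = e ∧
      ∀ᶠ q in 𝓝 q₀, Dz y q = M q (y q) ∧ Du y q = N q (y q) := by
  have hMb : ∀ᶠ q in 𝓝 q₀, ‖M q‖ ≤ ‖M q₀‖ + 1 :=
    (hM.differentiableAt.continuousAt.norm.eventually (gt_mem_nhds (lt_add_one _))).mono
      fun q hq => hq.le
  obtain ⟨R, hR, hball⟩ := Metric.eventually_nhds_iff_ball.1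
    (hflat.and (hMb.and (hM.eventually.and hN.eventually)))
  have hpr : ∀ ρ, ball q₀ ρ = ball q₀.1 ρ ×ˢ ball q₀.2 ρ := fun ρ => (ball_prod_same _ _ _).symm
  -- First `y_u = N y` is solved on the line `z = q₀.1`. Here `u` plays the role of the first
  -- variable and the second variable is a dummy, later set to `q₀.2`. The result serves as initial
  -- value for `y_z = M y`.
  obtain ⟨r₁, hr₁, hr₁R, y₁, hy₁, hy₁z, hy₁0⟩ := exists_solution_fst (q₀ := (q₀.2, q₀.2)) hR
    (L := fun q => N (q₀.1, q.1)) (y₀ := fun _ => e)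
    (by
      intro q hq
      rw [← ball_prod_same] at hq
      have h : (q₀.1, q.1) ∈ ball q₀ R := by rw [hpr]; exact ⟨mem_ball_self hR, hq.1⟩
      have h1 : DifferentiableAt ℂ N (q₀.1, q.1) := (hball _ h).2.2.2.differentiableAt
      exact (h1.comp (f := fun q : ℂ × ℂ => (q₀.1, q.1)) q (by fun_prop)).differentiableWithinAt)
    (differentiableOn_const e)
  have hy₀ : ∀ u ∈ ball q₀.2 r₁,
      HasDerivAt (fun u => y₁ (u, q₀.2)) (N (q₀.1, u) (y₁ (u, q₀.2))) u := by
    intro u hu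
    have h : (u, q₀.2) ∈ ball (q₀.2, q₀.2) r₁ := by
      rw [← ball_prod_same]; exact ⟨hu, mem_ball_self hr₁⟩
    have h1 := hasDerivAt_comp_curve (γ := fun u : ℂ => (u, q₀.2)) (t := u)
      (hy₁.differentiableAt (isOpen_ball.mem_nhds h))
      ((hasDerivAt_id u).prodMk (hasDerivAt_const u q₀.2))
    have h2 : Dz y₁ (u, q₀.2) = _ := hy₁z _ h
    simpa [h2] using h1
  obtain ⟨r, hr, hrr₁, y, hy, hyz, hy0⟩ := exists_solution_fst (q₀ := q₀) hr₁
    (L := M) (y₀ := fun u => y₁ (u, q₀.2))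
    (fun q hq => (hball q (ball_subset_ball hr₁R hq)).2.2.1.differentiableAt.differentiableWithinAt)
    (fun u hu => (hy₀ u hu).differentiableAt.differentiableWithinAt)
  have hrR : ball q₀ r ⊆ ball q₀ R := ball_subset_ball (hrr₁.trans hr₁R)
  have hyH : ∀ q ∈ ball q₀ r, Hol y q := fun q hq =>
    Hol.of_differentiableOn hy (isOpen_ball.mem_nhds hq)
  have hyz' : ∀ q ∈ ball q₀ r, Dz y q = M q (y q) := hyz
  have hq₀r : q₀ ∈ ball q₀ r := mem_ball_self hr
  -- The defect in the second equation. Flatness gives `ε_z = M ε`, and `ε` vanishes on the initial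
  -- line, so it vanishes identically by Grönwall's inequality along segments in the `z`-direction.
  let ε : ℂ × ℂ → E := fun q => Du y q - N q (y q)
  have hεH : ∀ q ∈ ball q₀ r, Hol ε q := fun q hq =>
    (hyH q hq).Du.sub ((hball q (hrR hq)).2.2.2.clm_apply (hyH q hq))
  have hεz : ∀ q ∈ ball q₀ r, Dz ε q = M q (ε q) := by
    intro q hq
    obtain ⟨hfl, -, hMq, hNq⟩ := hball q (hrR hq)
    have hyq := hyH q hq
    have h1 : Du (Dz y) q = Du (fun x => M x (y x)) q := by
      refine Du_congr ?_
      filter_upwards [isOpen_ball.mem_nhds hq] with x hx using hyz' x hx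
    calc Dz ε q = Dz (Du y) q - Dz (fun x => N x (y x)) q := Dz_sub hyq.Du (hNq.clm_apply hyq)
      _ = (Du M q (y q) + M q (Du y q)) - (Dz N q (y q) + N q (Dz y q)) := by
        rw [hyq.Dz_Du, h1, Du_clm_apply hMq hyq, Dz_clm_apply hNq hyq]
      _ = M q (ε q) := by
        have h2 := hfl (y q)
        rw [hyz' q hq, map_sub]
        rw [← sub_eq_zero] at h2 ⊢
        rw [← h2]
        abel
  have hε0 : ∀ u ∈ ball q₀.2 r, ε (q₀.1, u) = 0 := by
    intro u hu
    have h : (q₀.1, u) ∈ ball q₀ r := by rw [hpr]; exact ⟨mem_ball_self hr, hu⟩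
    have h1 := hasDerivAt_comp_curve (γ := fun u : ℂ => (q₀.1, u)) (t := u)
      (hyH _ h).differentiableAt ((hasDerivAt_const u q₀.1).prodMk (hasDerivAt_id u))
    have h2 : HasDerivAt (fun s => y (q₀.1, s)) (N (q₀.1, u) (y (q₀.1, u))) u := by
      rw [hy0 u hu]
      refine (hy₀ u (ball_subset_ball hrr₁ hu)).congr_of_eventuallyEq ?_
      filter_upwards [isOpen_ball.mem_nhds hu] with s hs using hy0 s hs
    have h3 := h1.unique h2
    simpa [ε, sub_eq_zero] using h3
  have hεq : ∀ q ∈ ball q₀ r, ε q = 0 := by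
    intro q hq
    have hseg : ∀ t ∈ Icc (0 : ℝ) 1, (q₀.1 + t * (q.1 - q₀.1), q.2) ∈ ball q₀ r :=
      fun t ht => segment_mem_ball hq ht
    have hd : ∀ t ∈ Icc (0 : ℝ) 1, HasDerivAt
        (fun t : ℝ => ε (q₀.1 + t * (q.1 - q₀.1), q.2))
        ((q.1 - q₀.1) • M (q₀.1 + t * (q.1 - q₀.1), q.2) (ε (q₀.1 + t * (q.1 - q₀.1), q.2))) t := by
      intro t ht
      have h1 : HasDerivAt (fun s : ℂ => (q₀.1 + s * (q.1 - q₀.1), q.2)) (q.1 - q₀.1, 0) (t : ℂ) := by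
        refine HasDerivAt.prodMk ?_ (hasDerivAt_const _ _)
        simpa using ((hasDerivAt_id (t : ℂ)).mul_const (q.1 - q₀.1)).const_add q₀.1
      have h2 := hasDerivAt_comp_curve (f := ε) (γ := fun s : ℂ => (q₀.1 + s * (q.1 - q₀.1), q.2))
        (hεH _ (hseg t ht)).differentiableAt h1
      rw [hεz _ (hseg t ht)] at h2
      have h3 : HasDerivAt (fun s : ℝ => (s : ℂ)) 1 t := by
        simpa using (hasDerivAt_id t).ofReal_comp
      simpa [Function.comp_def] using HasDerivAt.scomp t h2 h3
    have := eq_zero_of_abs_deriv_le_mul_abs_self_of_eq_zero_right (E := E)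
      (f := fun t : ℝ => ε (q₀.1 + t * (q.1 - q₀.1), q.2))
      (f' := fun t : ℝ => (q.1 - q₀.1) • M (q₀.1 + t * (q.1 - q₀.1), q.2)
        (ε (q₀.1 + t * (q.1 - q₀.1), q.2)))
      (K := ‖q.1 - q₀.1‖ * (‖M q₀‖ + 1)) (a := 0) (b := 1)
      (fun t ht => (hd t ht).continuousAt.continuousWithinAt)
      (fun t ht => (hd t (Ico_subset_Icc_self ht)).hasDerivWithinAt)
      (by
        have : q.2 ∈ ball q₀.2 r := by rw [hpr] at hq; exact hq.2
        simpa using hε0 q.2 this)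
      (fun t ht => by
        rw [norm_smul, mul_assoc]
        refine mul_le_mul_of_nonneg_left ?_ (norm_nonneg _)
        have h3 := hseg t (Ico_subset_Icc_self ht)
        exact (ContinuousLinearMap.le_opNorm _ _).trans
          (mul_le_mul_of_nonneg_right (hball _ (hrR h3)).2.1 (norm_nonneg _)))
      1 ⟨zero_le_one, le_rfl⟩
    simpa using this
  refine ⟨y, hyH q₀ hq₀r, ?_, ?_⟩
  · have h1 := hy0 q₀.2 (mem_ball_self hr)
    have h2 := hy₁0 q₀.2 (mem_ball_self hr₁)
    exact h1.trans h2
  · filter_upwards [ball_mem_nhds q₀ hr] with q hq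
    exact ⟨hyz' q hq, sub_eq_zero.1 (hεq q hq)⟩

end TwoVariables

/-! ### Curves and point transformations -/

/-- The Wronskian-type expression `ζ' υ'' - υ' ζ''` of a parametrized plane curve `(ζ, υ)`. -/
noncomputable def wr (ζ υ : ℂ → ℂ) (t : ℂ) : ℂ :=
  deriv ζ t * deriv (deriv υ) t - deriv υ t * deriv (deriv ζ) t

/-- The binary cubic form `A w³ + B w² v + C w v² + D v³`. -/
def cubicForm (A B C D v w : ℂ) : ℂ := A * w ^ 3 + B * w ^ 2 * v + C * w * v ^ 2 + D * v ^ 3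

/-- At the point `q`, the point transformation `(Z, U)` takes the curves that solve
`ζ' υ'' - υ' ζ'' = E(ζ', υ')` to those that solve the same equation with `E'` in place of `E`. -/
def MapsODE (Z U : ℂ × ℂ → ℂ) (q : ℂ × ℂ) (E' E : ℂ → ℂ → ℂ) : Prop :=
  ∀ (ζ υ : ℂ → ℂ) (t : ℂ), AnalyticAt ℂ ζ t → AnalyticAt ℂ υ t → (ζ t, υ t) = q →
    (wr (fun s => Z (ζ s, υ s)) (fun s => U (ζ s, υ s)) t =
        E' (deriv (fun s => Z (ζ s, υ s)) t) (deriv (fun s => U (ζ s, υ s)) t) ↔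
      wr ζ υ t = E (deriv ζ t) (deriv υ t))

/-- The Jacobian determinant of `(Z, U)`. -/
noncomputable def jac (Z U : ℂ × ℂ → ℂ) (q : ℂ × ℂ) : ℂ := Dz Z q * Du U q - Du Z q * Dz U q

section Curves

variable {f : ℂ × ℂ → ℂ} {ζ υ : ℂ → ℂ} {t : ℂ}

theorem hasDerivAt_comp_pair (hf : DifferentiableAt ℂ f (ζ t, υ t)) (hζ : DifferentiableAt ℂ ζ t)
    (hυ : DifferentiableAt ℂ υ t) :
    HasDerivAt (fun s => f (ζ s, υ s))
      (Dz f (ζ t, υ t) * deriv ζ t + Du f (ζ t, υ t) * deriv υ t) t := by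
  have h := hasDerivAt_comp_curve (γ := fun s => (ζ s, υ s)) hf
    (hζ.hasDerivAt.prodMk hυ.hasDerivAt)
  simpa [mul_comm] using h

theorem eventually_comp_pair {p : ℂ × ℂ → Prop} (hf : ∀ᶠ x in 𝓝 (ζ t, υ t), p x)
    (hζ : AnalyticAt ℂ ζ t) (hυ : AnalyticAt ℂ υ t) : ∀ᶠ s in 𝓝 t, p (ζ s, υ s) :=
  (hζ.continuousAt.prodMk hυ.continuousAt).eventually hf

theorem deriv_comp_pair_eventuallyEq (hf : Hol f (ζ t, υ t)) (hζ : AnalyticAt ℂ ζ t)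
    (hυ : AnalyticAt ℂ υ t) :
    deriv (fun s => f (ζ s, υ s)) =ᶠ[𝓝 t]
      fun s => Dz f (ζ s, υ s) * deriv ζ s + Du f (ζ s, υ s) * deriv υ s := by
  filter_upwards [eventually_comp_pair hf hζ hυ, hζ.eventually_analyticAt,
    hυ.eventually_analyticAt] with s h1 h2 h3
  exact (hasDerivAt_comp_pair h1 h2.differentiableAt h3.differentiableAt).deriv

theorem deriv_comp_pair (hf : Hol f (ζ t, υ t)) (hζ : AnalyticAt ℂ ζ t)
    (hυ : AnalyticAt ℂ υ t) :
    deriv (fun s => f (ζ s, υ s)) t =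
      Dz f (ζ t, υ t) * deriv ζ t + Du f (ζ t, υ t) * deriv υ t :=
  (deriv_comp_pair_eventuallyEq hf hζ hυ).self_of_nhds

theorem analyticAt_comp_pair (hf : Hol f (ζ t, υ t)) (hζ : AnalyticAt ℂ ζ t)
    (hυ : AnalyticAt ℂ υ t) : AnalyticAt ℂ (fun s => f (ζ s, υ s)) t := by
  rw [Complex.analyticAt_iff_eventually_differentiableAt]
  filter_upwards [eventually_comp_pair hf hζ hυ, hζ.eventually_analyticAt,
    hυ.eventually_analyticAt] with s h1 h2 h3
  exact (hasDerivAt_comp_pair h1 h2.differentiableAt h3.differentiableAt).differentiableAt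

theorem deriv_deriv_comp_pair (hf : Hol f (ζ t, υ t)) (hζ : AnalyticAt ℂ ζ t)
    (hυ : AnalyticAt ℂ υ t) :
    deriv (deriv (fun s => f (ζ s, υ s))) t =
      Dz (Dz f) (ζ t, υ t) * deriv ζ t ^ 2 + 2 * Du (Dz f) (ζ t, υ t) * deriv ζ t * deriv υ t +
        Du (Du f) (ζ t, υ t) * deriv υ t ^ 2 +
        Dz f (ζ t, υ t) * deriv (deriv ζ) t + Du f (ζ t, υ t) * deriv (deriv υ) t := by
  rw [(deriv_comp_pair_eventuallyEq hf hζ hυ).deriv_eq]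
  have h1 := hasDerivAt_comp_pair hf.Dz.differentiableAt hζ.differentiableAt hυ.differentiableAt
  have h2 := hasDerivAt_comp_pair hf.Du.differentiableAt hζ.differentiableAt hυ.differentiableAt
  have h3 := (h1.fun_mul hζ.deriv.differentiableAt.hasDerivAt).fun_add
    (h2.fun_mul hυ.deriv.differentiableAt.hasDerivAt)
  rw [h3.deriv, hf.Dz_Du]
  ring

end Curves

/-! ### Wronskians of quotients. -/

section Quotients

variable {f g : ℂ → ℂ} {t : ℂ}

theorem deriv_quot (hf : AnalyticAt ℂ f t) (hg : AnalyticAt ℂ g t) (h0 : g t ≠ 0) :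
    deriv (fun s => f s / g s) t = (deriv f t * g t - f t * deriv g t) / g t ^ 2 :=
  (hf.differentiableAt.hasDerivAt.fun_div hg.differentiableAt.hasDerivAt h0).deriv

theorem deriv_deriv_quot (hf : AnalyticAt ℂ f t) (hg : AnalyticAt ℂ g t) (h0 : g t ≠ 0) :
    deriv (deriv (fun s => f s / g s)) t =
      (deriv (deriv f) t * g t - f t * deriv (deriv g) t) / g t ^ 2 -
        2 * deriv g t * (deriv f t * g t - f t * deriv g t) / g t ^ 3 := by
  have h : deriv (fun s => f s / g s) =ᶠ[𝓝 t]
      fun s => (deriv f s * g s - f s * deriv g s) / g s ^ 2 := by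
    filter_upwards [hf.eventually_analyticAt, hg.eventually_analyticAt,
      hg.continuousAt.eventually_ne h0] with s h1 h2 h3 using deriv_quot h1 h2 h3
  rw [h.deriv_eq]
  have hf1 := hf.differentiableAt.hasDerivAt
  have hg1 := hg.differentiableAt.hasDerivAt
  have hf2 := hf.deriv.differentiableAt.hasDerivAt
  have hg2 := hg.deriv.differentiableAt.hasDerivAt
  rw [(((hf2.fun_mul hg1).fun_sub (hf1.fun_mul hg2)).fun_div (hg1.fun_pow 2)
    (pow_ne_zero 2 h0)).deriv]
  field_simp
  ring

/-- The right-hand side is the Wronskian determinant of `(p₀, p₁, p₂)`. Dividing the triple by `p₀`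
divides it by `p₀³`, and the Wronskian of `(1, P, Q)` is `P'Q'' - Q'P''`. -/
theorem wr_quot {p₀ p₁ p₂ : ℂ → ℂ} (h₀ : AnalyticAt ℂ p₀ t) (h₁ : AnalyticAt ℂ p₁ t)
    (h₂ : AnalyticAt ℂ p₂ t) (h : p₀ t ≠ 0) :
    wr (fun s => p₁ s / p₀ s) (fun s => p₂ s / p₀ s) t * p₀ t ^ 3 =
      p₀ t * (deriv p₁ t * deriv (deriv p₂) t - deriv p₂ t * deriv (deriv p₁) t)
      - p₁ t * (deriv p₀ t * deriv (deriv p₂) t - deriv p₂ t * deriv (deriv p₀) t)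
      + p₂ t * (deriv p₀ t * deriv (deriv p₁) t - deriv p₁ t * deriv (deriv p₀) t) := by
  rw [wr, deriv_quot h₁ h₀ h, deriv_quot h₂ h₀ h, deriv_deriv_quot h₁ h₀ h,
    deriv_deriv_quot h₂ h₀ h]
  field_simp
  ring

end Quotients

/-! ### Lie's conditions and the straightening transformation -/

/-- The left-hand side of Lie's first condition. -/
noncomputable def lie₁ (A B C D : ℂ × ℂ → ℂ) (q : ℂ × ℂ) : ℂ :=
  3 * Dz (Dz A) q + 3 * Dz A q * C q + 3 * A q * Dz C q - 3 * Du A q * D q + Du (Du C) q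
    - 6 * A q * Du D q + B q * Du C q - 2 * B q * Dz B q - 2 * Du (Dz B) q

/-- The left-hand side of Lie's second condition. -/
noncomputable def lie₂ (A B C D : ℂ × ℂ → ℂ) (q : ℂ × ℂ) : ℂ :=
  6 * Dz A q * D q - 3 * Du B q * D q + 3 * A q * Dz D q + Dz (Dz B) q - 2 * Du (Dz C) q
    - 3 * B q * Du D q + 3 * Du (Du D) q + 2 * C q * Du C q - C q * Dz B q

/-! ### Linear systems on `ℂ³` with holomorphic coefficients. -/

section Matrices

/-- The operator on `ℂ³` given by a matrix. -/
noncomputable def matCLM (m : Fin 3 → Fin 3 → ℂ) : (Fin 3 → ℂ) →L[ℂ] (Fin 3 → ℂ) :=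
  ∑ i, ∑ j, m i j • (ContinuousLinearMap.single ℂ (fun _ : Fin 3 => ℂ) i).comp
    (ContinuousLinearMap.proj j)

theorem matCLM_apply (m : Fin 3 → Fin 3 → ℂ) (v : Fin 3 → ℂ) (i : Fin 3) :
    matCLM m v i = ∑ j, m i j * v j := by
  fin_cases i <;> simp [matCLM, Fin.sum_univ_three]

variable {m n : Fin 3 → Fin 3 → ℂ × ℂ → ℂ} {q : ℂ × ℂ}

theorem Hol.matCLM (h : ∀ i j, Hol (m i j) q) :
    Hol (fun x => matCLM fun i j => m i j x) q := by
  have h' : ∀ᶠ x in 𝓝 q, ∀ i j, DifferentiableAt ℂ (m i j) x :=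
    eventually_all.2 fun i => eventually_all.2 fun j => h i j
  filter_upwards [h'] with x hx
  unfold ComplexLin.matCLM
  fun_prop

theorem Hol.apply {ι : Type*} [Fintype ι] {y : ℂ × ℂ → ι → ℂ} (h : Hol y q) (i : ι) :
    Hol (fun x => y x i) q := by
  filter_upwards [h] with x hx
  exact differentiableAt_pi.1 hx i

theorem fderiv_matCLM_apply (h : ∀ i j, Hol (m i j) q) (v : Fin 3 → ℂ) (i : Fin 3) (x : ℂ × ℂ) :
    fderiv ℂ (fun x => ComplexLin.matCLM fun i j => m i j x) q x v i =
      ∑ j, fderiv ℂ (m i j) q x * v j := by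
  have h1 := (Hol.matCLM h).differentiableAt.hasFDerivAt.clm_apply (hasFDerivAt_const v q)
  have h2 := hasFDerivAt_pi'.1 h1 i
  have h3 : HasFDerivAt (fun x => ∑ j, m i j x * v j) (∑ j, (v j) • fderiv ℂ (m i j) q) q := by
    refine HasFDerivAt.fun_sum fun j _ => ?_
    exact (h i j).differentiableAt.hasFDerivAt.mul_const (v j)
  simp only [matCLM_apply] at h2
  have h4 := congrArg (fun l => l x) (h2.unique h3)
  simpa [mul_comm] using h4

/-- Translates flatness from matrix entries to the operator form that `exists_solution_of_flat`
requires. -/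
theorem matCLM_flat (hm : ∀ i j, Hol (m i j) q) (hn : ∀ i j, Hol (n i j) q)
    (h : ∀ i k, Du (m i k) q + ∑ j, m i j q * n j k q = Dz (n i k) q + ∑ j, n i j q * m j k q)
    (v : Fin 3 → ℂ) :
    Du (fun x => matCLM fun i j => m i j x) q v +
        matCLM (fun i j => m i j q) (matCLM (fun i j => n i j q) v) =
      Dz (fun x => matCLM fun i j => n i j x) q v +
        matCLM (fun i j => n i j q) (matCLM (fun i j => m i j q) v) := by
  ext i
  simp only [Pi.add_apply, Du, Dz, fderiv_matCLM_apply hm, fderiv_matCLM_apply hn, matCLM_apply]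
  have h0 := h i 0
  have h1 := h i 1
  have h2 := h i 2
  simp only [Fin.sum_univ_three, Du, Dz] at h0 h1 h2 ⊢
  linear_combination v 0 * h0 + v 1 * h1 + v 2 * h2

end Matrices

/-! ### Lie's conditions as flatness, and the straightening map. -/

section Straightening

variable {A B C D : ℂ × ℂ → ℂ} {q₀ : ℂ × ℂ}

/-- The linear system of second order attached to a cubic equation satisfying Lie's conditions
has solutions with arbitrary initial values. -/
theorem exists_solution_of_lie (hA : Hol A q₀) (hB : Hol B q₀) (hC : Hol C q₀) (hD : Hol D q₀)
    (h1 : ∀ᶠ q in 𝓝 q₀, lie₁ A B C D q = 0) (h2 : ∀ᶠ q in 𝓝 q₀, lie₂ A B C D q = 0) :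
    ∃ g₁ g₂ g₃ : ℂ × ℂ → ℂ, ∀ e : Fin 3 → ℂ, ∃ φ : ℂ × ℂ → ℂ, Hol φ q₀ ∧ φ q₀ = e 0 ∧
      Dz φ q₀ = e 1 ∧ Du φ q₀ = e 2 ∧ ∀ᶠ q in 𝓝 q₀,
        Dz (Dz φ) q = C q / 3 * Dz φ q - D q * Du φ q + g₁ q * φ q ∧
        Du (Dz φ) q = B q / 3 * Dz φ q - C q / 3 * Du φ q + g₂ q * φ q ∧
        Du (Du φ) q = A q * Dz φ q - B q / 3 * Du φ q + g₃ q * φ q := by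
  -- The matrices `m`, `n` below act on `(φ, φ_z, φ_u)`. The entries of the flatness equation that
  -- multiply `φ_z` and `φ_u` determine `g₁`, `g₂`, `g₃`. These do not depend on the initial value
  -- `e`, so all solutions belong to one system.
  let g₁ : ℂ × ℂ → ℂ := fun x => Du D x - Dz C x / 3 + 2 * C x * C x / 9 - 2 * B x * D x / 3
  let g₂ : ℂ × ℂ → ℂ := fun x => (Du C x - Dz B x) / 3 + B x * C x / 9 - A x * D x
  let g₃ : ℂ × ℂ → ℂ := fun x => Du B x / 3 - Dz A x + 2 * B x * B x / 9 - 2 * A x * C x / 3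
  let m : Fin 3 → Fin 3 → ℂ × ℂ → ℂ := ![![fun _ => 0, fun _ => 1, fun _ => 0],
    ![g₁, fun x => C x / 3, fun x => -D x], ![g₂, fun x => B x / 3, fun x => -(C x / 3)]]
  let n : Fin 3 → Fin 3 → ℂ × ℂ → ℂ := ![![fun _ => 0, fun _ => 0, fun _ => 1],
    ![g₂, fun x => B x / 3, fun x => -(C x / 3)], ![g₃, A, fun x => -(B x / 3)]]
  have hall : ∀ᶠ q in 𝓝 q₀, (∀ i j, Hol (m i j) q) ∧ (∀ i j, Hol (n i j) q) ∧
      ∀ i k, Du (m i k) q + ∑ j, m i j q * n j k q = Dz (n i k) q + ∑ j, n i j q * m j k q := by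
    filter_upwards [h1, h2, hA.eventually, hB.eventually, hC.eventually, hD.eventually]
      with q h1 h2 hA hB hC hD
    have hg₁ : Hol g₁ q := by fun_prop
    have hg₂ : Hol g₂ q := by fun_prop
    have hg₃ : Hol g₃ q := by fun_prop
    have e1 : Du g₁ q = Du (Du D) q - Du (Dz C) q / 3 + 4 * C q * Du C q / 9
        - 2 * (Du B q * D q + B q * Du D q) / 3 := by
      simp (disch := fun_prop) only [g₁, Du_add, Du_sub, Du_mul, Du_div_const, Du_const]
      ring
    have e2 : Dz g₂ q = (Du (Dz C) q - Dz (Dz B) q) / 3 + (Dz B q * C q + B q * Dz C q) / 9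
        - (Dz A q * D q + A q * Dz D q) := by
      simp (disch := fun_prop) only [g₂, Dz_add, Dz_sub, Dz_mul, Dz_div_const, hC.Dz_Du]
    have e3 : Du g₂ q = (Du (Du C) q - Du (Dz B) q) / 3 + (Du B q * C q + B q * Du C q) / 9
        - (Du A q * D q + A q * Du D q) := by
      simp (disch := fun_prop) only [g₂, Du_add, Du_sub, Du_mul, Du_div_const]
    have e4 : Dz g₃ q = Du (Dz B) q / 3 - Dz (Dz A) q + 4 * B q * Dz B q / 9
        - 2 * (Dz A q * C q + A q * Dz C q) / 3 := by
      simp (disch := fun_prop) only [g₃, Dz_add, Dz_sub, Dz_mul, Dz_div_const, Dz_const, hB.Dz_Du]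
      ring
    have c1 : Du (fun x => C x / 3) q = Du C q / 3 := Du_div_const 3 hC
    have c2 : Dz (fun x => -(C x / 3)) q = -(Dz C q / 3) := by
      rw [Dz_neg (by fun_prop), Dz_div_const 3 hC]
    have c3 : Du (fun x => -(C x / 3)) q = -(Du C q / 3) := by
      rw [Du_neg (by fun_prop), Du_div_const 3 hC]
    have c4 : Dz (fun x => B x / 3) q = Dz B q / 3 := Dz_div_const 3 hB
    have c5 : Du (fun x => B x / 3) q = Du B q / 3 := Du_div_const 3 hB
    have c6 : Dz (fun x => -(B x / 3)) q = -(Dz B q / 3) := by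
      rw [Dz_neg (by fun_prop), Dz_div_const 3 hB]
    have c7 : Du (fun x => -D x) q = -Du D q := Du_neg hD
    have hL1 : 3 * Dz (Dz A) q + 3 * Dz A q * C q + 3 * A q * Dz C q - 3 * Du A q * D q
      + Du (Du C) q - 6 * A q * Du D q + B q * Du C q - 2 * B q * Dz B q - 2 * Du (Dz B) q = 0 := h1
    have hL2 : 6 * Dz A q * D q - 3 * Du B q * D q + 3 * A q * Dz D q + Dz (Dz B) q
      - 2 * Du (Dz C) q - 3 * B q * Du D q + 3 * Du (Du D) q + 2 * C q * Du C q
      - C q * Dz B q = 0 := h2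
    refine ⟨?_, ?_, ?_⟩
    · intro i j
      fin_cases i <;> fin_cases j <;> simp [m] <;> fun_prop
    · intro i j
      fin_cases i <;> fin_cases j <;> simp [n] <;> fun_prop
    · intro i k
      fin_cases i <;> fin_cases k <;>
        simp [m, n, Fin.sum_univ_three, Du_const, Dz_const, c1, c2, c3, c4, c5, c6, c7,
          e1, e2, e3, e4]
      -- The two entries that multiply `φ` itself are, up to the factor `1 / 3`, Lie's conditions;
      -- the other four nontrivial entries hold by the choice of the `gᵢ`.
      · simp only [g₁, g₂, g₃]; linear_combination (1 / 3) * hL2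
      · simp only [g₂]; ring
      · simp only [g₁]; ring
      · simp only [g₁, g₂, g₃]; linear_combination (1 / 3) * hL1
      · simp only [g₃]; ring
      · simp only [g₂]; ring
  obtain ⟨hm, hn, -⟩ := hall.self_of_nhds
  refine ⟨g₁, g₂, g₃, fun e => ?_⟩
  obtain ⟨y, hy, hy0, hyd⟩ := exists_solution_of_flat (Hol.matCLM hm) (Hol.matCLM hn)
    (hall.mono fun q hq => matCLM_flat hq.1 hq.2.1 hq.2.2) e
  have comp : ∀ {q}, Hol y q → ∀ i, Dz (fun x => y x i) q = Dz y q i ∧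
      Du (fun x => y x i) q = Du y q i := by
    intro q hq i
    have := (hasFDerivAt_pi'.1 hq.differentiableAt.hasFDerivAt i).fderiv
    constructor
    · rw [Dz, this]; rfl
    · rw [Du, this]; rfl
  have hfirst : ∀ᶠ q in 𝓝 q₀, ∀ i, Dz (fun x => y x i) q = ∑ j, m i j q * y q j ∧
      Du (fun x => y x i) q = ∑ j, n i j q * y q j := by
    filter_upwards [hyd, hy.eventually] with q hq hyq i
    rw [(comp hyq i).1, (comp hyq i).2, hq.1, hq.2, matCLM_apply, matCLM_apply]
    exact ⟨rfl, rfl⟩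
  have hz : Dz (fun x => y x 0) =ᶠ[𝓝 q₀] fun x => y x 1 := by
    filter_upwards [hfirst] with q hq
    rw [(hq 0).1]; simp [m, Fin.sum_univ_three]
  have hu : Du (fun x => y x 0) =ᶠ[𝓝 q₀] fun x => y x 2 := by
    filter_upwards [hfirst] with q hq
    rw [(hq 0).2]; simp [n, Fin.sum_univ_three]
  refine ⟨fun x => y x 0, hy.apply 0, congrFun hy0 0,
    hz.self_of_nhds.trans (congrFun hy0 1), hu.self_of_nhds.trans (congrFun hy0 2), ?_⟩
  filter_upwards [hfirst, hz.eventuallyEq_nhds, hu.eventuallyEq_nhds] with q hq hzq huq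
  rw [Dz_congr hzq, Du_congr hzq, Du_congr huq, hzq.self_of_nhds, huq.self_of_nhds,
    (hq 1).1, (hq 1).2, (hq 2).2]
  refine ⟨?_, ?_, ?_⟩ <;> simp [m, n, Fin.sum_univ_three] <;> ring

/-- An equation `u'' = A u'³ + B u'² + C u' + D` that satisfies Lie's conditions is locally
equivalent to `U'' = 0`. -/
theorem exists_straightening (hA : Hol A q₀) (hB : Hol B q₀) (hC : Hol C q₀) (hD : Hol D q₀)
    (h1 : ∀ᶠ q in 𝓝 q₀, lie₁ A B C D q = 0) (h2 : ∀ᶠ q in 𝓝 q₀, lie₂ A B C D q = 0) :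
    ∃ Z U : ℂ × ℂ → ℂ, Hol Z q₀ ∧ Hol U q₀ ∧ jac Z U q₀ ≠ 0 ∧
      ∀ᶠ q in 𝓝 q₀, MapsODE Z U q (fun _ _ => 0) (cubicForm (A q) (B q) (C q) (D q)) := by
  obtain ⟨g₁, g₂, g₃, hg⟩ := exists_solution_of_lie hA hB hC hD h1 h2
  obtain ⟨φ₀, hφ₀, a0, a1, a2, ha⟩ := hg ![1, 0, 0]
  obtain ⟨φ₁, hφ₁, b0, b1, b2, hb⟩ := hg ![0, 1, 0]
  obtain ⟨φ₂, hφ₂, c0, c1, c2, hc⟩ := hg ![0, 0, 1]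
  simp only [Matrix.cons_val] at a0 a1 a2 b0 b1 b2 c0 c1 c2
  have hne : φ₀ q₀ ≠ 0 := by rw [a0]; exact one_ne_zero
  -- The determinant of the 1-jets of the three solutions. The initial values are the unit vectors,
  -- so it equals `1` at `q₀`.
  let δ : ℂ × ℂ → ℂ := fun x => φ₀ x * (Dz φ₁ x * Du φ₂ x - Dz φ₂ x * Du φ₁ x)
    - φ₁ x * (Dz φ₀ x * Du φ₂ x - Dz φ₂ x * Du φ₀ x)
    + φ₂ x * (Dz φ₀ x * Du φ₁ x - Dz φ₁ x * Du φ₀ x)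
  have hδ : ∀ᶠ x in 𝓝 q₀, δ x ≠ 0 := by
    have h : Hol δ q₀ := by fun_prop
    refine h.differentiableAt.continuousAt.eventually_ne ?_
    simp [δ, a0, a1, a2, b0, b1, b2, c0, c1, c2]
  have hquot : ∀ φ : ℂ × ℂ → ℂ, Hol φ q₀ → φ q₀ = 0 →
      Dz (fun x => φ x / φ₀ x) q₀ = Dz φ q₀ ∧ Du (fun x => φ x / φ₀ x) q₀ = Du φ q₀ := by
    intro φ hφ h0
    have hQ : Hol (fun x => φ x / φ₀ x) q₀ := hφ.div hφ₀ hne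
    have hE : φ =ᶠ[𝓝 q₀] fun x => φ x / φ₀ x * φ₀ x := by
      filter_upwards [hφ₀.differentiableAt.continuousAt.eventually_ne hne] with x hx
      field_simp
    rw [Dz_congr hE, Du_congr hE, Dz_mul hQ hφ₀, Du_mul hQ hφ₀, a0, h0]
    simp
  refine ⟨fun x => φ₁ x / φ₀ x, fun x => φ₂ x / φ₀ x, hφ₁.div hφ₀ hne, hφ₂.div hφ₀ hne, ?_, ?_⟩
  · rw [jac, (hquot φ₁ hφ₁ b0).1, (hquot φ₁ hφ₁ b0).2, (hquot φ₂ hφ₂ c0).1, (hquot φ₂ hφ₂ c0).2]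
    simp [b1, b2, c1, c2]
  filter_upwards [ha, hb, hc, hδ, hφ₀.differentiableAt.continuousAt.eventually_ne hne,
    hφ₀.eventually, hφ₁.eventually, hφ₂.eventually] with q ha hb hc hδ hne hφ₀ hφ₁ hφ₂
  rintro ζ υ t hζ hυ rfl
  have k := wr_quot (analyticAt_comp_pair hφ₀ hζ hυ) (analyticAt_comp_pair hφ₁ hζ hυ)
    (analyticAt_comp_pair hφ₂ hζ hυ) hne
  rw [deriv_comp_pair hφ₀ hζ hυ, deriv_comp_pair hφ₁ hζ hυ, deriv_comp_pair hφ₂ hζ hυ,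
    deriv_deriv_comp_pair hφ₀ hζ hυ, deriv_deriv_comp_pair hφ₁ hζ hυ,
    deriv_deriv_comp_pair hφ₂ hζ hυ, ha.1, ha.2.1, ha.2.2, hb.1, hb.2.1, hb.2.2,
    hc.1, hc.2.1, hc.2.2] at k
  -- By the linear system, the first and second derivatives of each `φᵢ` along the curve are
  -- combinations of `φᵢ`, its `z`- and its `u`-derivative, with coefficients not depending on `i`.
  -- Their Wronskian is therefore `δ` times a 2×2 determinant in which the `gᵢ` cancel; that
  -- determinant is the defect of the curve in the cubic equation.
  have key : wr (fun s => φ₁ (ζ s, υ s) / φ₀ (ζ s, υ s)) (fun s => φ₂ (ζ s, υ s) / φ₀ (ζ s, υ s)) t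
      * φ₀ (ζ t, υ t) ^ 3 = δ (ζ t, υ t) * (wr ζ υ t - cubicForm (A (ζ t, υ t)) (B (ζ t, υ t))
        (C (ζ t, υ t)) (D (ζ t, υ t)) (deriv ζ t) (deriv υ t)) := by
    rw [k]
    simp only [δ, wr, cubicForm]
    ring
  constructor
  · intro h
    rw [h, zero_mul] at key
    exact sub_eq_zero.1 ((mul_eq_zero.1 key.symm).resolve_left hδ)
  · intro h
    rw [h, sub_self, mul_zero] at key
    exact (mul_eq_zero.1 key).resolve_right (pow_ne_zero 3 hne)

end Straightening

/-! ### Necessity of Lie's conditions -/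

section Necessity

variable {Z U : ℂ × ℂ → ℂ} {q : ℂ × ℂ}

/-- The first coefficient of `(X, Y)` in the basis `(Z_z, U_z)`, `(Z_u, U_u)`. -/
noncomputable def coefZ (Z U X Y : ℂ × ℂ → ℂ) (x : ℂ × ℂ) : ℂ :=
  (X x * Du U x - Y x * Du Z x) / jac Z U x

/-- The second coefficient of `(X, Y)` in the basis `(Z_z, U_z)`, `(Z_u, U_u)`. -/
noncomputable def coefU (Z U X Y : ℂ × ℂ → ℂ) (x : ℂ × ℂ) : ℂ :=
  (Y x * Dz Z x - X x * Dz U x) / jac Z U x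

/-- Cramer's rule. With a second derivative of `(Z, U)` as `(X, Y)`, the same two coefficients serve
both components, so `Z` and `U` solve one common second-order linear system. -/
theorem coef_fst (h : jac Z U q ≠ 0) (X Y : ℂ × ℂ → ℂ) :
    X q = coefZ Z U X Y q * Dz Z q + coefU Z U X Y q * Du Z q := by
  rw [coefZ, coefU]
  field_simp
  rw [jac]; ring

theorem coef_snd (h : jac Z U q ≠ 0) (X Y : ℂ × ℂ → ℂ) :
    Y q = coefZ Z U X Y q * Dz U q + coefU Z U X Y q * Du U q := by
  rw [coefZ, coefU]
  field_simp
  rw [jac]; ring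

theorem Hol.jac (hZ : Hol Z q) (hU : Hol U q) : Hol (jac Z U) q := by
  unfold ComplexLin.jac
  fun_prop

theorem eventually_jac_ne (hZ : Hol Z q) (hU : Hol U q) (h : jac Z U q ≠ 0) :
    ∀ᶠ x in 𝓝 q, jac Z U x ≠ 0 :=
  (Hol.jac hZ hU).differentiableAt.continuousAt.eventually_ne h

theorem Hol.coefZ {X Y : ℂ × ℂ → ℂ} (hZ : Hol Z q) (hU : Hol U q) (h : ComplexLin.jac Z U q ≠ 0)
    (hX : Hol X q) (hY : Hol Y q) : Hol (coefZ Z U X Y) q := by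
  have h1 : Hol (fun x => X x * ComplexLin.Du U x - Y x * ComplexLin.Du Z x) q := by fun_prop
  exact h1.div (Hol.jac hZ hU) h

theorem Hol.coefU {X Y : ℂ × ℂ → ℂ} (hZ : Hol Z q) (hU : Hol U q) (h : ComplexLin.jac Z U q ≠ 0)
    (hX : Hol X q) (hY : Hol Y q) : Hol (coefU Z U X Y) q := by
  have h1 : Hol (fun x => Y x * ComplexLin.Dz Z x - X x * ComplexLin.Dz U x) q := by fun_prop
  exact h1.div (Hol.jac hZ hU) h

/-- How the Wronskian of a curve changes under a point transformation. -/
theorem wr_comp {α₁ α₂ α₃ β₁ β₂ β₃ : ℂ} {ζ υ : ℂ → ℂ} {t : ℂ} (hζ : AnalyticAt ℂ ζ t)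
    (hυ : AnalyticAt ℂ υ t) (hq : (ζ t, υ t) = q) (hZ : Hol Z q) (hU : Hol U q)
    (hZ₁ : Dz (Dz Z) q = α₁ * Dz Z q + β₁ * Du Z q) (hU₁ : Dz (Dz U) q = α₁ * Dz U q + β₁ * Du U q)
    (hZ₂ : Du (Dz Z) q = α₂ * Dz Z q + β₂ * Du Z q) (hU₂ : Du (Dz U) q = α₂ * Dz U q + β₂ * Du U q)
    (hZ₃ : Du (Du Z) q = α₃ * Dz Z q + β₃ * Du Z q)
    (hU₃ : Du (Du U) q = α₃ * Dz U q + β₃ * Du U q) :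
    wr (fun s => Z (ζ s, υ s)) (fun s => U (ζ s, υ s)) t = jac Z U q * (wr ζ υ t -
      cubicForm α₃ (2 * α₂ - β₃) (α₁ - 2 * β₂) (-β₁) (deriv ζ t) (deriv υ t)) := by
  subst hq
  rw [wr, deriv_comp_pair hZ hζ hυ, deriv_comp_pair hU hζ hυ, deriv_deriv_comp_pair hZ hζ hυ,
    deriv_deriv_comp_pair hU hζ hυ, hZ₁, hZ₂, hZ₃, hU₁, hU₂, hU₃]
  simp only [wr, jac, cubicForm]
  ring

/-- A cubic polynomial is determined by its values on a nonempty open set. -/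
theorem cubicForm_inj_of_isOpen {A B C D A' B' C' D' : ℂ} {O : Set ℂ} (hO : IsOpen O)
    (hne : O.Nonempty) (h : ∀ w ∈ O, cubicForm A B C D 1 w = cubicForm A' B' C' D' 1 w) :
    A = A' ∧ B = B' ∧ C = C' ∧ D = D' := by
  obtain ⟨p, hp⟩ := hne
  obtain ⟨r, hr, hrO⟩ := Metric.isOpen_iff.1 hO p hp
  -- Room for the four equally spaced points `p + kε`, `k = -1, 0, 1, 2`: third, second and first
  -- differences recover `A`, `B`, `C` in turn.
  obtain ⟨ε, hε0, hε⟩ : ∃ ε : ℂ, ε ≠ 0 ∧ ∀ k : ℝ, |k| ≤ 2 → p + k * ε ∈ O := by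
    refine ⟨((r / 3 : ℝ) : ℂ), by exact_mod_cast (by positivity : r / 3 ≠ 0), fun k hk => hrO ?_⟩
    rw [mem_ball, dist_eq_norm, add_sub_cancel_left, norm_mul, Complex.norm_real,
      Complex.norm_real, Real.norm_eq_abs, Real.norm_eq_abs, abs_of_pos (by positivity : 0 < r / 3)]
    nlinarith
  have h0 := h _ (hε 0 (by norm_num))
  have h1 := h _ (hε 1 (by norm_num))
  have h2 := h _ (hε (-1) (by norm_num))
  have h3 := h _ (hε 2 (by norm_num))
  simp only [cubicForm, Complex.ofReal_zero, Complex.ofReal_one, Complex.ofReal_neg,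
    Complex.ofReal_ofNat] at h0 h1 h2 h3
  have hA : A = A' := by
    refine mul_right_cancel₀ (pow_ne_zero 3 hε0) ?_
    linear_combination (1 / 6) * h3 - (1 / 2) * h1 - (1 / 6) * h2 + (1 / 2) * h0
  subst hA
  have hB : B = B' := by
    refine mul_right_cancel₀ (pow_ne_zero 2 hε0) ?_
    linear_combination (1 / 2) * h1 + (1 / 2) * h2 - h0
  subst hB
  have hC : C = C' := by
    refine mul_right_cancel₀ hε0 ?_
    linear_combination h1 - h0
  subst hC
  exact ⟨rfl, rfl, rfl, by linear_combination h0⟩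

/-- There is a curve with any given 2-jet of the form `(1, w)`, `(0, s)`. -/
theorem exists_curve (q : ℂ × ℂ) (w s : ℂ) : ∃ υ : ℂ → ℂ, AnalyticAt ℂ υ q.1 ∧ υ q.1 = q.2 ∧
    deriv υ q.1 = w ∧ deriv (deriv υ) q.1 = s := by
  have hd : ∀ t, HasDerivAt (fun t : ℂ => q.2 + w * (t - q.1) + s / 2 * (t - q.1) ^ 2)
      (w + s * (t - q.1)) t := by
    intro t
    have h1 : HasDerivAt (fun t : ℂ => t - q.1) 1 t := (hasDerivAt_id t).sub_const _
    have h2 := ((h1.const_mul w).const_add q.2).fun_add ((h1.fun_pow 2).const_mul (s / 2))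
    refine h2.congr_deriv ?_
    norm_num
    ring
  refine ⟨fun t => q.2 + w * (t - q.1) + s / 2 * (t - q.1) ^ 2, ?_, by simp, ?_, ?_⟩
  · exact Complex.analyticAt_iff_eventually_differentiableAt.2
      (Eventually.of_forall fun t => (hd t).differentiableAt)
  · rw [(hd q.1).deriv]; simp
  · have : deriv (fun t : ℂ => q.2 + w * (t - q.1) + s / 2 * (t - q.1) ^ 2) =
        fun t => w + s * (t - q.1) := funext fun t => (hd t).deriv
    rw [this]
    simp

theorem wr_graph (υ : ℂ → ℂ) (t : ℂ) : wr (fun s => s) υ t = deriv (deriv υ) t := by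
  have h : deriv (fun s : ℂ => s) = fun _ => 1 := funext fun s => deriv_id s
  simp [wr, h]

/-! ### Compatibility conditions and Lie's expressions. -/

section Curvature

variable {α₁ α₂ α₃ β₁ β₂ β₃ : ℂ × ℂ → ℂ}

/-- The two ways of computing `f_zzu` and of computing `f_zuu` must agree; after the second
derivatives are eliminated this is linear in `f_z`, `f_u`, and the coefficients are the curvature
entries of the system. -/
theorem curvature_aux {f : ℂ × ℂ → ℂ} (hf : Hol f q) (ha₁ : Hol α₁ q) (ha₂ : Hol α₂ q)
    (ha₃ : Hol α₃ q) (hb₁ : Hol β₁ q) (hb₂ : Hol β₂ q) (hb₃ : Hol β₃ q)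
    (h₁ : Dz (Dz f) =ᶠ[𝓝 q] fun x => α₁ x * Dz f x + β₁ x * Du f x)
    (h₂ : Du (Dz f) =ᶠ[𝓝 q] fun x => α₂ x * Dz f x + β₂ x * Du f x)
    (h₃ : Du (Du f) =ᶠ[𝓝 q] fun x => α₃ x * Dz f x + β₃ x * Du f x) :
    (Du α₁ q - Dz α₂ q + β₁ q * α₃ q - β₂ q * α₂ q) * Dz f q +
      (Du β₁ q - Dz β₂ q + α₁ q * β₂ q + β₁ q * β₃ q - α₂ q * β₁ q - β₂ q * β₂ q) * Du f q = 0 ∧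
    (Du α₂ q - Dz α₃ q + α₂ q * α₂ q + β₂ q * α₃ q - α₃ q * α₁ q - β₃ q * α₂ q) * Dz f q +
      (Du β₂ q - Dz β₃ q + α₂ q * β₂ q - α₃ q * β₁ q) * Du f q = 0 := by
  have e₁ := h₁.self_of_nhds
  have e₂ := h₂.self_of_nhds
  have e₃ := h₃.self_of_nhds
  simp only at e₁ e₂ e₃
  constructor
  · have h : Dz (Du (Dz f)) q = Du (Dz (Dz f)) q := hf.Dz.Dz_Du
    rw [Dz_congr h₂, Du_congr h₁] at h
    simp (disch := fun_prop) only [Dz_add, Du_add, Dz_mul, Du_mul, hf.Dz_Du, e₁, e₂, e₃] at h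
    linear_combination -h
  · have h : Dz (Du (Du f)) q = Du (Dz (Du f)) q := hf.Du.Dz_Du
    have h' : Dz (Du f) =ᶠ[𝓝 q] fun x => α₂ x * Dz f x + β₂ x * Du f x := by
      filter_upwards [h₂, hf.eventually] with x hx hfx
      rw [hfx.Dz_Du, hx]
    rw [Dz_congr h₃, Du_congr h'] at h
    simp (disch := fun_prop) only [Dz_add, Du_add, Dz_mul, Du_mul, hf.Dz_Du, e₁, e₂, e₃] at h
    linear_combination -h

/-- Lie's expressions are of second order in the `αᵢ`, `βᵢ`, the curvature of first order. Each Lie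
expression is a combination of `z`- and `u`-derivatives of curvature entries and multiples of the
entries themselves. -/
theorem lie_of_curvature (ha₁ : Hol α₁ q) (ha₂ : Hol α₂ q)
    (ha₃ : Hol α₃ q) (hb₁ : Hol β₁ q) (hb₂ : Hol β₂ q) (hb₃ : Hol β₃ q)
    (r₁ : ∀ᶠ x in 𝓝 q, Du α₁ x - Dz α₂ x + β₁ x * α₃ x - β₂ x * α₂ x = 0)
    (r₂ : ∀ᶠ x in 𝓝 q, Du β₁ x - Dz β₂ x + α₁ x * β₂ x + β₁ x * β₃ x - α₂ x * β₁ x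
      - β₂ x * β₂ x = 0)
    (r₃ : ∀ᶠ x in 𝓝 q, Du α₂ x - Dz α₃ x + α₂ x * α₂ x + β₂ x * α₃ x - α₃ x * α₁ x
      - β₃ x * α₂ x = 0)
    (r₄ : ∀ᶠ x in 𝓝 q, Du β₂ x - Dz β₃ x + α₂ x * β₂ x - α₃ x * β₁ x = 0) :
    lie₁ α₃ (fun x => 2 * α₂ x - β₃ x) (fun x => α₁ x - 2 * β₂ x) (fun x => -β₁ x) q = 0 ∧
    lie₂ α₃ (fun x => 2 * α₂ x - β₃ x) (fun x => α₁ x - 2 * β₂ x) (fun x => -β₁ x) q = 0 := by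
  have hB : ∀ᶠ x in 𝓝 q, Dz (fun x => 2 * α₂ x - β₃ x) x = 2 * Dz α₂ x - Dz β₃ x := by
    filter_upwards [ha₂.eventually, hb₃.eventually] with x _ _
    simp (disch := fun_prop) only [Dz_sub, Dz_const_mul]
  have hC : ∀ᶠ x in 𝓝 q, Dz (fun x => α₁ x - 2 * β₂ x) x = Dz α₁ x - 2 * Dz β₂ x := by
    filter_upwards [ha₁.eventually, hb₂.eventually] with x _ _
    simp (disch := fun_prop) only [Dz_sub, Dz_const_mul]
  have hC' : ∀ᶠ x in 𝓝 q, Du (fun x => α₁ x - 2 * β₂ x) x = Du α₁ x - 2 * Du β₂ x := by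
    filter_upwards [ha₁.eventually, hb₂.eventually] with x _ _
    simp (disch := fun_prop) only [Du_sub, Du_const_mul]
  have hD' : ∀ᶠ x in 𝓝 q, Du (fun x => -β₁ x) x = -Du β₁ x := by
    filter_upwards [hb₁.eventually] with x hx using Du_neg hx
  have hBu : Du (fun x => 2 * α₂ x - β₃ x) q = 2 * Du α₂ q - Du β₃ q := by
    simp (disch := fun_prop) only [Du_sub, Du_const_mul]
  have hBzz : Dz (Dz (fun x => 2 * α₂ x - β₃ x)) q = 2 * Dz (Dz α₂) q - Dz (Dz β₃) q := by
    rw [Dz_congr hB]; simp (disch := fun_prop) only [Dz_sub, Dz_const_mul]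
  have hBzu : Du (Dz (fun x => 2 * α₂ x - β₃ x)) q = 2 * Du (Dz α₂) q - Du (Dz β₃) q := by
    rw [Du_congr hB]; simp (disch := fun_prop) only [Du_sub, Du_const_mul]
  have hCzu : Du (Dz (fun x => α₁ x - 2 * β₂ x)) q = Du (Dz α₁) q - 2 * Du (Dz β₂) q := by
    rw [Du_congr hC]; simp (disch := fun_prop) only [Du_sub, Du_const_mul]
  have hCuu : Du (Du (fun x => α₁ x - 2 * β₂ x)) q = Du (Du α₁) q - 2 * Du (Du β₂) q := by
    rw [Du_congr hC']; simp (disch := fun_prop) only [Du_sub, Du_const_mul]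
  have hDuu : Du (Du (fun x => -β₁ x)) q = -Du (Du β₁) q := by
    rw [Du_congr hD']; simp (disch := fun_prop) only [Du_neg]
  have hDz : Dz (fun x => -β₁ x) q = -Dz β₁ q := Dz_neg hb₁
  have d₁u := Du_congr (g := fun _ => (0 : ℂ)) r₁
  have d₁z := Dz_congr (g := fun _ => (0 : ℂ)) r₁
  have d₂u := Du_congr (g := fun _ => (0 : ℂ)) r₂
  have d₃z := Dz_congr (g := fun _ => (0 : ℂ)) r₃
  have d₄u := Du_congr (g := fun _ => (0 : ℂ)) r₄
  have d₄z := Dz_congr (g := fun _ => (0 : ℂ)) r₄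
  simp (disch := fun_prop) only [Dz_add, Du_add, Dz_sub, Du_sub, Dz_mul, Du_mul, Du_const,
    Dz_const, ha₁.Dz_Du, ha₂.Dz_Du, hb₂.Dz_Du] at d₁u d₁z d₂u d₃z d₄u d₄z
  have s₁ := r₁.self_of_nhds
  have s₂ := r₂.self_of_nhds
  have s₃ := r₃.self_of_nhds
  have s₄ := r₄.self_of_nhds
  constructor
  · rw [lie₁, hBzu, hCuu, hB.self_of_nhds, hC.self_of_nhds, hC'.self_of_nhds, hD'.self_of_nhds]
    linear_combination d₁u - 3 * d₃z - 2 * d₄u + (2 * α₂ q - β₃ q) * s₁ + 3 * α₃ q * s₂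
      + 3 * β₂ q * s₃ + (2 * β₃ q - α₂ q) * s₄
  · rw [lie₂, hBzz, hCzu, hDuu, hBu, hDz, hB.self_of_nhds, hC'.self_of_nhds, hD'.self_of_nhds]
    linear_combination -3 * d₂u - 2 * d₁z + d₄z + (2 * α₁ q - β₂ q) * s₁ + 3 * α₂ q * s₂
      + 3 * β₁ q * s₃ + (2 * β₂ q - α₁ q) * s₄

end Curvature

theorem lie_congr {A B C D A' B' C' D' : ℂ × ℂ → ℂ} (hA : A =ᶠ[𝓝 q] A') (hB : B =ᶠ[𝓝 q] B')
    (hC : C =ᶠ[𝓝 q] C') (hD : D =ᶠ[𝓝 q] D') :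
    lie₁ A B C D q = lie₁ A' B' C' D' q ∧ lie₂ A B C D q = lie₂ A' B' C' D' q := by
  constructor
  · simp only [lie₁]
    rw [Dz_congr (Dz_eventuallyEq hA), Du_congr (Du_eventuallyEq hC), Du_congr (Dz_eventuallyEq hB),
      Dz_congr hA, Dz_congr hB, Dz_congr hC, Du_congr hA, Du_congr hC, Du_congr hD,
      hA.self_of_nhds, hB.self_of_nhds, hC.self_of_nhds, hD.self_of_nhds]
  · simp only [lie₂]
    rw [Du_congr (Dz_eventuallyEq hC), Du_congr (Du_eventuallyEq hD), Dz_congr (Dz_eventuallyEq hB),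
      Dz_congr hA, Dz_congr hB, Dz_congr hD, Du_congr hB, Du_congr hC, Du_congr hD,
      hA.self_of_nhds, hB.self_of_nhds, hC.self_of_nhds, hD.self_of_nhds]

/-- If a point transformation takes `u'' = A u'³ + B u'² + C u' + D` to `U'' = 0`, then Lie's
conditions hold. -/
theorem lie_of_straightening {A B C D : ℂ × ℂ → ℂ} (hZ : Hol Z q) (hU : Hol U q)
    (hJ : jac Z U q ≠ 0) (h : ∀ᶠ x in 𝓝 q,
      MapsODE Z U x (fun _ _ => 0) (cubicForm (A x) (B x) (C x) (D x))) :
    lie₁ A B C D q = 0 ∧ lie₂ A B C D q = 0 := by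
  set α₁ := coefZ Z U (Dz (Dz Z)) (Dz (Dz U))
  set β₁ := coefU Z U (Dz (Dz Z)) (Dz (Dz U))
  set α₂ := coefZ Z U (Du (Dz Z)) (Du (Dz U))
  set β₂ := coefU Z U (Du (Dz Z)) (Du (Dz U))
  set α₃ := coefZ Z U (Du (Du Z)) (Du (Du U))
  set β₃ := coefU Z U (Du (Du Z)) (Du (Du U))
  have hJ' := eventually_jac_ne hZ hU hJ
  have hall : ∀ᶠ x in 𝓝 q, Hol α₁ x ∧ Hol β₁ x ∧ Hol α₂ x ∧ Hol β₂ x ∧ Hol α₃ x ∧ Hol β₃ x := by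
    filter_upwards [hZ.eventually, hU.eventually, hJ'] with x hZ hU hJ
    exact ⟨.coefZ hZ hU hJ hZ.Dz.Dz hU.Dz.Dz, .coefU hZ hU hJ hZ.Dz.Dz hU.Dz.Dz,
      .coefZ hZ hU hJ hZ.Dz.Du hU.Dz.Du, .coefU hZ hU hJ hZ.Dz.Du hU.Dz.Du,
      .coefZ hZ hU hJ hZ.Du.Du hU.Du.Du, .coefU hZ hU hJ hZ.Du.Du hU.Du.Du⟩
  -- For every slope `w`, a curve through `x` that obeys the cubic equation there has an image
  -- obeying `U'' = 0`. By `wr_comp` it then also obeys the cubic built from the `αᵢ`, `βᵢ`, so the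
  -- two cubics agree at all `w`.
  have hcoef : ∀ᶠ x in 𝓝 q, A x = α₃ x ∧ B x = 2 * α₂ x - β₃ x ∧ C x = α₁ x - 2 * β₂ x ∧
      D x = -β₁ x := by
    filter_upwards [h, hZ.eventually, hU.eventually, hJ'] with x h hZ hU hJ
    refine cubicForm_inj_of_isOpen isOpen_univ univ_nonempty fun w _ => ?_
    obtain ⟨υ, hυ, hυ0, hυ1, hυ2⟩ := exists_curve x w (cubicForm (A x) (B x) (C x) (D x) 1 w)
    have hid : AnalyticAt ℂ (fun s : ℂ => s) x.1 := analyticAt_id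
    have hx : ((fun s : ℂ => s) x.1, υ x.1) = x := by rw [hυ0]
    have h1 := (h (fun s => s) υ x.1 hid hυ hx).2 (by
      rw [wr_graph, hυ2, hυ1, deriv_id''])
    have h2 := wr_comp hid hυ hx hZ hU (coef_fst hJ _ _) (coef_snd hJ _ _) (coef_fst hJ _ _)
      (coef_snd hJ _ _) (coef_fst hJ _ _) (coef_snd hJ _ _)
    rw [h1, wr_graph, hυ2, hυ1, deriv_id''] at h2
    exact sub_eq_zero.1 ((mul_eq_zero.1 h2.symm).resolve_left hJ)
  have hA : A =ᶠ[𝓝 q] α₃ := hcoef.mono fun x hx => hx.1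
  have hB : B =ᶠ[𝓝 q] fun x => 2 * α₂ x - β₃ x := hcoef.mono fun x hx => hx.2.1
  have hC : C =ᶠ[𝓝 q] fun x => α₁ x - 2 * β₂ x := hcoef.mono fun x hx => hx.2.2.1
  have hD : D =ᶠ[𝓝 q] fun x => -β₁ x := hcoef.mono fun x hx => hx.2.2.2
  rw [(lie_congr hA hB hC hD).1, (lie_congr hA hB hC hD).2]
  have hcurv : ∀ᶠ x in 𝓝 q,
      (Du α₁ x - Dz α₂ x + β₁ x * α₃ x - β₂ x * α₂ x = 0 ∧
      Du β₁ x - Dz β₂ x + α₁ x * β₂ x + β₁ x * β₃ x - α₂ x * β₁ x - β₂ x * β₂ x = 0) ∧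
      (Du α₂ x - Dz α₃ x + α₂ x * α₂ x + β₂ x * α₃ x - α₃ x * α₁ x - β₃ x * α₂ x = 0 ∧
      Du β₂ x - Dz β₃ x + α₂ x * β₂ x - α₃ x * β₁ x = 0) := by
    -- Each pair of curvature entries annihilates both independent vectors `(Z_z, Z_u)` and `(U_z,
    -- U_u)`, hence is zero.
    have hlin : ∀ {r s : ℂ} {p}, jac Z U p ≠ 0 → r * Dz Z p + s * Du Z p = 0 →
        r * Dz U p + s * Du U p = 0 → r = 0 ∧ s = 0 := by
      intro r s p hJ h1 h2
      constructor
      · have : r * jac Z U p = 0 := by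
          rw [jac]; linear_combination Du U p * h1 - Du Z p * h2
        exact (mul_eq_zero.1 this).resolve_right hJ
      · have : s * jac Z U p = 0 := by
          rw [jac]; linear_combination Dz Z p * h2 - Dz U p * h1
        exact (mul_eq_zero.1 this).resolve_right hJ
    filter_upwards [hZ.eventually, hU.eventually, hJ', eventually_eventually_nhds.2 hJ', hall]
      with x hZ hU hJ hJ' ⟨k₁, l₁, k₂, l₂, k₃, l₃⟩
    obtain ⟨z1, z2⟩ := curvature_aux hZ k₁ k₂ k₃ l₁ l₂ l₃ (hJ'.mono fun _ h => coef_fst h _ _)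
      (hJ'.mono fun _ h => coef_fst h _ _) (hJ'.mono fun _ h => coef_fst h _ _)
    obtain ⟨u1, u2⟩ := curvature_aux hU k₁ k₂ k₃ l₁ l₂ l₃ (hJ'.mono fun _ h => coef_snd h _ _)
      (hJ'.mono fun _ h => coef_snd h _ _) (hJ'.mono fun _ h => coef_snd h _ _)
    exact ⟨hlin hJ z1 u1, hlin hJ z2 u2⟩
  obtain ⟨k₁, l₁, k₂, l₂, k₃, l₃⟩ := hall.self_of_nhds
  exact lie_of_curvature k₁ k₂ k₃ l₁ l₂ l₃ (hcurv.mono fun x hx => hx.1.1)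
    (hcurv.mono fun x hx => hx.1.2) (hcurv.mono fun x hx => hx.2.1)
    (hcurv.mono fun x hx => hx.2.2)

end Necessity

/-! ### Pulling back a linear equation -/

section Pullback

variable {Z U : ℂ × ℂ → ℂ} {q : ℂ × ℂ}

/-- The pullback of the equation `U'' = a U' + e` under a point transformation is cubic in `u'`. -/
theorem exists_pullback {S : Set (ℂ × ℂ)} {a e : ℂ × ℂ → ℂ} (hZ : ∀ q ∈ S, Hol Z q)
    (hU : ∀ q ∈ S, Hol U q) (hJ : ∀ q ∈ S, jac Z U q ≠ 0) (ha : ∀ q ∈ S, Hol a q)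
    (he : ∀ q ∈ S, Hol e q) :
    ∃ A B C D : ℂ × ℂ → ℂ, (∀ q ∈ S, Hol A q ∧ Hol B q ∧ Hol C q ∧ Hol D q) ∧
      ∀ (ζ υ : ℂ → ℂ) (t : ℂ), AnalyticAt ℂ ζ t → AnalyticAt ℂ υ t → (ζ t, υ t) ∈ S →
        wr (fun s => Z (ζ s, υ s)) (fun s => U (ζ s, υ s)) t -
          cubicForm 0 0 (a (ζ t, υ t)) (e (ζ t, υ t)) (deriv (fun s => Z (ζ s, υ s)) t)
            (deriv (fun s => U (ζ s, υ s)) t) =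
        jac Z U (ζ t, υ t) * (wr ζ υ t - cubicForm (A (ζ t, υ t)) (B (ζ t, υ t)) (C (ζ t, υ t))
          (D (ζ t, υ t)) (deriv ζ t) (deriv υ t)) := by
  set α₁ := coefZ Z U (Dz (Dz Z)) (Dz (Dz U)) with hα₁
  set β₁ := coefU Z U (Dz (Dz Z)) (Dz (Dz U)) with hβ₁
  set α₂ := coefZ Z U (Du (Dz Z)) (Du (Dz U)) with hα₂
  set β₂ := coefU Z U (Du (Dz Z)) (Du (Dz U)) with hβ₂
  set α₃ := coefZ Z U (Du (Du Z)) (Du (Du U)) with hα₃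
  set β₃ := coefU Z U (Du (Du Z)) (Du (Du U)) with hβ₃
  -- The coefficients of `wr_comp`, corrected by those of `a U' Z'² + e Z'³` with `Z' = Z_z ζ' + Z_u
  -- υ'` and `U' = U_z ζ' + U_u υ'`, divided by the Jacobian.
  refine ⟨fun x => α₃ x + (a x * Du U x * Du Z x ^ 2 + e x * Du Z x ^ 3) / jac Z U x,
    fun x => 2 * α₂ x - β₃ x + (a x * (Dz U x * Du Z x ^ 2 + 2 * Du U x * Dz Z x * Du Z x)
      + 3 * e x * Dz Z x * Du Z x ^ 2) / jac Z U x,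
    fun x => α₁ x - 2 * β₂ x + (a x * (Du U x * Dz Z x ^ 2 + 2 * Dz U x * Dz Z x * Du Z x)
      + 3 * e x * Dz Z x ^ 2 * Du Z x) / jac Z U x,
    fun x => -β₁ x + (a x * Dz U x * Dz Z x ^ 2 + e x * Dz Z x ^ 3) / jac Z U x, ?_, ?_⟩
  · intro q hq
    have hZ := hZ q hq
    have hU := hU q hq
    have ha := ha q hq
    have he := he q hq
    have hJ := hJ q hq
    have k₁ : Hol α₁ q := .coefZ hZ hU hJ hZ.Dz.Dz hU.Dz.Dz
    have l₁ : Hol β₁ q := .coefU hZ hU hJ hZ.Dz.Dz hU.Dz.Dz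
    have k₂ : Hol α₂ q := .coefZ hZ hU hJ hZ.Dz.Du hU.Dz.Du
    have l₂ : Hol β₂ q := .coefU hZ hU hJ hZ.Dz.Du hU.Dz.Du
    have k₃ : Hol α₃ q := .coefZ hZ hU hJ hZ.Du.Du hU.Du.Du
    have l₃ : Hol β₃ q := .coefU hZ hU hJ hZ.Du.Du hU.Du.Du
    have hj := Hol.jac hZ hU
    clear_value α₁ α₂ α₃ β₁ β₂ β₃
    refine ⟨Hol.add (by fun_prop) (Hol.div (by fun_prop) hj hJ),
      Hol.add (by fun_prop) (Hol.div (by fun_prop) hj hJ),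
      Hol.add (by fun_prop) (Hol.div (by fun_prop) hj hJ),
      Hol.add (by fun_prop) (Hol.div (by fun_prop) hj hJ)⟩
  · intro ζ υ t hζ hυ hq
    have hZ := hZ _ hq
    have hU := hU _ hq
    have hJ := hJ _ hq
    rw [wr_comp hζ hυ rfl hZ hU (coef_fst hJ _ _) (coef_snd hJ _ _) (coef_fst hJ _ _)
      (coef_snd hJ _ _) (coef_fst hJ _ _) (coef_snd hJ _ _), deriv_comp_pair hZ hζ hυ,
      deriv_comp_pair hU hζ hυ, ← hα₁, ← hα₂, ← hα₃, ← hβ₁, ← hβ₂, ← hβ₃]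
    simp only [cubicForm]
    field_simp
    ring

theorem Dz_comp {f : ℂ × ℂ → ℂ} (hf : Hol f (Z q, U q)) (hZ : Hol Z q) (hU : Hol U q) :
    Dz (fun x => f (Z x, U x)) q = Dz f (Z q, U q) * Dz Z q + Du f (Z q, U q) * Dz U q := by
  have h := hf.differentiableAt.hasFDerivAt.comp q
    (hZ.differentiableAt.hasFDerivAt.prodMk hU.differentiableAt.hasFDerivAt)
  have h' : fderiv ℂ (fun x => f (Z x, U x)) q = _ := h.fderiv
  rw [Dz, h']
  simp [fderiv_apply_eq, mul_comm]

theorem Du_comp {f : ℂ × ℂ → ℂ} (hf : Hol f (Z q, U q)) (hZ : Hol Z q) (hU : Hol U q) :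
    Du (fun x => f (Z x, U x)) q = Dz f (Z q, U q) * Du Z q + Du f (Z q, U q) * Du U q := by
  have h := hf.differentiableAt.hasFDerivAt.comp q
    (hZ.differentiableAt.hasFDerivAt.prodMk hU.differentiableAt.hasFDerivAt)
  have h' : fderiv ℂ (fun x => f (Z x, U x)) q = _ := h.fderiv
  rw [Du, h']
  simp [fderiv_apply_eq, mul_comm]

theorem Hol.comp_pair {f : ℂ × ℂ → ℂ} (hf : Hol f (Z q, U q)) (hZ : Hol Z q) (hU : Hol U q) :
    Hol (fun x => f (Z x, U x)) q := by
  refine Hol.comp (T := fun x => (Z x, U x)) hf ?_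
  filter_upwards [hZ, hU] with x h1 h2 using h1.prodMk h2

theorem Hol.comp_fst {a : ℂ → ℂ} (ha : AnalyticAt ℂ a q.1) : Hol (fun x : ℂ × ℂ => a x.1) q := by
  filter_upwards [continuousAt_fst.eventually ha.eventually_analyticAt] with x hx
  exact hx.differentiableAt.comp x differentiableAt_fst

theorem Du_comp_fst {a : ℂ → ℂ} (ha : AnalyticAt ℂ a q.1) :
    Du (fun x : ℂ × ℂ => a x.1) q = 0 := by
  have h : HasFDerivAt (fun x : ℂ × ℂ => a x.1) _ q :=
    HasFDerivAt.comp (g := a) q ha.differentiableAt.hasFDerivAt hasFDerivAt_fst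
  rw [Du, h.fderiv]
  simp

/-- A linear equation satisfies Lie's conditions. -/
theorem lie_linear {a b c : ℂ → ℂ} (ha : AnalyticAt ℂ a q.1) (hb : AnalyticAt ℂ b q.1)
    (hc : AnalyticAt ℂ c q.1) :
    lie₁ (fun _ => 0) (fun _ => 0) (fun x => a x.1) (fun x => b x.1 * x.2 + c x.1) q = 0 ∧
    lie₂ (fun _ => 0) (fun _ => 0) (fun x => a x.1) (fun x => b x.1 * x.2 + c x.1) q = 0 := by
  have hz : Dz (fun _ : ℂ × ℂ => (0 : ℂ)) = fun _ => 0 := funext fun x => Dz_const 0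
  have hu : Du (fun _ : ℂ × ℂ => (0 : ℂ)) = fun _ => 0 := funext fun x => Du_const 0
  have hau : Du (fun x : ℂ × ℂ => a x.1) =ᶠ[𝓝 q] fun _ => 0 := by
    filter_upwards [continuousAt_fst.eventually ha.eventually_analyticAt] with x hx
    exact Du_comp_fst hx
  have hbu : Du (fun x : ℂ × ℂ => b x.1 * x.2 + c x.1) =ᶠ[𝓝 q] fun x => b x.1 := by
    filter_upwards [continuousAt_fst.eventually hb.eventually_analyticAt,
      continuousAt_fst.eventually hc.eventually_analyticAt] with x hbx hcx
    have h2 : Hol (fun x : ℂ × ℂ => x.2) x := Eventually.of_forall fun _ => differentiableAt_snd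
    have h3 : Du (fun x : ℂ × ℂ => x.2) x = 1 := by
      rw [Du, (hasFDerivAt_snd (𝕜 := ℂ) (p := x)).fderiv]; rfl
    rw [Du_add ((Hol.comp_fst hbx).mul h2) (Hol.comp_fst hcx), Du_mul (Hol.comp_fst hbx) h2,
      Du_comp_fst hbx, Du_comp_fst hcx, h3]
    ring
  have hazu : Du (Dz (fun x : ℂ × ℂ => a x.1)) q = 0 := by
    rw [← (Hol.comp_fst ha).Dz_Du, Dz_congr hau, Dz_const]
  have hauu : Du (Du (fun x : ℂ × ℂ => a x.1)) q = 0 := by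
    rw [Du_congr hau, Du_const]
  have hbuu : Du (Du (fun x : ℂ × ℂ => b x.1 * x.2 + c x.1)) q = 0 := by
    rw [Du_congr hbu, Du_comp_fst hb]
  constructor
  · simp [lie₁, hz, hu, hauu]
  · simp [lie₂, hz, hazu, hbuu, hau.self_of_nhds, hu]

/-- If a point transformation takes `u'' = A u'³ + B u'² + C u' + D` to a linear equation, then
Lie's conditions hold. -/
theorem lie_of_linearization {A B C D : ℂ × ℂ → ℂ} {a b c : ℂ → ℂ} (hZ : Hol Z q) (hU : Hol U q)
    (hJ : jac Z U q ≠ 0) (ha : AnalyticAt ℂ a (Z q)) (hb : AnalyticAt ℂ b (Z q))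
    (hc : AnalyticAt ℂ c (Z q)) (h : ∀ᶠ x in 𝓝 q, MapsODE Z U x
      (cubicForm 0 0 (a (Z x)) (b (Z x) * U x + c (Z x))) (cubicForm (A x) (B x) (C x) (D x))) :
    lie₁ A B C D q = 0 ∧ lie₂ A B C D q = 0 := by
  have hev : ∀ {d : ℂ → ℂ}, AnalyticAt ℂ d (Z q) →
      ∀ᶠ x : ℂ × ℂ in 𝓝 (Z q, U q), AnalyticAt ℂ d x.1 := fun hd =>
    continuousAt_fst.eventually hd.eventually_analyticAt
  have h2 : Hol (fun x : ℂ × ℂ => x.2) (Z q, U q) :=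
    Eventually.of_forall fun _ => differentiableAt_snd
  -- The sufficiency part, applied to the linear target equation, carries it on to `U'' = 0`; the
  -- composite map straightens the original equation.
  obtain ⟨Z', U', hZ', hU', hJ', hM⟩ := exists_straightening (q₀ := (Z q, U q))
    (A := fun _ => 0) (B := fun _ => 0) (C := fun x => a x.1) (D := fun x => b x.1 * x.2 + c x.1)
    (Hol.const _) (Hol.const _) (Hol.comp_fst ha)
    (((Hol.comp_fst hb).mul h2).add (Hol.comp_fst hc))
    (by filter_upwards [hev ha, hev hb, hev hc] with x h1 h2 h3 using (lie_linear h1 h2 h3).1)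
    (by filter_upwards [hev ha, hev hb, hev hc] with x h1 h2 h3 using (lie_linear h1 h2 h3).2)
  refine lie_of_straightening (Z := fun x => Z' (Z x, U x)) (U := fun x => U' (Z x, U x))
    (hZ'.comp_pair hZ hU) (hU'.comp_pair hZ hU) ?_ ?_
  · rw [jac, Dz_comp hZ' hZ hU, Du_comp hZ' hZ hU, Dz_comp hU' hZ hU, Du_comp hU' hZ hU]
    have := mul_ne_zero hJ' hJ
    convert this using 1
    simp only [jac]
    ring
  · have hcont : ContinuousAt (fun x => (Z x, U x)) q :=
      hZ.differentiableAt.continuousAt.prodMk hU.differentiableAt.continuousAt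
    filter_upwards [h, hcont.eventually hM, hZ.eventually, hU.eventually] with x hx hMx hZx hUx
    intro ζ υ t hζ hυ hq
    subst hq
    rw [← hx ζ υ t hζ hυ rfl]
    exact hMx (fun s => Z (ζ s, υ s)) (fun s => U (ζ s, υ s)) t (analyticAt_comp_pair hZx hζ hυ)
      (analyticAt_comp_pair hUx hζ hυ) rfl

end Pullback

/-! ### Real and complex derivatives -/

section OneVariable

theorem hasDerivAt_mk_left {v : ℂ → ℂ} {v' : ℂ} {x y : ℝ} (h : HasDerivAt v v' ⟨x, y⟩) :
    HasDerivAt (fun t : ℝ => v ⟨t, y⟩) v' x := by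
  have h1 : HasDerivAt (fun t : ℝ => (⟨t, y⟩ : ℂ)) 1 x := by
    have h2 : (fun t : ℝ => (⟨t, y⟩ : ℂ)) = fun t : ℝ => (t : ℂ) + y * Complex.I := by
      funext t; apply Complex.ext <;> simp
    rw [h2]
    simpa using (hasDerivAt_id x).ofReal_comp.add_const (y * Complex.I)
  simpa [Function.comp_def] using HasDerivAt.scomp x h h1

theorem hasDerivAt_mk_right {v : ℂ → ℂ} {v' : ℂ} {x y : ℝ} (h : HasDerivAt v v' ⟨x, y⟩) :
    HasDerivAt (fun t : ℝ => v ⟨x, t⟩) (Complex.I * v') y := by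
  have h1 : HasDerivAt (fun t : ℝ => (⟨x, t⟩ : ℂ)) Complex.I y := by
    have h2 : (fun t : ℝ => (⟨x, t⟩ : ℂ)) = fun t : ℝ => (x : ℂ) + t * Complex.I := by
      funext t; apply Complex.ext <;> simp
    rw [h2]
    simpa using ((hasDerivAt_id y).ofReal_comp.mul_const Complex.I).const_add (x : ℂ)
  simpa [Function.comp_def] using HasDerivAt.scomp y h h1

theorem hasDerivAt_re {v : ℝ → ℂ} {v' : ℂ} {t : ℝ} (h : HasDerivAt v v' t) :
    HasDerivAt (fun s => (v s).re) v'.re t := by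
  simpa [Function.comp_def] using Complex.reCLM.hasFDerivAt.comp_hasDerivAt t h

theorem hasDerivAt_im {v : ℝ → ℂ} {v' : ℂ} {t : ℝ} (h : HasDerivAt v v' t) :
    HasDerivAt (fun s => (v s).im) v'.im t := by
  simpa [Function.comp_def] using Complex.imCLM.hasFDerivAt.comp_hasDerivAt t h

theorem continuous_mk_left (y : ℝ) : Continuous fun t : ℝ => (⟨t, y⟩ : ℂ) := by
  have h2 : (fun t : ℝ => (⟨t, y⟩ : ℂ)) = fun t : ℝ => (t : ℂ) + y * Complex.I := by
    funext t; apply Complex.ext <;> simp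
  rw [h2]; fun_prop

theorem continuous_mk_right (x : ℝ) : Continuous fun t : ℝ => (⟨x, t⟩ : ℂ) := by
  have h2 : (fun t : ℝ => (⟨x, t⟩ : ℂ)) = fun t : ℝ => (x : ℂ) + t * Complex.I := by
    funext t; apply Complex.ext <;> simp
  rw [h2]; fun_prop

/-- Near `z`, the pair `(k₁, k₂)` is the pair of real and imaginary parts of `K`. -/
def IsReIm (k₁ k₂ : ℝ → ℝ → ℝ) (K : ℂ → ℂ) (z : ℂ) : Prop :=
  ∀ᶠ w in 𝓝 z, k₁ w.re w.im = (K w).re ∧ k₂ w.re w.im = (K w).im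

variable {k₁ k₂ : ℝ → ℝ → ℝ} {K : ℂ → ℂ} {z : ℂ}

theorem IsReIm.px (h : IsReIm k₁ k₂ K z) (hK : AnalyticAt ℂ K z) :
    IsReIm (px k₁) (px k₂) (deriv K) z := by
  filter_upwards [h.eventually_nhds, hK.eventually_analyticAt] with w hw hKw
  have h1 := hasDerivAt_mk_left (x := w.re) (y := w.im) hKw.differentiableAt.hasDerivAt
  have h2 : ∀ᶠ t in 𝓝 w.re, k₁ t w.im = (K ⟨t, w.im⟩).re ∧ k₂ t w.im = (K ⟨t, w.im⟩).im :=
    (continuous_mk_left w.im).continuousAt.eventually hw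
  exact ⟨((hasDerivAt_re h1).congr_of_eventuallyEq (h2.mono fun _ h => h.1)).deriv,
    ((hasDerivAt_im h1).congr_of_eventuallyEq (h2.mono fun _ h => h.2)).deriv⟩

theorem IsReIm.py (h : IsReIm k₁ k₂ K z) (hK : AnalyticAt ℂ K z) :
    IsReIm (py k₁) (py k₂) (fun w => Complex.I * deriv K w) z := by
  filter_upwards [h.eventually_nhds, hK.eventually_analyticAt] with w hw hKw
  have h1 := hasDerivAt_mk_right (x := w.re) (y := w.im) hKw.differentiableAt.hasDerivAt
  have h2 : ∀ᶠ t in 𝓝 w.im, k₁ w.re t = (K ⟨w.re, t⟩).re ∧ k₂ w.re t = (K ⟨w.re, t⟩).im :=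
    (continuous_mk_right w.re).continuousAt.eventually hw
  exact ⟨((hasDerivAt_re h1).congr_of_eventuallyEq (h2.mono fun _ h => h.1)).deriv,
    ((hasDerivAt_im h1).congr_of_eventuallyEq (h2.mono fun _ h => h.2)).deriv⟩

theorem isReIm_toComplex (f g : ℝ → ℝ → ℝ) (z : ℂ) : IsReIm f g (toComplex f g) z :=
  Eventually.of_forall fun _ => ⟨rfl, rfl⟩

variable {f g : ℝ → ℝ → ℝ} {x y : ℝ}

/-- By the Cauchy–Riemann equations both terms averaged in `h` are `Re u'`, and both in `l` are `Im
u'`. -/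
theorem hh_ll_eq (hu : AnalyticAt ℂ (toComplex f g) ⟨x, y⟩) :
    (⟨hh f g x y, ll f g x y⟩ : ℂ) = deriv (toComplex f g) ⟨x, y⟩ := by
  have h := isReIm_toComplex f g ⟨x, y⟩
  obtain ⟨h1, h2⟩ := (h.px hu).self_of_nhds
  obtain ⟨h3, h4⟩ := (h.py hu).self_of_nhds
  simp only [Complex.mul_re, Complex.mul_im, Complex.I_re, Complex.I_im] at h1 h2 h3 h4
  apply Complex.ext
  · show (ComplexLin.px f x y + ComplexLin.py g x y) / 2 = _
    rw [h1, h4]; ring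
  · show (ComplexLin.px g x y - ComplexLin.py f x y) / 2 = _
    rw [h2, h3]; ring

/-- The system of real equations is one complex ordinary differential equation. -/
theorem satisfiesAt_iff (w₁ w₂ : Fun6) (hu : AnalyticAt ℂ (toComplex f g) ⟨x, y⟩) :
    SatisfiesAt w₁ w₂ f g x y ↔ deriv (deriv (toComplex f g)) ⟨x, y⟩ =
      ⟨w₁ x y (f x y) (g x y) (hh f g x y) (ll f g x y),
        w₂ x y (f x y) (g x y) (hh f g x y) (ll f g x y)⟩ := by
  have h := isReIm_toComplex f g ⟨x, y⟩
  have hI : AnalyticAt ℂ (fun w => Complex.I * deriv (toComplex f g) w) ⟨x, y⟩ :=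
    analyticAt_const.mul hu.deriv
  have hd : deriv (fun w => Complex.I * deriv (toComplex f g) w) ⟨x, y⟩ =
      Complex.I * deriv (deriv (toComplex f g)) ⟨x, y⟩ := deriv_const_mul _ hu.deriv.differentiableAt
  obtain ⟨h1, h2⟩ := ((h.px hu).px hu.deriv).self_of_nhds
  obtain ⟨h3, h4⟩ := ((h.px hu).py hu.deriv).self_of_nhds
  obtain ⟨h5, h6⟩ := ((h.py hu).py hI).self_of_nhds
  simp only [hd, Complex.mul_re, Complex.mul_im, Complex.I_re, Complex.I_im] at h1 h2 h3 h4 h5 h6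
  -- The terms of the first equation contribute `1 + 1 + 2` times `Re u''`, those of the second the
  -- same multiple of `Im u''`; this is the source of the factor `4`.
  rw [SatisfiesAt, h1, h2, h3, h4, h5, h6, Complex.ext_iff]
  refine and_congr ?_ ?_
  · constructor <;> intro h <;> linarith
  · constructor <;> intro h <;> linarith

end OneVariable

/-! ### Real and imaginary parts of functions of `(z, u)`. -/

section FourVariables

/-- The value of `k` at the point of `ℝ⁴` that corresponds to a point of `ℂ²`. -/
def evalAt (k : Fun4) (p : ℂ × ℂ) : ℝ := k p.1.re p.1.im p.2.re p.2.im

/-- Near `q`, the pair `(k₁, k₂)` is the pair of real and imaginary parts of `K`. -/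
def IsReIm₄ (k₁ k₂ : Fun4) (K : ℂ × ℂ → ℂ) (q : ℂ × ℂ) : Prop :=
  ∀ᶠ p in 𝓝 q, evalAt k₁ p = (K p).re ∧ evalAt k₂ p = (K p).im

variable {k₁ k₂ : Fun4} {K : ℂ × ℂ → ℂ} {q : ℂ × ℂ}

theorem Hol.hasDerivAt_fst {p : ℂ × ℂ} (h : Hol K p) :
    HasDerivAt (fun w => K (w, p.2)) (ComplexLin.Dz K p) p.1 := by
  have := hasDerivAt_comp_pair (f := K) (ζ := fun w => w) (υ := fun _ => p.2) (t := p.1)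
    h.differentiableAt (by fun_prop) (by fun_prop)
  simpa using this

theorem Hol.hasDerivAt_snd {p : ℂ × ℂ} (h : Hol K p) :
    HasDerivAt (fun w => K (p.1, w)) (ComplexLin.Du K p) p.2 := by
  have := hasDerivAt_comp_pair (f := K) (ζ := fun _ => p.1) (υ := fun w => w) (t := p.2)
    h.differentiableAt (by fun_prop) (by fun_prop)
  simpa using this

theorem IsReIm₄.dx (h : IsReIm₄ k₁ k₂ K q) (hK : Hol K q) :
    IsReIm₄ (dx k₁) (dx k₂) (Dz K) q := by
  filter_upwards [h.eventually_nhds, hK.eventually] with p hp hKp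
  have h1 := hasDerivAt_mk_left (x := p.1.re) (y := p.1.im) hKp.hasDerivAt_fst
  have h2 : ∀ᶠ t : ℝ in 𝓝 p.1.re, evalAt k₁ (⟨t, p.1.im⟩, p.2) = (K (⟨t, p.1.im⟩, p.2)).re ∧
      evalAt k₂ (⟨t, p.1.im⟩, p.2) = (K (⟨t, p.1.im⟩, p.2)).im :=
    ((continuous_mk_left p.1.im).prodMk continuous_const).continuousAt.eventually hp
  exact ⟨((hasDerivAt_re h1).congr_of_eventuallyEq (h2.mono fun _ h => h.1)).deriv,
    ((hasDerivAt_im h1).congr_of_eventuallyEq (h2.mono fun _ h => h.2)).deriv⟩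

theorem IsReIm₄.dy (h : IsReIm₄ k₁ k₂ K q) (hK : Hol K q) :
    IsReIm₄ (dy k₁) (dy k₂) (fun p => Complex.I * Dz K p) q := by
  filter_upwards [h.eventually_nhds, hK.eventually] with p hp hKp
  have h1 := hasDerivAt_mk_right (x := p.1.re) (y := p.1.im) hKp.hasDerivAt_fst
  have h2 : ∀ᶠ t : ℝ in 𝓝 p.1.im, evalAt k₁ (⟨p.1.re, t⟩, p.2) = (K (⟨p.1.re, t⟩, p.2)).re ∧
      evalAt k₂ (⟨p.1.re, t⟩, p.2) = (K (⟨p.1.re, t⟩, p.2)).im :=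
    ((continuous_mk_right p.1.re).prodMk continuous_const).continuousAt.eventually hp
  exact ⟨((hasDerivAt_re h1).congr_of_eventuallyEq (h2.mono fun _ h => h.1)).deriv,
    ((hasDerivAt_im h1).congr_of_eventuallyEq (h2.mono fun _ h => h.2)).deriv⟩

theorem IsReIm₄.df (h : IsReIm₄ k₁ k₂ K q) (hK : Hol K q) :
    IsReIm₄ (df k₁) (df k₂) (Du K) q := by
  filter_upwards [h.eventually_nhds, hK.eventually] with p hp hKp
  have h1 := hasDerivAt_mk_left (x := p.2.re) (y := p.2.im) hKp.hasDerivAt_snd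
  have h2 : ∀ᶠ t : ℝ in 𝓝 p.2.re, evalAt k₁ (p.1, ⟨t, p.2.im⟩) = (K (p.1, ⟨t, p.2.im⟩)).re ∧
      evalAt k₂ (p.1, ⟨t, p.2.im⟩) = (K (p.1, ⟨t, p.2.im⟩)).im :=
    (continuous_const.prodMk (continuous_mk_left p.2.im)).continuousAt.eventually hp
  exact ⟨((hasDerivAt_re h1).congr_of_eventuallyEq (h2.mono fun _ h => h.1)).deriv,
    ((hasDerivAt_im h1).congr_of_eventuallyEq (h2.mono fun _ h => h.2)).deriv⟩

theorem IsReIm₄.dg (h : IsReIm₄ k₁ k₂ K q) (hK : Hol K q) :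
    IsReIm₄ (dg k₁) (dg k₂) (fun p => Complex.I * Du K p) q := by
  filter_upwards [h.eventually_nhds, hK.eventually] with p hp hKp
  have h1 := hasDerivAt_mk_right (x := p.2.re) (y := p.2.im) hKp.hasDerivAt_snd
  have h2 : ∀ᶠ t : ℝ in 𝓝 p.2.im, evalAt k₁ (p.1, ⟨p.2.re, t⟩) = (K (p.1, ⟨p.2.re, t⟩)).re ∧
      evalAt k₂ (p.1, ⟨p.2.re, t⟩) = (K (p.1, ⟨p.2.re, t⟩)).im :=
    (continuous_const.prodMk (continuous_mk_right p.2.re)).continuousAt.eventually hp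
  exact ⟨((hasDerivAt_re h1).congr_of_eventuallyEq (h2.mono fun _ h => h.1)).deriv,
    ((hasDerivAt_im h1).congr_of_eventuallyEq (h2.mono fun _ h => h.2)).deriv⟩

variable {A₁ A₂ B₁ B₂ C₁ C₂ D₁ D₂ : Fun4} {A B C D : ℂ × ℂ → ℂ} {x y f g : ℝ}

/-- The derivatives of order at most two of the real and imaginary parts. -/
theorem IsReIm₄.derivs (h : IsReIm₄ k₁ k₂ K (⟨x, y⟩, ⟨f, g⟩))
    (hK : Hol K (⟨x, y⟩, ⟨f, g⟩)) :
    (k₁ x y f g = (K (⟨x, y⟩, ⟨f, g⟩)).re ∧ k₂ x y f g = (K (⟨x, y⟩, ⟨f, g⟩)).im) ∧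
    (ComplexLin.dx k₁ x y f g = (Dz K (⟨x, y⟩, ⟨f, g⟩)).re ∧
      ComplexLin.dx k₂ x y f g = (Dz K (⟨x, y⟩, ⟨f, g⟩)).im) ∧
    (ComplexLin.dy k₁ x y f g = -(Dz K (⟨x, y⟩, ⟨f, g⟩)).im ∧
      ComplexLin.dy k₂ x y f g = (Dz K (⟨x, y⟩, ⟨f, g⟩)).re) ∧
    (ComplexLin.df k₁ x y f g = (Du K (⟨x, y⟩, ⟨f, g⟩)).re ∧
      ComplexLin.df k₂ x y f g = (Du K (⟨x, y⟩, ⟨f, g⟩)).im) ∧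
    (ComplexLin.dg k₁ x y f g = -(Du K (⟨x, y⟩, ⟨f, g⟩)).im ∧
      ComplexLin.dg k₂ x y f g = (Du K (⟨x, y⟩, ⟨f, g⟩)).re) := by
  obtain ⟨a1, a2⟩ := h.self_of_nhds
  obtain ⟨b1, b2⟩ := (h.dx hK).self_of_nhds
  obtain ⟨c1, c2⟩ := (h.dy hK).self_of_nhds
  obtain ⟨d1, d2⟩ := (h.df hK).self_of_nhds
  obtain ⟨e1, e2⟩ := (h.dg hK).self_of_nhds
  simp only [evalAt, Complex.mul_re, Complex.mul_im, Complex.I_re, Complex.I_im, zero_mul,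
    one_mul, zero_sub, zero_add] at a1 a2 b1 b2 c1 c2 d1 d2 e1 e2
  exact ⟨⟨a1, a2⟩, ⟨b1, b2⟩, ⟨c1, c2⟩, ⟨d1, d2⟩, ⟨e1, e2⟩⟩

/-- For holomorphic coefficients a first-order term appears twice, through `∂_x` and `∂_y` or
through `∂_f` and `∂_g`, and a second-order one four times; the numerical factors of the constraints
make the total `4` in each case. -/
theorem constraints_eq
    (hA : IsReIm₄ A₁ A₂ A (⟨x, y⟩, ⟨f, g⟩)) (hB : IsReIm₄ B₁ B₂ B (⟨x, y⟩, ⟨f, g⟩))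
    (hC : IsReIm₄ C₁ C₂ C (⟨x, y⟩, ⟨f, g⟩)) (hD : IsReIm₄ D₁ D₂ D (⟨x, y⟩, ⟨f, g⟩))
    (kA : Hol A (⟨x, y⟩, ⟨f, g⟩)) (kB : Hol B (⟨x, y⟩, ⟨f, g⟩))
    (kC : Hol C (⟨x, y⟩, ⟨f, g⟩)) (kD : Hol D (⟨x, y⟩, ⟨f, g⟩)) :
    constraint₁ A₁ A₂ B₁ B₂ C₁ C₂ D₁ D₂ x y f g = 4 * (lie₁ A B C D (⟨x, y⟩, ⟨f, g⟩)).re ∧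
    constraint₂ A₁ A₂ B₁ B₂ C₁ C₂ D₁ D₂ x y f g = 4 * (lie₁ A B C D (⟨x, y⟩, ⟨f, g⟩)).im ∧
    constraint₃ A₁ A₂ B₁ B₂ C₁ C₂ D₁ D₂ x y f g = 4 * (lie₂ A B C D (⟨x, y⟩, ⟨f, g⟩)).re ∧
    constraint₄ A₁ A₂ B₁ B₂ C₁ C₂ D₁ D₂ x y f g = 4 * (lie₂ A B C D (⟨x, y⟩, ⟨f, g⟩)).im := by
  have I1 : ∀ {K : ℂ × ℂ → ℂ}, Hol K (⟨x, y⟩, ⟨f, g⟩) →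
      Dz (fun p => Complex.I * Dz K p) (⟨x, y⟩, ⟨f, g⟩) =
        Complex.I * Dz (Dz K) (⟨x, y⟩, ⟨f, g⟩) := fun h => Dz_const_mul _ h.Dz
  have I2 : ∀ {K : ℂ × ℂ → ℂ}, Hol K (⟨x, y⟩, ⟨f, g⟩) →
      Du (fun p => Complex.I * Dz K p) (⟨x, y⟩, ⟨f, g⟩) =
        Complex.I * Du (Dz K) (⟨x, y⟩, ⟨f, g⟩) := fun h => Du_const_mul _ h.Dz
  have I3 : ∀ {K : ℂ × ℂ → ℂ}, Hol K (⟨x, y⟩, ⟨f, g⟩) →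
      Du (fun p => Complex.I * Du K p) (⟨x, y⟩, ⟨f, g⟩) =
        Complex.I * Du (Du K) (⟨x, y⟩, ⟨f, g⟩) := fun h => Du_const_mul _ h.Du
  have J1 : ∀ {K : ℂ × ℂ → ℂ}, Hol K (⟨x, y⟩, ⟨f, g⟩) →
      Hol (fun p => Complex.I * Dz K p) (⟨x, y⟩, ⟨f, g⟩) := fun h => by fun_prop
  have J2 : ∀ {K : ℂ × ℂ → ℂ}, Hol K (⟨x, y⟩, ⟨f, g⟩) →
      Hol (fun p => Complex.I * Du K p) (⟨x, y⟩, ⟨f, g⟩) := fun h => by fun_prop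
  obtain ⟨⟨a1, a2⟩, ⟨a3, a4⟩, ⟨a5, a6⟩, ⟨a7, a8⟩, ⟨a9, a10⟩⟩ := hA.derivs kA
  obtain ⟨⟨b1, b2⟩, ⟨b3, b4⟩, ⟨b5, b6⟩, ⟨b7, b8⟩, ⟨b9, b10⟩⟩ := hB.derivs kB
  obtain ⟨⟨c1, c2⟩, ⟨c3, c4⟩, ⟨c5, c6⟩, ⟨c7, c8⟩, ⟨c9, c10⟩⟩ := hC.derivs kC
  obtain ⟨⟨d1, d2⟩, ⟨d3, d4⟩, ⟨d5, d6⟩, ⟨d7, d8⟩, ⟨d9, d10⟩⟩ := hD.derivs kD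
  obtain ⟨-, ⟨a11, a12⟩, ⟨a13, a14⟩, -, -⟩ := (hA.dx kA).derivs kA.Dz
  obtain ⟨-, -, ⟨a15, a16⟩, -, -⟩ := (hA.dy kA).derivs (J1 kA)
  obtain ⟨-, ⟨b11, b12⟩, ⟨b13, b14⟩, ⟨b17, b18⟩, ⟨b19, b20⟩⟩ := (hB.dx kB).derivs kB.Dz
  obtain ⟨-, -, ⟨b15, b16⟩, ⟨b21, b22⟩, ⟨b23, b24⟩⟩ := (hB.dy kB).derivs (J1 kB)
  obtain ⟨-, -, -, ⟨c17, c18⟩, ⟨c19, c20⟩⟩ := (hC.dx kC).derivs kC.Dz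
  obtain ⟨-, -, -, ⟨c21, c22⟩, ⟨c23, c24⟩⟩ := (hC.dy kC).derivs (J1 kC)
  obtain ⟨-, -, -, ⟨c11, c12⟩, ⟨c13, c14⟩⟩ := (hC.df kC).derivs kC.Du
  obtain ⟨-, -, -, -, ⟨c15, c16⟩⟩ := (hC.dg kC).derivs (J2 kC)
  obtain ⟨-, -, -, ⟨d11, d12⟩, ⟨d13, d14⟩⟩ := (hD.df kD).derivs kD.Du
  obtain ⟨-, -, -, -, ⟨d15, d16⟩⟩ := (hD.dg kD).derivs (J2 kD)
  simp only [I1 kA, I1 kB, I2 kB, I2 kC, I3 kC, I3 kD, Complex.mul_re, Complex.mul_im,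
    Complex.I_re, Complex.I_im, zero_mul, one_mul, zero_sub, zero_add]
    at a15 a16 b15 b16 b21 b22 b23 b24 c21 c22 c23 c24 c15 c16 d15 d16
  refine ⟨?_, ?_, ?_, ?_⟩
  · simp only [constraint₁, lie₁, Pi.add_apply, Pi.sub_apply, Pi.mul_apply, Pi.ofNat_apply, *]
    simp
    ring
  · simp only [constraint₂, lie₁, Pi.add_apply, Pi.sub_apply, Pi.mul_apply, Pi.ofNat_apply, *]
    simp
    ring
  · simp only [constraint₃, lie₂, Pi.add_apply, Pi.sub_apply, Pi.mul_apply, Pi.ofNat_apply, *]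
    simp
    ring
  · simp only [constraint₄, lie₂, Pi.add_apply, Pi.sub_apply, Pi.mul_apply, Pi.ofNat_apply, *]
    simp
    ring

theorem constraints_iff
    (hA : IsReIm₄ A₁ A₂ A (⟨x, y⟩, ⟨f, g⟩)) (hB : IsReIm₄ B₁ B₂ B (⟨x, y⟩, ⟨f, g⟩))
    (hC : IsReIm₄ C₁ C₂ C (⟨x, y⟩, ⟨f, g⟩)) (hD : IsReIm₄ D₁ D₂ D (⟨x, y⟩, ⟨f, g⟩))
    (kA : Hol A (⟨x, y⟩, ⟨f, g⟩)) (kB : Hol B (⟨x, y⟩, ⟨f, g⟩))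
    (kC : Hol C (⟨x, y⟩, ⟨f, g⟩)) (kD : Hol D (⟨x, y⟩, ⟨f, g⟩)) :
    (constraint₁ A₁ A₂ B₁ B₂ C₁ C₂ D₁ D₂ x y f g = 0 ∧
      constraint₂ A₁ A₂ B₁ B₂ C₁ C₂ D₁ D₂ x y f g = 0 ∧
      constraint₃ A₁ A₂ B₁ B₂ C₁ C₂ D₁ D₂ x y f g = 0 ∧
      constraint₄ A₁ A₂ B₁ B₂ C₁ C₂ D₁ D₂ x y f g = 0) ↔
    lie₁ A B C D (⟨x, y⟩, ⟨f, g⟩) = 0 ∧ lie₂ A B C D (⟨x, y⟩, ⟨f, g⟩) = 0 := by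
  obtain ⟨h1, h2, h3, h4⟩ := constraints_eq hA hB hC hD kA kB kC kD
  rw [h1, h2, h3, h4, Complex.ext_iff, Complex.ext_iff]
  simp [and_assoc]

end FourVariables

/-! ### Change of the independent variable -/

section ChangeOfVariable

variable {ζ υ V : ℂ → ℂ} {t : ℂ}

theorem exists_local_inverse (hζ : AnalyticAt ℂ ζ t) (h0 : deriv ζ t ≠ 0) :
    ∃ σ : ℂ → ℂ, ∀ᶠ s in 𝓝 t, σ (ζ s) = s :=
  ⟨_, hζ.hasStrictDerivAt.eventually_left_inverse h0⟩

/-- A function that is analytic in terms of a local parameter is analytic. -/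
theorem analyticAt_of_comp (hζ : AnalyticAt ℂ ζ t) (hυ : AnalyticAt ℂ υ t) (h0 : deriv ζ t ≠ 0)
    (h : ∀ᶠ s in 𝓝 t, V (ζ s) = υ s) : AnalyticAt ℂ V (ζ t) :=
  (analyticAt_comp_iff_of_deriv_ne_zero hζ h0).1 (hυ.congr (h.mono fun _ hs => hs.symm))

/-- When `υ = V ∘ ζ` is differentiated twice, the term with `ζ''` cancels in `ζ'υ'' - υ'ζ''`. The
remaining factor `ζ'³` matches the degree of `cubicForm`. -/
theorem derivs_of_comp (hζ : AnalyticAt ℂ ζ t) (hV : AnalyticAt ℂ V (ζ t))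
    (h : ∀ᶠ s in 𝓝 t, V (ζ s) = υ s) :
    deriv υ t = deriv V (ζ t) * deriv ζ t ∧
      wr ζ υ t = deriv (deriv V) (ζ t) * deriv ζ t ^ 3 := by
  have h1 : deriv υ =ᶠ[𝓝 t] fun s => deriv V (ζ s) * deriv ζ s := by
    filter_upwards [h.eventually_nhds, hζ.eventually_analyticAt,
      hζ.continuousAt.eventually hV.eventually_analyticAt] with s hs hζs hVs
    have h2 : υ =ᶠ[𝓝 s] fun r => V (ζ r) := hs.mono fun _ h => h.symm
    rw [h2.deriv_eq]
    exact (hVs.differentiableAt.hasDerivAt.comp s hζs.differentiableAt.hasDerivAt).deriv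
  refine ⟨h1.self_of_nhds, ?_⟩
  have h3 : HasDerivAt (fun s => deriv V (ζ s)) (deriv (deriv V) (ζ t) * deriv ζ t) t :=
    hV.deriv.differentiableAt.hasDerivAt.comp t hζ.differentiableAt.hasDerivAt
  have h4 := (h3.fun_mul hζ.deriv.differentiableAt.hasDerivAt).deriv
  rw [wr, h1.deriv_eq, h4, h1.self_of_nhds]
  ring

end ChangeOfVariable

theorem linRe_linIm (a b c : ℂ → ℂ) (X Y F G H L : ℝ) :
    (⟨linRe a b c X Y F G H L, linIm a b c X Y F G H L⟩ : ℂ) =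
      a ⟨X, Y⟩ * ⟨H, L⟩ + b ⟨X, Y⟩ * ⟨F, G⟩ + c ⟨X, Y⟩ := by
  apply Complex.ext
  · simp [linRe]; ring
  · simp [linIm]; ring

/-- The transformed pair satisfies the linear system if and only if the transformed curve satisfies
the linear equation in parametric form. -/
theorem satisfiesAt_lin_iff {T : OpenPartialHomeomorph (ℂ × ℂ) (ℂ × ℂ)} {a b c : ℂ → ℂ}
    {f g F G : ℝ → ℝ → ℝ} {x y : ℝ} (hu : AnalyticAt ℂ (toComplex f g) ⟨x, y⟩)
    (hZ : Hol (fun q => (T q).1) (⟨x, y⟩, ⟨f x y, g x y⟩))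
    (hU : Hol (fun q => (T q).2) (⟨x, y⟩, ⟨f x y, g x y⟩))
    (h : TransformsTo T f g F G x y) :
    SatisfiesAt (linRe a b c) (linIm a b c) F G (T (⟨x, y⟩, ⟨f x y, g x y⟩)).1.re
        (T (⟨x, y⟩, ⟨f x y, g x y⟩)).1.im ↔
      wr (fun s => (T (s, toComplex f g s)).1) (fun s => (T (s, toComplex f g s)).2) ⟨x, y⟩ =
        cubicForm 0 0 (a (T (⟨x, y⟩, ⟨f x y, g x y⟩)).1)
          (b (T (⟨x, y⟩, ⟨f x y, g x y⟩)).1 * (T (⟨x, y⟩, ⟨f x y, g x y⟩)).2 +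
            c (T (⟨x, y⟩, ⟨f x y, g x y⟩)).1)
          (deriv (fun s => (T (s, toComplex f g s)).1) ⟨x, y⟩)
          (deriv (fun s => (T (s, toComplex f g s)).2) ⟨x, y⟩) := by
  obtain ⟨h0, hev⟩ := h
  have hid : AnalyticAt ℂ (fun s : ℂ => s) ⟨x, y⟩ := analyticAt_id
  have hζ : AnalyticAt ℂ (fun s => (T (s, toComplex f g s)).1) ⟨x, y⟩ :=
    analyticAt_comp_pair (f := fun q => (T q).1) hZ hid hu
  have hυ : AnalyticAt ℂ (fun s => (T (s, toComplex f g s)).2) ⟨x, y⟩ :=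
    analyticAt_comp_pair (f := fun q => (T q).2) hU hid hu
  -- Nothing is assumed about the regularity of `F`, `G`; it follows because `Z` is a local
  -- parameter along the curve.
  have hV := analyticAt_of_comp hζ hυ h0 hev
  obtain ⟨h1, h2⟩ := derivs_of_comp hζ hV hev
  have h3 := hev.self_of_nhds
  have hV' : AnalyticAt ℂ (toComplex F G) ⟨(T (⟨x, y⟩, ⟨f x y, g x y⟩)).1.re,
    (T (⟨x, y⟩, ⟨f x y, g x y⟩)).1.im⟩ := hV
  rw [satisfiesAt_iff _ _ hV', linRe_linIm, hh_ll_eq hV', h1, h2]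
  set Q := T (⟨x, y⟩, ⟨f x y, g x y⟩) with hQ
  have e1 : T (⟨x, y⟩, toComplex f g ⟨x, y⟩) = Q := rfl
  have e2 : (⟨F Q.1.re Q.1.im, G Q.1.re Q.1.im⟩ : ℂ) = Q.2 := h3
  have e3 : (⟨Q.1.re, Q.1.im⟩ : ℂ) = Q.1 := rfl
  rw [e1, e2, e3]
  set d := deriv (fun s => (T (s, toComplex f g s)).1) ⟨x, y⟩
  simp only [cubicForm]
  constructor
  · intro h
    rw [h]
    ring
  · intro h
    refine mul_right_cancel₀ (pow_ne_zero 3 h0) ?_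
    rw [h]
    ring

/-! ### Holomorphic point transformations -/

section PointTransformations

theorem Hol.hasStrictFDerivAt {f : ℂ × ℂ → ℂ} {q : ℂ × ℂ} (h : Hol f q) :
    HasStrictFDerivAt f (fderiv ℂ f q) q :=
  hasStrictFDerivAt_of_hasFDerivAt_of_continuousAt
    (by filter_upwards [h] with x hx using hx.hasFDerivAt) h.differentiableAt_fderiv.continuousAt

theorem exists_equiv_of_jac_ne {Z U : ℂ × ℂ → ℂ} {q : ℂ × ℂ} (hJ : jac Z U q ≠ 0) :
    ∃ e : (ℂ × ℂ) ≃L[ℂ] (ℂ × ℂ),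
      (e : ℂ × ℂ →L[ℂ] ℂ × ℂ) = (fderiv ℂ Z q).prod (fderiv ℂ U q) := by
  have hinj : Function.Injective ((fderiv ℂ Z q).prod (fderiv ℂ U q)).toLinearMap := by
    rw [← LinearMap.ker_eq_bot, LinearMap.ker_eq_bot']
    intro v hv
    have h1 : fderiv ℂ Z q v = 0 := congrArg Prod.fst hv
    have h2 : fderiv ℂ U q v = 0 := congrArg Prod.snd hv
    rw [fderiv_apply_eq, smul_eq_mul, smul_eq_mul] at h1 h2
    have h3 : v.1 * jac Z U q = 0 := by
      rw [jac]; linear_combination Du U q * h1 - Du Z q * h2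
    have h4 : v.2 * jac Z U q = 0 := by
      rw [jac]; linear_combination Dz Z q * h2 - Dz U q * h1
    exact Prod.ext ((mul_eq_zero.1 h3).resolve_right hJ) ((mul_eq_zero.1 h4).resolve_right hJ)
  refine ⟨(LinearEquiv.ofInjectiveEndo _ hinj).toContinuousLinearEquiv, ?_⟩
  ext <;> rfl

/-- A pair of holomorphic functions with non-vanishing Jacobian is a biholomorphic map between
neighbourhoods of a point and its image. -/
theorem exists_openPartialHomeomorph {Z U : ℂ × ℂ → ℂ} {q₀ : ℂ × ℂ} {S : Set (ℂ × ℂ)}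
    (hS : IsOpen S) (hq₀ : q₀ ∈ S) (hZ : ∀ q ∈ S, Hol Z q) (hU : ∀ q ∈ S, Hol U q)
    (hJ : ∀ q ∈ S, jac Z U q ≠ 0) :
    ∃ T : OpenPartialHomeomorph (ℂ × ℂ) (ℂ × ℂ), q₀ ∈ T.source ∧ T.source ⊆ S ∧
      (∀ q, T q = (Z q, U q)) ∧ DifferentiableOn ℂ T T.source ∧
      DifferentiableOn ℂ T.symm T.target := by
  obtain ⟨e, he⟩ := exists_equiv_of_jac_ne (hJ q₀ hq₀)
  have hs : HasStrictFDerivAt (fun q => (Z q, U q)) (e : ℂ × ℂ →L[ℂ] ℂ × ℂ) q₀ := by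
    rw [he]
    exact (hZ q₀ hq₀).hasStrictFDerivAt.prodMk (hU q₀ hq₀).hasStrictFDerivAt
  -- Restricting to `S` keeps the Jacobian nonzero on the whole source, so that the inverse is
  -- holomorphic on the whole target.
  let T := (hs.toOpenPartialHomeomorph (fun q => (Z q, U q))).restrOpen S hS
  have hT : ∀ q, T q = (Z q, U q) := fun _ => rfl
  have hTS : T.source ⊆ S := fun q hq => hq.2
  have hd : ∀ q ∈ S, HasFDerivAt T ((fderiv ℂ Z q).prod (fderiv ℂ U q)) q := fun q hq =>
    (hZ q hq).differentiableAt.hasFDerivAt.prodMk (hU q hq).differentiableAt.hasFDerivAt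
  refine ⟨T, ⟨hs.mem_toOpenPartialHomeomorph_source, hq₀⟩, hTS, hT, fun q hq =>
    (hd q (hTS hq)).differentiableAt.differentiableWithinAt, fun y hy => ?_⟩
  have hy' : T.symm y ∈ S := hTS (T.map_target hy)
  obtain ⟨e', he'⟩ := exists_equiv_of_jac_ne (hJ _ hy')
  have := T.hasFDerivAt_symm hy (f' := e') (by rw [he']; exact hd _ hy')
  exact this.differentiableAt.differentiableWithinAt

/-- The components of a biholomorphic map have non-vanishing Jacobian. -/
theorem jac_ne_zero {T : OpenPartialHomeomorph (ℂ × ℂ) (ℂ × ℂ)}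
    (hT : DifferentiableOn ℂ T T.source) (hT' : DifferentiableOn ℂ T.symm T.target)
    {q : ℂ × ℂ} (hq : q ∈ T.source) :
    jac (fun x => (T x).1) (fun x => (T x).2) q ≠ 0 := by
  intro hJ
  have h1 : DifferentiableAt ℂ T q := hT.differentiableAt (T.open_source.mem_nhds hq)
  have h2 : DifferentiableAt ℂ T.symm (T q) :=
    hT'.differentiableAt (T.open_target.mem_nhds (T.map_source hq))
  have h3 : HasFDerivAt (fun x => x) ((fderiv ℂ T.symm (T q)).comp (fderiv ℂ T q)) q := by
    refine (h2.hasFDerivAt.comp q h1.hasFDerivAt).congr_of_eventuallyEq ?_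
    filter_upwards [T.eventually_left_inverse hq] with x hx using hx.symm
  have h4 := h3.unique (hasFDerivAt_id q)
  have hinj : ∀ v, fderiv ℂ T q v = 0 → v = 0 := by
    intro v hv
    have := congrArg (fun l => l v) h4
    simpa [hv] using this.symm
  have hcomp : ∀ v, fderiv ℂ T q v = (v.1 * Dz (fun x => (T x).1) q + v.2 * Du (fun x => (T x).1) q,
      v.1 * Dz (fun x => (T x).2) q + v.2 * Du (fun x => (T x).2) q) := by
    intro v
    have h5 : fderiv ℂ (fun x => (T x).1) q v = (fderiv ℂ T q v).1 := by
      rw [h1.hasFDerivAt.fst.fderiv]; rfl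
    have h6 : fderiv ℂ (fun x => (T x).2) q v = (fderiv ℂ T q v).2 := by
      rw [h1.hasFDerivAt.snd.fderiv]; rfl
    rw [fderiv_apply_eq] at h5 h6
    exact Prod.ext h5.symm h6.symm
  simp only [jac] at hJ
  -- If the Jacobian vanished, `(Z_u, -Z_z)` and `(U_u, -U_z)` would lie in the kernel of the
  -- injective derivative. Then all four partial derivatives are zero, which puts `(1, 0)` in the
  -- kernel.
  have k1 := hinj (Du (fun x => (T x).1) q, -Dz (fun x => (T x).1) q) (by
    rw [hcomp]
    refine Prod.ext ?_ ?_
    · simp only [Prod.fst_zero]; ring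
    · simp only [Prod.snd_zero]; linear_combination -hJ)
  have k2 := hinj (Du (fun x => (T x).2) q, -Dz (fun x => (T x).2) q) (by
    rw [hcomp]
    refine Prod.ext ?_ ?_
    · simp only [Prod.fst_zero]; linear_combination hJ
    · simp only [Prod.snd_zero]; ring)
  simp only [Prod.mk_eq_zero, neg_eq_zero] at k1 k2
  have k3 := hinj (1, 0) (by rw [hcomp]; simp [k1.2, k2.2])
  simp at k3

end PointTransformations

/-! ### The criterion -/

section Criterion

/-- The complex right-hand side `w₁ + i w₂`. -/
def rhs (w₁ w₂ : Fun6) (z u p : ℂ) : ℂ :=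
  ⟨w₁ z.re z.im u.re u.im p.re p.im, w₂ z.re z.im u.re u.im p.re p.im⟩

/-- The complex function of `(z, u)` with real part `k₁` and imaginary part `k₂`. -/
def complexify (k₁ k₂ : Fun4) (q : ℂ × ℂ) : ℂ := ⟨evalAt k₁ q, evalAt k₂ q⟩

theorem cubic_iff {A B C D : ℂ} {w₁ w₂ h l : ℝ} :
    (4 * w₁ = 4 * A.re * h ^ 3 - 12 * A.re * h * l ^ 2 - 12 * A.im * h ^ 2 * l
        + 4 * A.im * l ^ 3 + 4 * B.re * h ^ 2 - 4 * B.re * l ^ 2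
        - 8 * B.im * h * l + 4 * C.re * h - 4 * C.im * l + 4 * D.re ∧
    4 * w₂ = 12 * A.re * h ^ 2 * l - 4 * A.re * l ^ 3 + 4 * A.im * h ^ 3
        - 12 * A.im * h * l ^ 2 + 8 * B.re * h * l + 4 * B.im * h ^ 2
        - 4 * B.im * l ^ 2 + 4 * C.im * h + 4 * C.re * l + 4 * D.im) ↔
    (⟨w₁, w₂⟩ : ℂ) = cubicForm A B C D 1 ⟨h, l⟩ := by
  have h1 : (cubicForm A B C D 1 ⟨h, l⟩).re = A.re * h ^ 3 - 3 * A.re * h * l ^ 2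
      - 3 * A.im * h ^ 2 * l + A.im * l ^ 3 + B.re * h ^ 2 - B.re * l ^ 2
      - 2 * B.im * h * l + C.re * h - C.im * l + D.re := by
    simp [cubicForm, pow_succ]; ring
  have h2 : (cubicForm A B C D 1 ⟨h, l⟩).im = 3 * A.re * h ^ 2 * l - A.re * l ^ 3 + A.im * h ^ 3
      - 3 * A.im * h * l ^ 2 + 2 * B.re * h * l + B.im * h ^ 2
      - B.im * l ^ 2 + C.im * h + C.re * l + D.im := by
    simp [cubicForm, pow_succ]; ring
  rw [Complex.ext_iff, h1, h2]
  refine and_congr ?_ ?_ <;> constructor <;> intro h <;> linarith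

theorem isCubic_iff {W : Set (ℂ × ℂ × ℂ)} {w₁ w₂ : Fun6} {A₁ A₂ B₁ B₂ C₁ C₂ D₁ D₂ : Fun4} :
    IsCubic W w₁ w₂ A₁ A₂ B₁ B₂ C₁ C₂ D₁ D₂ ↔ ∀ z u p : ℂ, (z, u, p) ∈ W →
      rhs w₁ w₂ z u p = cubicForm (complexify A₁ A₂ (z, u)) (complexify B₁ B₂ (z, u))
        (complexify C₁ C₂ (z, u)) (complexify D₁ D₂ (z, u)) 1 p := by
  constructor
  · intro h z u p hp
    exact (cubic_iff (A := complexify A₁ A₂ (z, u)) (B := complexify B₁ B₂ (z, u))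
      (C := complexify C₁ C₂ (z, u)) (D := complexify D₁ D₂ (z, u))).1 (h z.re z.im u.re u.im p.re p.im hp)
  · intro h x y f g k l hp
    exact (cubic_iff (A := complexify A₁ A₂ (⟨x, y⟩, ⟨f, g⟩))
      (B := complexify B₁ B₂ (⟨x, y⟩, ⟨f, g⟩)) (C := complexify C₁ C₂ (⟨x, y⟩, ⟨f, g⟩))
      (D := complexify D₁ D₂ (⟨x, y⟩, ⟨f, g⟩))).2 (h ⟨x, y⟩ ⟨f, g⟩ ⟨k, l⟩ hp)

theorem isOpen_base {W : Set (ℂ × ℂ × ℂ)} (hW : IsOpen W) : IsOpen (base W) := by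
  have h : base W = ⋃ p : ℂ, (fun q : ℂ × ℂ => (q.1, q.2, p)) ⁻¹' W := by
    ext q; simp [base]
  rw [h]
  exact isOpen_iUnion fun p => hW.preimage (by fun_prop)

theorem isReIm₄_complexify (k₁ k₂ : Fun4) (q : ℂ × ℂ) : IsReIm₄ k₁ k₂ (complexify k₁ k₂) q :=
  Eventually.of_forall fun _ => ⟨rfl, rfl⟩

variable {W : Set (ℂ × ℂ × ℂ)} {w₁ w₂ : Fun6}

theorem satisfiesAt_iff_wr {A B C D : ℂ} {f g : ℝ → ℝ → ℝ} {x y : ℝ}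
    (hu : AnalyticAt ℂ (toComplex f g) ⟨x, y⟩)
    (hw : rhs w₁ w₂ ⟨x, y⟩ ⟨f x y, g x y⟩ (deriv (toComplex f g) ⟨x, y⟩) =
      cubicForm A B C D 1 (deriv (toComplex f g) ⟨x, y⟩)) :
    SatisfiesAt w₁ w₂ f g x y ↔ wr (fun s => s) (toComplex f g) ⟨x, y⟩ =
      cubicForm A B C D (deriv (fun s : ℂ => s) ⟨x, y⟩) (deriv (toComplex f g) ⟨x, y⟩) := by
  rw [satisfiesAt_iff w₁ w₂ hu, wr_graph, deriv_id'', ← hw, ← hh_ll_eq hu]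
  rfl

/-- Sufficiency of the criterion. -/
theorem complexLinearizable_of_constraints (hW : IsOpen W) {A₁ A₂ B₁ B₂ C₁ C₂ D₁ D₂ : Fun4}
    (hA : AnalyticPairOn (base W) A₁ A₂) (hB : AnalyticPairOn (base W) B₁ B₂)
    (hC : AnalyticPairOn (base W) C₁ C₂) (hD : AnalyticPairOn (base W) D₁ D₂)
    (hw : IsCubic W w₁ w₂ A₁ A₂ B₁ B₂ C₁ C₂ D₁ D₂)
    (hcon : Constraints (base W) A₁ A₂ B₁ B₂ C₁ C₂ D₁ D₂) : ComplexLinearizable W w₁ w₂ := by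
  intro q₀ hq₀
  have hΩ := isOpen_base hW
  have hol : ∀ {k₁ k₂ : Fun4}, AnalyticPairOn (base W) k₁ k₂ → ∀ q ∈ base W,
      Hol (complexify k₁ k₂) q := fun h q hq => Hol.of_differentiableOn h (hΩ.mem_nhds hq)
  have hlie : ∀ q ∈ base W, lie₁ (complexify A₁ A₂) (complexify B₁ B₂) (complexify C₁ C₂)
      (complexify D₁ D₂) q = 0 ∧ lie₂ (complexify A₁ A₂) (complexify B₁ B₂) (complexify C₁ C₂)
      (complexify D₁ D₂) q = 0 := fun q hq =>
    (constraints_iff (x := q.1.re) (y := q.1.im) (f := q.2.re) (g := q.2.im)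
      (isReIm₄_complexify _ _ _) (isReIm₄_complexify _ _ _) (isReIm₄_complexify _ _ _)
      (isReIm₄_complexify _ _ _) (hol hA q hq) (hol hB q hq) (hol hC q hq) (hol hD q hq)).1
      (hcon q.1.re q.1.im q.2.re q.2.im hq)
  obtain ⟨Z, U, hZ, hU, hJ, hM⟩ := exists_straightening (hol hA q₀ hq₀) (hol hB q₀ hq₀)
    (hol hC q₀ hq₀) (hol hD q₀ hq₀) (by
      filter_upwards [hΩ.mem_nhds hq₀] with q hq using (hlie q hq).1) (by
      filter_upwards [hΩ.mem_nhds hq₀] with q hq using (hlie q hq).2)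
  obtain ⟨S, hS, hSo, hq₀S⟩ := _root_.eventually_nhds_iff.1 (hZ.eventually.and (hU.eventually.and
    ((eventually_jac_ne hZ hU hJ).and hM)))
  obtain ⟨T, hqT, hTS, hT, hTd, hTs⟩ := exists_openPartialHomeomorph hSo hq₀S
    (fun q hq => (hS q hq).1) (fun q hq => (hS q hq).2.1) (fun q hq => (hS q hq).2.2.1)
  have hT1 : (fun q => (T q).1) = Z := funext fun q => by rw [hT]
  have hT2 : (fun q => (T q).2) = U := funext fun q => by rw [hT]
  -- The linear target can always be taken to be `U'' = 0`.
  refine ⟨T, fun _ => 0, fun _ => 0, fun _ => 0, hqT, hTd, hTs, differentiableOn_const _,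
    differentiableOn_const _, differentiableOn_const _, ?_⟩
  intro f g F G x y hu hsrc hWp htr
  obtain ⟨hZx, hUx, -, hMx⟩ := hS _ (hTS hsrc)
  rw [satisfiesAt_lin_iff hu (by rw [hT1]; exact hZx) (by rw [hT2]; exact hUx) htr]
  rw [hh_ll_eq hu] at hWp
  rw [satisfiesAt_iff_wr hu (isCubic_iff.1 hw _ _ _ hWp)]
  have h := hMx (fun s => s) (toComplex f g) ⟨x, y⟩ analyticAt_id hu rfl
  rw [← h]
  simp [hT, cubicForm]

/-- Near a point where the system is linearizable, it is a cubic equation that satisfies Lie's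
conditions. -/
theorem exists_local_coefficients (hW : IsOpen W)
    (hw : ContinuousOn (fun q : ℂ × ℂ × ℂ => rhs w₁ w₂ q.1 q.2.1 q.2.2) W) {q₀ : ℂ × ℂ}
    (hlin : ComplexLinearizableAt W w₁ w₂ q₀) :
    ∃ (S : Set (ℂ × ℂ)) (A B C D : ℂ × ℂ → ℂ), IsOpen S ∧ q₀ ∈ S ∧
      ∀ q ∈ S, (Hol A q ∧ Hol B q ∧ Hol C q ∧ Hol D q) ∧
        (lie₁ A B C D q = 0 ∧ lie₂ A B C D q = 0) ∧
        ∀ p, (q.1, q.2, p) ∈ W → rhs w₁ w₂ q.1 q.2 p = cubicForm (A q) (B q) (C q) (D q) 1 p := by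
  obtain ⟨T, a, b, c, hqT, hTd, hTs, ha, hb, hc, hall⟩ := hlin
  set Z : ℂ × ℂ → ℂ := fun q => (T q).1 with hZdef
  set U : ℂ × ℂ → ℂ := fun q => (T q).2 with hUdef
  have hsn : ∀ q ∈ T.source, T.source ∈ 𝓝 q := fun q hq => T.open_source.mem_nhds hq
  have hZ : ∀ q ∈ T.source, Hol Z q := fun q hq => Hol.of_differentiableOn hTd.fst (hsn q hq)
  have hU : ∀ q ∈ T.source, Hol U q := fun q hq => Hol.of_differentiableOn hTd.snd (hsn q hq)
  have hJ : ∀ q ∈ T.source, jac Z U q ≠ 0 := fun q hq => jac_ne_zero hTd hTs hq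
  have han : ∀ {d : ℂ → ℂ}, DifferentiableOn ℂ d (Prod.fst '' T.target) → ∀ q ∈ T.source,
      AnalyticAt ℂ d (Z q) := fun hd q hq =>
    hd.analyticAt ((isOpenMap_fst _ T.open_target).mem_nhds ⟨T q, T.map_source hq, rfl⟩)
  have hcomp : ∀ {d : ℂ → ℂ}, DifferentiableOn ℂ d (Prod.fst '' T.target) → ∀ q ∈ T.source,
      Hol (fun x => d (Z x)) q := fun hd q hq =>
    Hol.comp_pair (f := fun x => _) (Hol.comp_fst (q := (Z q, U q)) (han hd q hq)) (hZ q hq)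
      (hU q hq)
  obtain ⟨A, B, C, D, hhol, hpull⟩ := exists_pullback (S := T.source)
    (a := fun x => a (Z x)) (e := fun x => b (Z x) * U x + c (Z x)) hZ hU hJ (hcomp ha)
    (fun q hq => ((hcomp hb q hq).mul (hU q hq)).add (hcomp hc q hq))
  refine ⟨T.source, A, B, C, D, T.open_source, hqT, fun q hq => ⟨hhol q hq, ?_, ?_⟩⟩
  · refine lie_of_linearization (hZ q hq) (hU q hq) (hJ q hq) (han ha q hq) (han hb q hq)
      (han hc q hq) ?_
    filter_upwards [hsn q hq] with x hx
    rintro ζ υ t hζ hυ rfl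
    have h := hpull ζ υ t hζ hυ hx
    rw [← sub_eq_zero, h, mul_eq_zero, or_iff_right (hJ _ hx), sub_eq_zero]
  -- The test curve has slope `p` and second derivative `w` at `q`, so it satisfies the system
  -- there. Its image then satisfies the linear one, and the pullback formula yields the cubic. The
  -- excluded `p` is where `Z` fails to be a parameter.
  · have hgen : ∀ p, (q.1, q.2, p) ∈ W → Dz Z q + Du Z q * p ≠ 0 →
        rhs w₁ w₂ q.1 q.2 p = cubicForm (A q) (B q) (C q) (D q) 1 p := by
      intro p hp hne
      obtain ⟨υ, hυ, hυ0, hυ1, hυ2⟩ := exists_curve q p (rhs w₁ w₂ q.1 q.2 p)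
      have hid : AnalyticAt ℂ (fun s : ℂ => s) q.1 := analyticAt_id
      have hq' : (q.1, υ q.1) = q := by rw [hυ0]
      have hqs : (q.1, υ q.1) ∈ T.source := by rw [hq']; exact hq
      have hd : deriv (fun s => Z (s, υ s)) q.1 = Dz Z q + Du Z q * p := by
        rw [deriv_comp_pair (hZ _ hqs) hid hυ, hq', hυ1, deriv_id'']
        ring
      -- Inverting `Z` along the curve expresses `U` as a function of `Z`; this provides the pair
      -- `(F, G)`.
      obtain ⟨σ, hσ⟩ := exists_local_inverse (analyticAt_comp_pair (hZ _ hqs) hid hυ)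
        (by rw [hd]; exact hne)
      let V : ℂ → ℂ := fun w => U (σ w, υ (σ w))
      have hu : AnalyticAt ℂ (toComplex (fun x y => (υ ⟨x, y⟩).re) fun x y => (υ ⟨x, y⟩).im)
        ⟨q.1.re, q.1.im⟩ := hυ
      have htr : TransformsTo T (fun x y => (υ ⟨x, y⟩).re) (fun x y => (υ ⟨x, y⟩).im)
          (fun x y => (V ⟨x, y⟩).re) (fun x y => (V ⟨x, y⟩).im) q.1.re q.1.im := by
        refine ⟨?_, ?_⟩
        · show deriv (fun s => Z (s, υ s)) q.1 ≠ 0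
          rw [hd]; exact hne
        · show ∀ᶠ s in 𝓝 q.1, V (Z (s, υ s)) = U (s, υ s)
          filter_upwards [hσ] with s hs
          simp only [V, hs]
      have hval : (⟨hh (fun x y => (υ ⟨x, y⟩).re) (fun x y => (υ ⟨x, y⟩).im) q.1.re q.1.im,
          ll (fun x y => (υ ⟨x, y⟩).re) (fun x y => (υ ⟨x, y⟩).im) q.1.re q.1.im⟩ : ℂ) = p :=
        (hh_ll_eq hu).trans hυ1
      have hiff := hall _ _ _ _ q.1.re q.1.im hu hqs (by
        rw [hval]
        show (q.1, υ q.1, p) ∈ W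
        rw [hυ0]; exact hp) htr
      rw [satisfiesAt_lin_iff hu (hZ _ hqs) (hU _ hqs) htr, satisfiesAt_iff w₁ w₂ hu] at hiff
      have h1 : wr (fun s => Z (s, υ s)) (fun s => U (s, υ s)) q.1 =
          cubicForm 0 0 (a (Z (q.1, υ q.1))) (b (Z (q.1, υ q.1)) * U (q.1, υ q.1) +
            c (Z (q.1, υ q.1))) (deriv (fun s => Z (s, υ s)) q.1)
            (deriv (fun s => U (s, υ s)) q.1) := hiff.1 (by
        refine hυ2.trans ?_
        rw [rhs, ← hval, ← hυ0])
      have h2 := hpull (fun s => s) υ q.1 hid hυ hqs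
      rw [sub_eq_zero.2 h1, eq_comm, mul_eq_zero, or_iff_right (hJ _ hqs), sub_eq_zero, wr_graph,
        hυ2, hυ1, deriv_id'', hq'] at h2
      exact h2
    intro p hp
    -- At an exceptional slope `Z_u ≠ 0`, since otherwise the Jacobian would vanish. The slope is
    -- therefore isolated, and continuity of both sides extends the identity to it.
    by_cases hne : Dz Z q + Du Z q * p = 0
    · have hZu : Du Z q ≠ 0 := by
        intro h0
        rw [h0, zero_mul, add_zero] at hne
        exact hJ q hq (by simp [jac, h0, hne])
      have hc1 : ContinuousAt (fun p => rhs w₁ w₂ q.1 q.2 p) p :=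
        ContinuousAt.comp (f := fun p : ℂ => (q.1, q.2, p)) (hw.continuousAt (hW.mem_nhds hp))
          (by fun_prop)
      have hc2 : ContinuousAt (fun p => cubicForm (A q) (B q) (C q) (D q) 1 p) p := by
        unfold cubicForm; fun_prop
      have hWp : ∀ᶠ r in 𝓝 p, (q.1, q.2, r) ∈ W := by
        have : ContinuousAt (fun p : ℂ => (q.1, q.2, p)) p := by fun_prop
        exact this.eventually (hW.mem_nhds hp)
      refine tendsto_nhds_unique_of_eventuallyEq (hc1.tendsto.mono_left nhdsWithin_le_nhds)
        (hc2.tendsto.mono_left (nhdsWithin_le_nhds (s := {p}ᶜ))) ?_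
      filter_upwards [nhdsWithin_le_nhds hWp, self_mem_nhdsWithin] with r hr hrp
      refine hgen r hr fun h0 => hrp ?_
      have : Du Z q * (r - p) = 0 := by linear_combination h0 - hne
      exact sub_eq_zero.1 ((mul_eq_zero.1 this).resolve_left hZu)
    · exact hgen p hp hne

/-- Necessity of the criterion. -/
theorem exists_coefficients (hW : IsOpen W)
    (hw : ContinuousOn (fun q : ℂ × ℂ × ℂ => rhs w₁ w₂ q.1 q.2.1 q.2.2) W)
    (hlin : ComplexLinearizable W w₁ w₂) :
    ∃ A B C D : ℂ × ℂ → ℂ, ∀ q ∈ base W, (Hol A q ∧ Hol B q ∧ Hol C q ∧ Hol D q) ∧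
      (lie₁ A B C D q = 0 ∧ lie₂ A B C D q = 0) ∧
      ∀ p, (q.1, q.2, p) ∈ W → rhs w₁ w₂ q.1 q.2 p = cubicForm (A q) (B q) (C q) (D q) 1 p := by
  classical
  have hloc : ∀ q : ℂ × ℂ, ∃ (S : Set (ℂ × ℂ)) (A B C D : ℂ × ℂ → ℂ), q ∈ base W → IsOpen S ∧
      q ∈ S ∧ ∀ x ∈ S, (Hol A x ∧ Hol B x ∧ Hol C x ∧ Hol D x) ∧
        (lie₁ A B C D x = 0 ∧ lie₂ A B C D x = 0) ∧
        ∀ p, (x.1, x.2, p) ∈ W → rhs w₁ w₂ x.1 x.2 p = cubicForm (A x) (B x) (C x) (D x) 1 p := by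
    intro q
    by_cases hq : q ∈ base W
    · obtain ⟨S, A, B, C, D, h⟩ := exists_local_coefficients hW hw (hlin q hq)
      exact ⟨S, A, B, C, D, fun _ => h⟩
    · exact ⟨∅, fun _ => 0, fun _ => 0, fun _ => 0, fun _ => 0, fun h => absurd h hq⟩
  choose S A B C D h using hloc
  -- The global coefficients are the diagonal values of the local ones. Near `q` they coincide with
  -- the local coefficients chosen at `q`, since two cubics that agree on the nonempty open fibre of
  -- `W` are equal; holomorphy and Lie's conditions carry over.
  refine ⟨fun q => A q q, fun q => B q q, fun q => C q q, fun q => D q q, fun q hq => ?_⟩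
  obtain ⟨hSo, hqS, hx⟩ := h q hq
  have hagree : ∀ᶠ x in 𝓝 q, A q x = A x x ∧ B q x = B x x ∧ C q x = C x x ∧ D q x = D x x := by
    filter_upwards [hSo.mem_nhds hqS, (isOpen_base hW).mem_nhds hq] with x hxS hxW
    obtain ⟨-, hxSx, hxx⟩ := h x hxW
    refine cubicForm_inj_of_isOpen (O := {p | (x.1, x.2, p) ∈ W}) (hW.preimage (by fun_prop)) hxW
      fun p hp => ?_
    rw [← (hx x hxS).2.2 p hp, ← (hxx x hxSx).2.2 p hp]
  obtain ⟨⟨kA, kB, kC, kD⟩, hl, hc⟩ := hx q hqS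
  have eA : A q =ᶠ[𝓝 q] fun x => A x x := hagree.mono fun _ h => h.1
  have eB : B q =ᶠ[𝓝 q] fun x => B x x := hagree.mono fun _ h => h.2.1
  have eC : C q =ᶠ[𝓝 q] fun x => C x x := hagree.mono fun _ h => h.2.2.1
  have eD : D q =ᶠ[𝓝 q] fun x => D x x := hagree.mono fun _ h => h.2.2.2
  refine ⟨⟨kA.congr eA, kB.congr eB, kC.congr eC, kD.congr eD⟩, ?_, hc⟩
  rw [← (lie_congr eA eB eC eD).1, ← (lie_congr eA eB eC eD).2]
  exact hl

theorem continuousOn_rhs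
    (hw₁ : ContinuousOn (fun q : ℂ × ℂ × ℂ =>
      w₁ q.1.re q.1.im q.2.1.re q.2.1.im q.2.2.re q.2.2.im) W)
    (hw₂ : ContinuousOn (fun q : ℂ × ℂ × ℂ =>
      w₂ q.1.re q.1.im q.2.1.re q.2.1.im q.2.2.re q.2.2.im) W) :
    ContinuousOn (fun q : ℂ × ℂ × ℂ => rhs w₁ w₂ q.1 q.2.1 q.2.2) W := by
  have h : (fun q : ℂ × ℂ × ℂ => rhs w₁ w₂ q.1 q.2.1 q.2.2) = fun q =>
      ((w₁ q.1.re q.1.im q.2.1.re q.2.1.im q.2.2.re q.2.2.im : ℝ) : ℂ) +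
      ((w₂ q.1.re q.1.im q.2.1.re q.2.1.im q.2.2.re q.2.2.im : ℝ) : ℂ) * Complex.I := by
    funext q
    apply Complex.ext <;> simp [rhs]
  rw [h]
  exact (Complex.continuous_ofReal.comp_continuousOn hw₁).add
    ((Complex.continuous_ofReal.comp_continuousOn hw₂).mul continuousOn_const)

end Criterion

end ComplexLin

theorem theorem1 (W : Set (ℂ × ℂ × ℂ)) (hW : IsOpen W) (w₁ w₂ : ComplexLin.Fun6)
    (hw₁ : ContinuousOn (fun q : ℂ × ℂ × ℂ =>
      w₁ q.1.re q.1.im q.2.1.re q.2.1.im q.2.2.re q.2.2.im) W)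
    (hw₂ : ContinuousOn (fun q : ℂ × ℂ × ℂ =>
      w₂ q.1.re q.1.im q.2.1.re q.2.1.im q.2.2.re q.2.2.im) W) :
    ComplexLin.ComplexLinearizable W w₁ w₂ ↔
      ∃ A₁ A₂ B₁ B₂ C₁ C₂ D₁ D₂ : ComplexLin.Fun4,
        ComplexLin.AnalyticPairOn (ComplexLin.base W) A₁ A₂ ∧
        ComplexLin.AnalyticPairOn (ComplexLin.base W) B₁ B₂ ∧
        ComplexLin.AnalyticPairOn (ComplexLin.base W) C₁ C₂ ∧
        ComplexLin.AnalyticPairOn (ComplexLin.base W) D₁ D₂ ∧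
        ComplexLin.IsCubic W w₁ w₂ A₁ A₂ B₁ B₂ C₁ C₂ D₁ D₂ ∧
        ComplexLin.Constraints (ComplexLin.base W) A₁ A₂ B₁ B₂ C₁ C₂ D₁ D₂ := by
  constructor
  · intro h
    obtain ⟨A, B, C, D, hq⟩ :=
      ComplexLin.exists_coefficients hW (ComplexLin.continuousOn_rhs hw₁ hw₂) h
    refine ⟨fun x y f g => (A (⟨x, y⟩, ⟨f, g⟩)).re, fun x y f g => (A (⟨x, y⟩, ⟨f, g⟩)).im,
      fun x y f g => (B (⟨x, y⟩, ⟨f, g⟩)).re, fun x y f g => (B (⟨x, y⟩, ⟨f, g⟩)).im,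
      fun x y f g => (C (⟨x, y⟩, ⟨f, g⟩)).re, fun x y f g => (C (⟨x, y⟩, ⟨f, g⟩)).im,
      fun x y f g => (D (⟨x, y⟩, ⟨f, g⟩)).re, fun x y f g => (D (⟨x, y⟩, ⟨f, g⟩)).im,
      fun q h => (hq q h).1.1.differentiableAt.differentiableWithinAt,
      fun q h => (hq q h).1.2.1.differentiableAt.differentiableWithinAt,
      fun q h => (hq q h).1.2.2.1.differentiableAt.differentiableWithinAt,
      fun q h => (hq q h).1.2.2.2.differentiableAt.differentiableWithinAt,
      ComplexLin.isCubic_iff.2 fun z u p hp => (hq (z, u) ⟨p, hp⟩).2.2 p hp, ?_⟩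
    intro x y f g hΩ
    obtain ⟨⟨kA, kB, kC, kD⟩, hl, -⟩ := hq _ hΩ
    have hri : ∀ (K : ℂ × ℂ → ℂ) q, ComplexLin.IsReIm₄ (fun x y f g => (K (⟨x, y⟩, ⟨f, g⟩)).re)
        (fun x y f g => (K (⟨x, y⟩, ⟨f, g⟩)).im) K q :=
      fun K q => Filter.Eventually.of_forall fun _ => ⟨rfl, rfl⟩
    exact (ComplexLin.constraints_iff (hri A _) (hri B _) (hri C _) (hri D _) kA kB kC kD).2 hl
  · rintro ⟨A₁, A₂, B₁, B₂, C₁, C₂, D₁, D₂, hA, hB, hC, hD, hw, hcon⟩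
    exact ComplexLin.complexLinearizable_of_constraints hW hA hB hC hD hw hcon
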